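/- **Notation.** Let $\mathbb{O}$ (octonions) and $\mathbb{O}'$ (split octonions) be the algebras of pairs of quaternions $a+b\ell$ with product $(a+b\ell)(c+d\ell)=(ac+\varepsilon\bar d b)+(da+b\bar c)\ell$, conjugation $\overline{a+b\ell}=\bar a-b\ell$, and $\varepsilon=\ell^2=-1$ for $\mathbb{O}$, $\varepsilon=+1$ for $\mathbb{O}'$. Their imaginary units are $\mathcal U=\{i,j,k,k\ell,j\ell,i\ell,\ell\}$ for $\mathbb{O}$ and $\{I,J,K,KL,JL,IL,L\}$ for $\mathbb{O}'$. Let $\mathbb{C}'=\mathbb{R}\oplus\mathbb{R}L\subset\mathbb{O}'$ and $\langle x,y\rangle=\mathrm{Re}(x\bar y)$. For $K\in\{\mathbb{C}',\mathbb{O},\mathbb{O}'\}$, let $\mathfrak{tri}(K)$ be the Lie algebra of triples $(\varphi_0,\varphi_1,\varphi_2)$ (indices mod 3) of $\langle\cdot,\cdot\rangle$-skew endomorphisms of $K$ with $\varphi_{i+2}(\overline{xy})=\overline{\varphi_i(x)y}+\overline{x\varphi_{i+1}(y)}$. For $x,y\in K$ let $T_i(x,y)\in\mathfrak{tri}(K)$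 be the triple whose components with index $i,i+1,i+2$ are $r\mapsto 4\langle x,r\rangle y-4\langle y,r\rangle x$, $\ r\mapsto\overline{\overline{xr}\,y}-\overline{\overline{yr}\,x}$, $\ r\mapsto\overline{y\,\overline{rx}}-\overline{x\,\overline{ry}}$. The Lie algebra $\mathfrak{su}(3,K_1\otimes K_2)$ is $$\mathfrak{tri}(K_1)\oplus\mathfrak{tri}(K_2)\oplus\{X_u\}\oplus\{Y_u\}\oplus\{Z_u\},\qquad u\in K_1\otimes K_2 .$$ Here $\mathfrak{tri}(K_1)\oplus\mathfrak{tri}(K_2)$ is a subalgebra, whose elements act on $X_u,Y_u,Z_u$ through their components of index $0,1,2$. With $\overline{x\otimes x'}=\bar x\otimes\bar x'$, $$[X_u,Y_v]=Z_{-\overline{uv}},\quad [Y_u,Z_v]=X_{-\overline{uv}},\quad [Z_u,X_v]=Y_{-\overline{uv}} .$$ For two elements of the same type, say $X$ ($i=0$; similarly $Y$, $i=1$, and $Z$, $i=2$), $$[X_{x\otimes x'},X_{y\otimes y'}]=\langle x',y'\rangle T_0(x,y)+\langle x,y\rangle T_0(x',y').$$ Put $\mathfrak{e}_8=\mathfrak{e}_{8(-24)}=\mathfrak{su}(3,\mathbb{O}'\otimes\mathbb{O})$.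 Define $$D_u=\tfrac12[X_1,X_u],\quad E_u=\tfrac12[Y_1,Y_u],\quad F_u=\tfrac12[Z_1,Z_u],\quad S_u=E_u-F_u,\quad D_{u,v}=\tfrac12[X_u,X_v].$$ For an imaginary unit $p$ of $\mathbb{O}$ put $$A_p=-(D_{a(p)}-D_{b(p)}),\qquad G_p=-(D_{a(p)}+D_{b(p)}-2D_{c(p)}),$$ where $D_{(u,v)}=D_{u,v}$ and $a(p),b(p),c(p)$ are the following pairs of units: | $p$ | $i$ | $j$ | $k$ | $k\ell$ | $j\ell$ | $i\ell$ | $\ell$ | |---|---|---|---|---|---|---|---| | $a(p)$ | $(j,k)$ | $(k,i)$ | $(i,j)$ | $(j\ell,i)$ | $(i\ell,k)$ | $(k\ell,j)$ | $(i\ell,i)$ | | $b(p)$ | $(k\ell,j\ell)$ | $(i\ell,k\ell)$ | $(j\ell,i\ell)$ | $(j,i\ell)$ | $(i,k\ell)$ | $(k,j\ell)$ | $(j\ell,j)$ | | $c(p)$ | $(\ell,i\ell)$ | $(\ell,j\ell)$ | $(\ell,k\ell)$ | $(k,\ell)$ | $(j,\ell)$ | $(i,\ell)$ | $(k\ell,k)$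 | The product of each pair is $p$. For an imaginary unit $Q$ of $\mathbb{O}'$, define $A_Q,G_Q$ by the same formulas with capital letters, where for $Q\in\{I,J,K\}$ the two members of $b(Q)$ and of $c(Q)$ are interchanged, so that the product of each pair is again $Q$. For $Q\in\{I,J,K,KL,JL,IL\}$ consider the 27 elements labelled by $Q$: $X_{pQ},Y_{pQ},Z_{pQ}$ ($p\in\{1\}\cup\mathcal U$), $D_Q,S_Q,G_Q$. Let $W_Q$ be their span. They are extended linearly in the label to $Q=\frac12(N+sNL)$, where $N\in\{I,J,K\}$, $s=\pm1$, and $H_{N,s}$ is the span of the 27 elements so labelled. (These six labels are null elements of $\mathbb{O}'$.) Let $\mathbb{A}$ be the space of $3\times3$ octonionic Hermitian matrices (the Albert algebra). Let $\mathfrak{sl}(3,\mathbb{O})=\mathfrak{e}_{6(-26)}$ be the Lie algebra of all endomorphisms of $\mathbb{A}$ that leave the determinant infinitesimally invariant. **Theorem.** In $\mathfrak{e}_8$, where $p\in\mathcal U$, $q\in\{1\}\cup\mathcal U$: 1. The 78 elements $A_p,G_p,S_p,D_p,X_q,Y_q,Z_q,X_{qL},Y_{qL},Z_{qL},D_L,S_L$,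 the 8 elements $A_L,G_L,A_Q$ ($Q\in\{I,J,K,KL,JL,IL\}$) and the remaining $162=6\cdot27$ elements labelled by $Q\in\{I,J,K,KL,JL,IL\}$ form a basis of $\mathfrak{e}_8$; in particular $\dim\mathfrak{e}_8=248$. 2. The 28 elements $A_p,G_p,S_p,D_p$ span a Lie subalgebra of dimension 28 isomorphic to $\mathfrak{so}(8)$. Together with $X_q,Y_q,Z_q$ they span a Lie subalgebra $\mathfrak{f}_4$ of dimension 52. 3. The 78 elements span a Lie subalgebra $\mathfrak{e}_6$ of dimension 78, and there is an isomorphism $\mathfrak{su}(3,\mathbb{C}'\otimes\mathbb{O})\to\mathfrak{e}_6$ which is the natural inclusion on the elements $X_u,Y_u,Z_u$. 4. The centralizer of $\mathfrak{e}_6$ in $\mathfrak{e}_8$ is the span of $A_L$, $G_L$ and $A_Q$ ($Q\in\{I,J,K,KL,JL,IL\}$). It has dimension 8 and is isomorphic to $\mathfrak{sl}(3,\mathbb{R})$. It consists precisely of the elements of $\mathfrak{g}_{2(2)}=\mathfrak{der}(\mathbb{O}')$ (a derivation $d$ being identified with $(d,d,d)\in\mathfrak{tri}(\mathbb{O}')$)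 that annihilate $L$. 5. Each $H_{N,s}$ has dimension 27 and is invariant under $\mathfrak{e}_6$, and as a vector space $$\mathfrak{e}_8=\mathfrak{e}_6\oplus\mathfrak{sl}(3,\mathbb{R})\oplus\bigoplus_{N\in\{I,J,K\},\,s=\pm1}H_{N,s},\qquad 248=78+8+6\times27 .$$ Moreover $H_{N,1}+H_{N,-1}=W_N+W_{NL}$. Each $W_Q$, for $Q$ one of the six units, has dimension 27 and is invariant under $\mathfrak{f}_4$. For each sign $s$ the sum $H_{I,s}+H_{J,s}+H_{K,s}$ is invariant under the centralizer $\mathfrak{sl}(3,\mathbb{R})$. 6. There is an isomorphism $\mathfrak{e}_6\cong\mathfrak{e}_{6(-26)}=\mathfrak{sl}(3,\mathbb{O})$ under which $\mathfrak{f}_4$ corresponds to the annihilator of the identity matrix in $\mathbb{A}$ and under which, as $\mathfrak{e}_6$-modules, the three $H_{N,1}$ are isomorphic to $\mathbb{A}$ and the three $H_{N,-1}$ to the dual of $\mathbb{A}$. -/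

import Mathlib

open scoped TensorProduct Quaternion

attribute [local instance 100] LieRing.ofAssociativeRing

noncomputable section

/-- The structure of a real composition algebra (`ℂ'`, `𝕆`, `𝕆'` below): a bilinear product with
unit, the conjugation and the real part, with the usual identities. -/
class CompAlg (K : Type) [AddCommGroup K] [Module ℝ K] where
  mul : K →ₗ[ℝ] K →ₗ[ℝ] K
  one : K
  conj : K →ₗ[ℝ] K
  re : K →ₗ[ℝ] ℝ
  one_mul : ∀ x, mul one x = x
  mul_one : ∀ x, mul x one = x
  conj_conj : ∀ x, conj (conj x) = x
  conj_mul : ∀ x y, conj (mul x y) = mul (conj y) (conj x)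
  add_conj : ∀ x, x + conj x = (2 * re x) • one
  re_conj : ∀ x, re (conj x) = re x
  re_mul_comm : ∀ x y, re (mul x y) = re (mul y x)
  re_mul_assoc : ∀ x y z, re (mul (mul x y) z) = re (mul x (mul y z))
  conj_mul_mul : ∀ x y z,
    mul (conj z) (mul x y) + mul (conj x) (mul z y) = (2 * re (mul x (conj z))) • y
  mul_mul_conj : ∀ x y z,
    mul (mul y z) (conj x) + mul (mul y x) (conj z) = (2 * re (mul x (conj z))) • y

namespace CompAlg

variable {K : Type} [AddCommGroup K] [Module ℝ K] [CompAlg K]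

/-- The polarized norm `⟨x, y⟩ = Re (x ȳ)`. -/
def ip : K →ₗ[ℝ] K →ₗ[ℝ] ℝ :=
  LinearMap.mk₂ ℝ (fun x y : K => re (mul x (conj y))) (by simp) (by simp) (by simp) (by simp)

/-- The conjugated product `x, y ↦ \overline{x y}`. -/
def tm : K →ₗ[ℝ] K →ₗ[ℝ] K :=
  LinearMap.mk₂ ℝ (fun x y : K => conj (mul x y)) (by simp) (by simp) (by simp) (by simp)

lemma ip_apply (x y : K) : ip x y = re (mul x (conj y)) := rfl

lemma tm_apply (x y : K) : tm x y = conj (mul x y) := rfl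

lemma ip_comm (x y : K) : ip x y = ip y x := by
  rw [ip_apply, ip_apply, ← re_conj, conj_mul, conj_conj]

lemma ip_tm (x y z : K) : ip (tm x y) z = ip x (tm y z) := by
  rw [ip_apply, ip_apply, tm_apply, tm_apply, conj_conj, ← conj_mul, re_conj, re_mul_comm,
    re_mul_assoc]

lemma tm_left (x y z : K) : tm (tm x y) z + tm (tm z y) x = (2 * ip x z) • y := by
  simp only [tm_apply, ip_apply]
  rw [conj_mul, conj_conj, conj_mul, conj_conj, conj_mul_mul]

lemma tm_right (x y z : K) : tm x (tm y z) + tm z (tm y x) = (2 * ip x z) • y := by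
  simp only [tm_apply, ip_apply]
  rw [conj_mul, conj_conj, conj_mul (K := K) z, conj_conj, mul_mul_conj]

variable (K) in
/-- The triality algebra of `K`: triples of skew endomorphisms, acting on the three off-diagonal
positions (types I, II, III), that are compatible with the brackets
`[F_i(x), F_{i+1}(y)] = -F_{i+2}(\overline{x y})` of the off-diagonal elements. -/
def triSub : LieSubalgebra ℝ (Fin 3 → Module.End ℝ K) where
  carrier := {φ | (∀ i x y, ip (φ i x) y + ip x (φ i y) = 0) ∧
    ∀ i x y, φ (i + 2) (tm x y) = tm (φ i x) y + tm x (φ (i + 1) y)}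
  add_mem' := by
    rintro a b ⟨ha, ha'⟩ ⟨hb, hb'⟩
    refine ⟨fun i x y => ?_, fun i x y => ?_⟩
    · have := ha i x y
      have := hb i x y
      simp only [Pi.add_apply, LinearMap.add_apply, map_add]
      linarith
    · simp only [Pi.add_apply, LinearMap.add_apply, map_add, ha', hb']
      abel
  zero_mem' := by simp
  smul_mem' := by
    rintro c a ⟨ha, ha'⟩
    refine ⟨fun i x y => ?_, fun i x y => ?_⟩
    · have := ha i x y
      simp only [Pi.smul_apply, LinearMap.smul_apply, map_smul, smul_eq_mul]
      linear_combination c * this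
    · simp only [Pi.smul_apply, LinearMap.smul_apply, map_smul, ha', smul_add]
  lie_mem' := by
    rintro a b ⟨ha, ha'⟩ ⟨hb, hb'⟩
    refine ⟨fun i x y => ?_, fun i x y => ?_⟩
    · have h1 := ha i (b i x) y
      have h2 := hb i x (a i y)
      have h3 := hb i (a i x) y
      have h4 := ha i x (b i y)
      simp only [Ring.lie_def, Pi.sub_apply, Pi.mul_apply, LinearMap.sub_apply,
        Module.End.mul_apply, map_sub]
      linarith
    · simp only [Ring.lie_def, Pi.sub_apply, Pi.mul_apply, LinearMap.sub_apply,
        Module.End.mul_apply, map_sub, ha', hb', map_add]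
      abel

variable (K) in
/-- The triality algebra of `K` as a type. -/
def Tri : Type := triSub K

instance : LieRing (Tri K) := inferInstanceAs (LieRing (triSub K))

instance : LieAlgebra ℝ (Tri K) := inferInstanceAs (LieAlgebra ℝ (triSub K))

/-- The three components of an element of the triality algebra. -/
def Tri.app (φ : Tri K) (i : Fin 3) : Module.End ℝ K := Subtype.val (p := (· ∈ triSub K)) φ i

@[ext]
lemma Tri.ext {φ ψ : Tri K} (h : ∀ i r, φ.app i r = ψ.app i r) : φ = ψ :=
  Subtype.ext (funext fun i => LinearMap.ext (h i))

lemma Tri.skew (φ : Tri K) (i : Fin 3) (x y : K) : ip (φ.app i x) y + ip x (φ.app i y) = 0 :=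
  φ.2.1 i x y

lemma Tri.app_tm (φ : Tri K) (i : Fin 3) (x y : K) :
    φ.app (i + 2) (tm x y) = tm (φ.app i x) y + tm x (φ.app (i + 1) y) :=
  φ.2.2 i x y

lemma Tri.app_add (φ ψ : Tri K) (i : Fin 3) : (φ + ψ).app i = φ.app i + ψ.app i := rfl

lemma Tri.app_smul (c : ℝ) (φ : Tri K) (i : Fin 3) : (c • φ).app i = c • φ.app i := rfl

lemma Tri.app_lie (φ ψ : Tri K) (i : Fin 3) (r : K) :
    ⁅φ, ψ⁆.app i r = φ.app i (ψ.app i r) - ψ.app i (φ.app i r) := rfl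

/-- The `k`-th component of the diagonal element `[X_x, X_y]`: its action on the off-diagonal
elements of type I, II, III for `k = 0, 1, 2`. -/
def tFun (k : Fin 3) (x y r : K) : K :=
  match k with
  | 0 => (4 * ip x r) • y - (4 * ip y r) • x
  | 1 => tm (tm x r) y - tm (tm y r) x
  | 2 => tm y (tm r x) - tm x (tm r y)

/-- `tFun` as a linear map in the last variable. -/
def tEnd (k : Fin 3) (x y : K) : Module.End ℝ K where
  toFun := tFun k x y
  map_add' r s := by
    fin_cases k <;> simp [tFun, mul_add, add_smul] <;> abel
  map_smul' c r := by
    fin_cases k <;> simp [tFun, smul_sub, smul_smul, mul_left_comm]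

lemma tEnd_zero (x y r : K) : tEnd 0 x y r = (4 * ip x r) • y - (4 * ip y r) • x := rfl

lemma tEnd_one (x y r : K) : tEnd 1 x y r = tm (tm x r) y - tm (tm y r) x := rfl

lemma tEnd_two (x y r : K) : tEnd 2 x y r = tm y (tm r x) - tm x (tm r y) := rfl

lemma tEnd_skew (k : Fin 3) (x y r s : K) : ip (tEnd k x y r) s + ip r (tEnd k x y s) = 0 := by
  fin_cases k
  · simp only [Fin.zero_eta, tEnd_zero, map_sub, map_smul, LinearMap.sub_apply,
      LinearMap.smul_apply, smul_eq_mul]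
    rw [ip_comm r y, ip_comm r x]
    ring
  · simp only [Fin.mk_one, tEnd_one, map_sub, LinearMap.sub_apply]
    rw [ip_comm r (tm _ _), ip_comm r (tm _ _), ip_tm (tm x r), ip_tm (tm y r), ip_tm (tm x s),
      ip_tm (tm y s), ip_comm (tm x s), ip_comm (tm y s)]
    ring
  · simp only [Fin.reduceFinMk, tEnd_two, map_sub, LinearMap.sub_apply]
    rw [ip_comm (tm y _), ip_comm (tm x _), ← ip_tm s, ← ip_tm s, ← ip_tm r, ← ip_tm r,
      ip_comm (tm s y), ip_comm (tm s x)]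
    ring

lemma tEnd_tm (k : Fin 3) (x y r s : K) :
    tEnd (k + 2) x y (tm r s) = tm (tEnd k x y r) s + tm r (tEnd (k + 1) x y s) := by
  fin_cases k
  · simp only [Fin.zero_eta, zero_add, tEnd_zero, tEnd_one, tEnd_two, map_sub, map_smul,
      LinearMap.sub_apply, LinearMap.smul_apply]
    have h1 := congrArg (tm y) (tm_left r s x)
    have h2 := congrArg (tm x) (tm_left r s y)
    have h3 := tm_right y (tm x s) r
    have h4 := tm_right x (tm y s) r
    simp only [map_add, map_smul] at h1 h2
    rw [ip_comm x r, ip_comm y r]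
    rw [ip_comm y r] at h3
    rw [ip_comm x r] at h4
    linear_combination (norm := module) h1 - h2 - h3 + h4
  · have e : (1 : Fin 3) + 2 = 0 := rfl
    have e' : (1 : Fin 3) + 1 = 2 := rfl
    simp only [Fin.mk_one, e, e', tEnd_zero, tEnd_one, tEnd_two, map_sub, LinearMap.sub_apply]
    have h1 := tm_left (tm x r) y s
    have h2 := tm_left (tm y r) x s
    have h3 := tm_right r y (tm s x)
    have h4 := tm_right r x (tm s y)
    rw [ip_tm] at h1 h2
    rw [← ip_tm, ip_comm] at h3 h4
    linear_combination (norm := module) -h1 + h2 - h3 + h4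
  · have e : (2 : Fin 3) + 2 = 1 := rfl
    have e' : (2 : Fin 3) + 1 = 0 := rfl
    simp only [Fin.reduceFinMk, e, e', tEnd_zero, tEnd_one, tEnd_two, map_sub, map_smul,
      LinearMap.sub_apply]
    have h1 := congrArg (fun t => tm t y) (tm_right x r s)
    have h2 := congrArg (fun t => tm t x) (tm_right y r s)
    have h3 := tm_left s (tm r x) y
    have h4 := tm_left s (tm r y) x
    simp only [map_add, map_smul, LinearMap.add_apply, LinearMap.smul_apply] at h1 h2
    rw [ip_comm s] at h3 h4
    linear_combination (norm := module) h1 - h2 - h3 + h4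

/-- The diagonal element `[F_i(x), F_i(y)]` of the triality algebra. -/
def T (i : Fin 3) : K →ₗ[ℝ] K →ₗ[ℝ] Tri K :=
  LinearMap.mk₂ ℝ
    (fun x y => ⟨fun j => tEnd (j - i) x y, fun j r s => tEnd_skew _ x y r s, fun j r s => by
      have h := tEnd_tm (j - i) x y r s
      rwa [show j - i + 2 = j + 2 - i by abel, show j - i + 1 = j + 1 - i by abel] at h⟩)
    (by
      intro x x' y
      ext j r
      change tFun (j - i) (x + x') y r = tFun (j - i) x y r + tFun (j - i) x' y r
      generalize j - i = k
      fin_cases k <;> simp [tFun, mul_add, add_smul] <;> abel)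
    (by
      intro c x y
      ext j r
      change tFun (j - i) (c • x) y r = c • tFun (j - i) x y r
      generalize j - i = k
      fin_cases k <;> simp [tFun, smul_sub, smul_smul, mul_comm, mul_left_comm])
    (by
      intro x y y'
      ext j r
      change tFun (j - i) x (y + y') r = tFun (j - i) x y r + tFun (j - i) x y' r
      generalize j - i = k
      fin_cases k <;> simp [tFun, mul_add, add_smul] <;> abel)
    (by
      intro c x y
      ext j r
      change tFun (j - i) x (c • y) r = c • tFun (j - i) x y r
      generalize j - i = k
      fin_cases k <;> simp [tFun, smul_sub, smul_smul, mul_comm, mul_left_comm])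

lemma T_apply (i j : Fin 3) (x y : K) : (T i x y).app j = tEnd (j - i) x y :=
  rfl

lemma T_swap (i : Fin 3) (x y : K) : T i x y = -T i y x := by
  ext j r
  change tFun (j - i) x y r = -tFun (j - i) y x r
  generalize j - i = k
  fin_cases k <;> simp [tFun]

lemma T_lie (φ : Tri K) (i : Fin 3) (x y : K) :
    ⁅φ, T i x y⁆ = T i (φ.app i x) y +
      T i x (φ.app i y) := by
  have hs := φ.skew
  have ht := φ.app_tm
  have key : ∀ k r, φ.app (i + k) (tEnd k x y r) - tEnd k x y (φ.app (i + k) r) =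
      tEnd k (φ.app i x) y r + tEnd k x (φ.app i y) r := by
    intro k r
    have a1 : i + 1 + 2 = i := by rw [add_assoc]; simp [show (1 : Fin 3) + 2 = 0 from rfl]
    have a2 : i + 2 + 2 = i + 1 := by rw [add_assoc, show (2 : Fin 3) + 2 = 1 from rfl]
    have a3 : i + 1 + 1 = i + 2 := by rw [add_assoc, show (1 : Fin 3) + 1 = 2 from rfl]
    have a4 : i + 2 + 1 = i := by rw [add_assoc]; simp [show (2 : Fin 3) + 1 = 0 from rfl]
    have t0 := ht i
    have t1 := ht (i + 1)
    have t2 := ht (i + 2)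
    rw [a1, a3] at t1
    rw [a2, a4] at t2
    fin_cases k
    · simp only [Fin.zero_eta, add_zero, tEnd_zero, map_sub, map_smul]
      have h1 := hs i x r
      have h2 := hs i y r
      rw [show ip x (φ.app i r) = -ip (φ.app i x) r by linarith,
        show ip y (φ.app i r) = -ip (φ.app i y) r by linarith]
      module
    · simp only [Fin.mk_one, tEnd_one, map_sub, t2, t0, map_add, LinearMap.add_apply]
      abel
    · simp only [Fin.reduceFinMk, tEnd_two, map_sub, t0, t2, map_add]
      abel
  ext j r
  have h := key (j - i) r
  rw [add_sub_cancel] at h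
  exact h

/-- The cyclic identity for three off-diagonal elements of different types. -/
lemma T_cyclic (i : Fin 3) (x y z : K) :
    T (i + 2) (tm x y) z + T i (tm y z) x + T (i + 1) (tm z x) y = 0 := by
  have key : ∀ x y z r : K, tEnd 1 (tm x y) z r + tEnd 0 (tm y z) x r + tEnd 2 (tm z x) y r = 0 := by
    intro x y z r
    simp only [tEnd_zero, tEnd_one, tEnd_two]
    have h1 := tm_left (tm x y) r z
    have h2 := tm_right y r (tm z x)
    have h3 := tm_left z r (tm x y)
    have h4 := tm_left z x (tm r y)
    have h5 := congrArg (fun t => tm t z) (tm_left x y r)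
    simp only [map_add, map_smul, LinearMap.add_apply, LinearMap.smul_apply] at h5
    have e1 : ip y (tm z x) = ip (tm x y) z := by rw [← ip_tm, ip_comm, ip_tm]
    have e2 : ip z (tm x y) = ip (tm x y) z := ip_comm _ _
    have e3 : ip z (tm r y) = ip (tm y z) r := by rw [ip_comm, ip_tm, ip_comm]
    rw [e1] at h2
    rw [e2] at h3
    rw [e3] at h4
    rw [ip_comm x r] at h5 ⊢
    rw [ip_comm r x] at h5 ⊢
    linear_combination (norm := module) h1 + h2 - 2 • h3 - 2 • h4 + 2 • h5
  ext j r
  change tEnd (j - (i + 2)) (tm x y) z r + tEnd (j - i) (tm y z) x r +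
    tEnd (j - (i + 1)) (tm z x) y r = 0
  rw [show j - (i + 2) = j - i - 2 by abel, show j - (i + 1) = j - i - 1 by abel]
  generalize j - i = k
  fin_cases k
  · exact key x y z r
  · have e : tEnd 2 (tm x y) z r + tEnd 1 (tm y z) x r + tEnd 0 (tm z x) y r = 0 := by
      rw [← key y z x r]
      abel
    exact e
  · have e : tEnd 0 (tm x y) z r + tEnd 2 (tm y z) x r + tEnd 1 (tm z x) y r = 0 := by
      rw [← key z x y r]
      abel
    exact e

end CompAlg

section Su3

open CompAlg

variable (K₁ K₂ : Type) [AddCommGroup K₁] [Module ℝ K₁] [CompAlg K₁]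
  [AddCommGroup K₂] [Module ℝ K₂] [CompAlg K₂]

/-- The underlying space of `𝔰𝔲(3, K₁ ⊗ K₂)`: a diagonal part, consisting of an element of each of
the two triality algebras, and three off-diagonal entries in `K₁ ⊗ K₂`, of types I, II, III. -/
def Su3 : Type := (Tri K₁ × Tri K₂) × (Fin 3 → K₁ ⊗[ℝ] K₂)

instance : AddCommGroup (Su3 K₁ K₂) :=
  inferInstanceAs (AddCommGroup ((Tri K₁ × Tri K₂) × (Fin 3 → K₁ ⊗[ℝ] K₂)))

instance : Module ℝ (Su3 K₁ K₂) :=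
  inferInstanceAs (Module ℝ ((Tri K₁ × Tri K₂) × (Fin 3 → K₁ ⊗[ℝ] K₂)))

namespace Su3

variable {K₁ K₂}

/-- The first diagonal part, in the triality algebra of `K₁`. -/
def diag₁ (x : Su3 K₁ K₂) : Tri K₁ := x.1.1

/-- The second diagonal part, in the triality algebra of `K₂`. -/
def diag₂ (x : Su3 K₁ K₂) : Tri K₂ := x.1.2

/-- The off-diagonal entries. -/
def off (x : Su3 K₁ K₂) : Fin 3 → K₁ ⊗[ℝ] K₂ := x.2

/-- The conjugated product of `K₁ ⊗ K₂`. -/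
def tmT : K₁ ⊗[ℝ] K₂ →ₗ[ℝ] K₁ ⊗[ℝ] K₂ →ₗ[ℝ] K₁ ⊗[ℝ] K₂ := TensorProduct.map₂ tm tm

/-- The bracket `[F_i(u), F_i(v)]` of two off-diagonal elements of the same type. -/
def kap (i : Fin 3) : K₁ ⊗[ℝ] K₂ →ₗ[ℝ] K₁ ⊗[ℝ] K₂ →ₗ[ℝ] (Tri K₁ × Tri K₂) :=
  LinearMap.compr₂ (TensorProduct.map₂ (T i) ip)
      (LinearMap.inl ℝ (Tri K₁) (Tri K₂) ∘ₗ (TensorProduct.rid ℝ (Tri K₁)).toLinearMap) +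
    LinearMap.compr₂ (TensorProduct.map₂ ip (T i))
      (LinearMap.inr ℝ (Tri K₁) (Tri K₂) ∘ₗ (TensorProduct.lid ℝ (Tri K₂)).toLinearMap)

/-- The action of a diagonal element on the off-diagonal elements of type `i`. -/
def act (i : Fin 3) : (Tri K₁ × Tri K₂) →ₗ[ℝ] Module.End ℝ (K₁ ⊗[ℝ] K₂) where
  toFun h := LinearMap.rTensor K₂ (h.1.app i) +
    LinearMap.lTensor K₁ (h.2.app i)
  map_add' h h' := by
    simp only [Prod.fst_add, Prod.snd_add, Tri.app_add,
      LinearMap.rTensor_add, LinearMap.lTensor_add]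
    abel
  map_smul' c h := by
    simp only [Prod.smul_fst, Prod.smul_snd, Tri.app_smul,
      LinearMap.rTensor_smul, LinearMap.lTensor_smul, smul_add, RingHom.id_apply]

lemma tmT_tmul (x y : K₁) (z w : K₂) :
    tmT (x ⊗ₜ[ℝ] z) (y ⊗ₜ[ℝ] w) = tm x y ⊗ₜ[ℝ] tm z w := by
  simp [tmT]

lemma kap_tmul (i : Fin 3) (x y : K₁) (z w : K₂) :
    kap i (x ⊗ₜ[ℝ] z) (y ⊗ₜ[ℝ] w) = (ip z w • T i x y, ip x y • T i z w) := by
  simp [kap]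

lemma act_tmul (i : Fin 3) (h : Tri K₁ × Tri K₂) (x : K₁) (z : K₂) :
    act i h (x ⊗ₜ[ℝ] z) = h.1.app i x ⊗ₜ[ℝ] z +
      x ⊗ₜ[ℝ] h.2.app i z := by
  simp [act]

lemma act_lie (i : Fin 3) (h h' : Tri K₁ × Tri K₂) (u : K₁ ⊗[ℝ] K₂) :
    act i ⁅h, h'⁆ u = act i h (act i h' u) - act i h' (act i h u) := by
  induction u using TensorProduct.induction_on with
  | zero => simp
  | add a b ha hb => simp only [map_add, ha, hb]; abel
  | tmul x z =>
    simp only [act_tmul, map_add]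
    change ((h.1.app i) ((h'.1.app i) x) -
        (h'.1.app i) ((h.1.app i) x)) ⊗ₜ[ℝ] z +
      x ⊗ₜ[ℝ] ((h.2.app i) ((h'.2.app i) z) -
        (h'.2.app i) ((h.2.app i) z)) = _
    simp only [TensorProduct.sub_tmul, TensorProduct.tmul_sub]
    abel

lemma act_tmT (i : Fin 3) (h : Tri K₁ × Tri K₂) (u v : K₁ ⊗[ℝ] K₂) :
    act (i + 2) h (tmT u v) = tmT (act i h u) v + tmT u (act (i + 1) h v) := by
  induction u using TensorProduct.induction_on with
  | zero => simp
  | add a b ha hb => simp only [map_add, ha, hb, LinearMap.add_apply]; abel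
  | tmul x z =>
    induction v using TensorProduct.induction_on with
    | zero => simp
    | add a b ha hb => simp only [map_add, ha, hb]; abel
    | tmul y w =>
      simp only [act_tmul, tmT_tmul, map_add, LinearMap.add_apply, h.1.app_tm, h.2.app_tm,
        TensorProduct.add_tmul, TensorProduct.tmul_add]
      abel

lemma kap_swap (i : Fin 3) (u v : K₁ ⊗[ℝ] K₂) : kap i u v = -kap i v u := by
  induction u using TensorProduct.induction_on with
  | zero => simp
  | add a b ha hb => simp only [map_add, ha, hb, LinearMap.add_apply]; abel
  | tmul x z =>
    induction v using TensorProduct.induction_on with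
    | zero => simp
    | add a b ha hb => simp only [map_add, ha, hb, LinearMap.add_apply]; abel
    | tmul y w =>
      rw [kap_tmul, kap_tmul, T_swap i x y, T_swap i z w, ip_comm z w, ip_comm x y]
      simp

lemma lie_kap (i : Fin 3) (h : Tri K₁ × Tri K₂) (u v : K₁ ⊗[ℝ] K₂) :
    ⁅h, kap i u v⁆ = kap i (act i h u) v + kap i u (act i h v) := by
  induction u using TensorProduct.induction_on with
  | zero => simp
  | add a b ha hb => simp only [map_add, ha, hb, LinearMap.add_apply, lie_add]; abel
  | tmul x z =>
    induction v using TensorProduct.induction_on with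
    | zero => simp
    | add a b ha hb => simp only [map_add, ha, hb, lie_add]; abel
    | tmul y w =>
      obtain ⟨h₁, h₂⟩ := h
      have s1 := h₁.skew i x y
      have s2 := h₂.skew i z w
      simp only [act_tmul, map_add, LinearMap.add_apply, kap_tmul]
      ext1
      · change ⁅h₁, ip z w • T i x y⁆ = _
        simp only [lie_smul, T_lie, Prod.fst_add]
        rw [show ip z (h₂.app i w) =
          -ip (h₂.app i z) w by linarith]
        module
      · change ⁅h₂, ip x y • T i z w⁆ = _
        simp only [lie_smul, T_lie, Prod.snd_add]
        rw [show ip x (h₁.app i y) =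
          -ip (h₁.app i x) y by linarith]
        module

lemma act_kap_zero (i : Fin 3) (u v w : K₁ ⊗[ℝ] K₂) :
    act i (kap i u v) w + act i (kap i v w) u + act i (kap i w u) v = 0 := by
  induction u using TensorProduct.induction_on with
  | zero => simp
  | add a b ha hb =>
    linear_combination (norm := (simp only [map_add, LinearMap.add_apply]; abel)) ha + hb
  | tmul x x' =>
    induction v using TensorProduct.induction_on with
    | zero => simp
    | add a b ha hb =>
      linear_combination (norm := (simp only [map_add, LinearMap.add_apply]; abel)) ha + hb
    | tmul y y' =>
      induction w using TensorProduct.induction_on with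
      | zero => simp
      | add a b ha hb =>
        linear_combination (norm := (simp only [map_add, LinearMap.add_apply]; abel)) ha + hb
      | tmul z z' =>
        simp only [kap_tmul, act_tmul, Tri.app_smul, LinearMap.smul_apply,
          T_apply, sub_self, tEnd_zero, TensorProduct.sub_tmul, TensorProduct.tmul_sub,
          ← TensorProduct.smul_tmul', TensorProduct.tmul_smul, smul_sub, smul_smul]
        rw [ip_comm z y, ip_comm z' y', ip_comm z x, ip_comm z' x', ip_comm y x, ip_comm y' x']
        module

lemma act_kap_one (i : Fin 3) (u v w : K₁ ⊗[ℝ] K₂) :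
    act (i + 1) (kap i u v) w = tmT (tmT u w) v - tmT (tmT v w) u := by
  induction u using TensorProduct.induction_on with
  | zero => simp
  | add a b ha hb => simp only [map_add, LinearMap.add_apply, ha, hb]; abel
  | tmul x x' =>
    induction v using TensorProduct.induction_on with
    | zero => simp
    | add a b ha hb => simp only [map_add, LinearMap.add_apply, ha, hb]; abel
    | tmul y y' =>
      induction w using TensorProduct.induction_on with
      | zero => simp
      | add a b ha hb => simp only [map_add, LinearMap.add_apply, ha, hb]; abel
      | tmul z z' =>
        have e : i + 1 - i = 1 := by abel
        have l1 := tm_left x z y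
        have l2 := tm_left x' z' y'
        simp only [kap_tmul, act_tmul, Tri.app_smul, LinearMap.smul_apply,
          T_apply, e, tEnd_one, tmT_tmul]
        rw [eq_sub_of_add_eq l1, eq_sub_of_add_eq l2]
        simp only [TensorProduct.sub_tmul, TensorProduct.tmul_sub,
          ← TensorProduct.smul_tmul', TensorProduct.tmul_smul, smul_sub, smul_smul]
        module

lemma act_kap_two (i : Fin 3) (u v w : K₁ ⊗[ℝ] K₂) :
    act (i + 2) (kap i u v) w = tmT v (tmT w u) - tmT u (tmT w v) := by
  induction u using TensorProduct.induction_on with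
  | zero => simp
  | add a b ha hb => simp only [map_add, LinearMap.add_apply, ha, hb]; abel
  | tmul x x' =>
    induction v using TensorProduct.induction_on with
    | zero => simp
    | add a b ha hb => simp only [map_add, LinearMap.add_apply, ha, hb]; abel
    | tmul y y' =>
      induction w using TensorProduct.induction_on with
      | zero => simp
      | add a b ha hb => simp only [map_add, LinearMap.add_apply, ha, hb]; abel
      | tmul z z' =>
        have e : i + 2 - i = 2 := by abel
        have l1 := tm_right x z y
        have l2 := tm_right x' z' y'
        simp only [kap_tmul, act_tmul, Tri.app_smul, LinearMap.smul_apply,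
          T_apply, e, tEnd_two, tmT_tmul]
        rw [eq_sub_of_add_eq l1, eq_sub_of_add_eq l2]
        simp only [TensorProduct.sub_tmul, TensorProduct.tmul_sub,
          ← TensorProduct.smul_tmul', TensorProduct.tmul_smul, smul_sub, smul_smul]
        module

lemma kap_cyclic (i : Fin 3) (u v w : K₁ ⊗[ℝ] K₂) :
    kap (i + 2) (tmT u v) w + kap i (tmT v w) u + kap (i + 1) (tmT w u) v = 0 := by
  induction u using TensorProduct.induction_on with
  | zero => simp
  | add a b ha hb =>
    linear_combination (norm := (simp only [map_add, LinearMap.add_apply]; abel)) ha + hb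
  | tmul x x' =>
    induction v using TensorProduct.induction_on with
    | zero => simp
    | add a b ha hb =>
      linear_combination (norm := (simp only [map_add, LinearMap.add_apply]; abel)) ha + hb
    | tmul y y' =>
      induction w using TensorProduct.induction_on with
      | zero => simp
      | add a b ha hb =>
        linear_combination (norm := (simp only [map_add, LinearMap.add_apply]; abel)) ha + hb
      | tmul z z' =>
        have h1 := T_cyclic i x y z
        have h2 := T_cyclic i x' y' z'
        have a1 : ip (tm y z) x = ip (tm x y) z := by rw [ip_comm, ip_tm]
        have a2 : ip (tm z x) y = ip (tm x y) z := by rw [ip_tm, ip_comm]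
        have b1 : ip (tm y' z') x' = ip (tm x' y') z' := by rw [ip_comm, ip_tm]
        have b2 : ip (tm z' x') y' = ip (tm x' y') z' := by rw [ip_tm, ip_comm]
        simp only [tmT_tmul, kap_tmul, a1, a2, b1, b2]
        ext1
        · simp only [Prod.fst_add, ← smul_add, h1, smul_zero, Prod.fst_zero]
        · simp only [Prod.snd_add, ← smul_add, h2, smul_zero, Prod.snd_zero]

/-- The bracket of `𝔰𝔲(3, K₁ ⊗ K₂)`: the commutator of `3 × 3` matrices in which diagonal elements
act through the component of the appropriate type, and
`[F_{i+1}(u), F_{i+2}(v)] = F_i(-\overline{u v})`. -/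
instance : Bracket (Su3 K₁ K₂) (Su3 K₁ K₂) where
  bracket x y :=
    (⁅x.1, y.1⁆ + ∑ i, kap i (x.2 i) (y.2 i),
      fun i => act i x.1 (y.2 i) - act i y.1 (x.2 i) - tmT (x.2 (i + 1)) (y.2 (i + 2)) +
        tmT (y.2 (i + 1)) (x.2 (i + 2)))

lemma lie_def (x y : Su3 K₁ K₂) : ⁅x, y⁆ =
    (⁅x.1, y.1⁆ + ∑ i, kap i (x.2 i) (y.2 i),
      fun i => act i x.1 (y.2 i) - act i y.1 (x.2 i) - tmT (x.2 (i + 1)) (y.2 (i + 2)) +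
        tmT (y.2 (i + 1)) (x.2 (i + 2))) := rfl

lemma jac_diag (h h' h'' : Tri K₁ × Tri K₂) (u v w : Fin 3 → K₁ ⊗[ℝ] K₂) :
    ⁅h, ⁅h', h''⁆ + ∑ i, kap i (v i) (w i)⁆ +
      ∑ i, kap i (u i) (act i h' (w i) - act i h'' (v i) - tmT (v (i + 1)) (w (i + 2)) +
        tmT (w (i + 1)) (v (i + 2))) =
    (⁅⁅h, h'⁆ + ∑ i, kap i (u i) (v i), h''⁆ +
      ∑ i, kap i (act i h (v i) - act i h' (u i) - tmT (u (i + 1)) (v (i + 2)) +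
        tmT (v (i + 1)) (u (i + 2))) (w i)) +
    (⁅h', ⁅h, h''⁆ + ∑ i, kap i (u i) (w i)⁆ +
      ∑ i, kap i (v i) (act i h (w i) - act i h'' (u i) - tmT (u (i + 1)) (w (i + 2)) +
        tmT (w (i + 1)) (u (i + 2)))) := by
  have sw : ∀ (i : Fin 3) (a b c : K₁ ⊗[ℝ] K₂), kap i a (tmT b c) = -kap i (tmT b c) a :=
    fun i a b c => kap_swap _ _ _
  have ls : ∀ (i : Fin 3) (a b : K₁ ⊗[ℝ] K₂), ⁅kap i a b, h''⁆ =
      -(kap i (act i h'' a) b + kap i a (act i h'' b)) := fun i a b => by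
    rw [← lie_skew, lie_kap]
  have e12 : (1 : Fin 3) + 2 = 0 := rfl
  have e11 : (1 : Fin 3) + 1 = 2 := rfl
  have e21 : (2 : Fin 3) + 1 = 0 := rfl
  have e22 : (2 : Fin 3) + 2 = 1 := rfl
  have a0 := kap_cyclic 0 (u 0) (v 1) (w 2)
  have a1 := kap_cyclic 1 (u 1) (v 2) (w 0)
  have a2 := kap_cyclic 2 (u 2) (v 0) (w 1)
  have b0 := kap_cyclic 0 (u 0) (w 1) (v 2)
  have b1 := kap_cyclic 1 (u 1) (w 2) (v 0)
  have b2 := kap_cyclic 2 (u 2) (w 0) (v 1)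
  have c0 := kap_swap 0 (v 0) (act 0 h'' (u 0))
  have c1 := kap_swap 1 (v 1) (act 1 h'' (u 1))
  have c2 := kap_swap 2 (v 2) (act 2 h'' (u 2))
  have lz := leibniz_lie h h' h''
  simp only [Fin.sum_univ_three, lie_add, add_lie, lie_kap, ls, map_add, map_sub,
    LinearMap.add_apply, LinearMap.sub_apply, zero_add, e12, e11, e21, e22, sw] at *
  linear_combination (norm := abel) lz + a0 + a1 + a2 - b0 - b1 - b2 + c0 + c1 + c2

set_option maxHeartbeats 1000000 in
lemma jac_off (h h' h'' : Tri K₁ × Tri K₂) (u v w : Fin 3 → K₁ ⊗[ℝ] K₂) (i : Fin 3) :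
    act i h (act i h' (w i) - act i h'' (v i) - tmT (v (i + 1)) (w (i + 2)) +
        tmT (w (i + 1)) (v (i + 2))) -
      act i (⁅h', h''⁆ + ∑ i, kap i (v i) (w i)) (u i) -
      tmT (u (i + 1)) (act (i + 2) h' (w (i + 2)) - act (i + 2) h'' (v (i + 2)) -
        tmT (v (i + 2 + 1)) (w (i + 2 + 2)) + tmT (w (i + 2 + 1)) (v (i + 2 + 2))) +
      tmT (act (i + 1) h' (w (i + 1)) - act (i + 1) h'' (v (i + 1)) -
        tmT (v (i + 1 + 1)) (w (i + 1 + 2)) + tmT (w (i + 1 + 1)) (v (i + 1 + 2))) (u (i + 2)) =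
    (act i (⁅h, h'⁆ + ∑ i, kap i (u i) (v i)) (w i) -
      act i h'' (act i h (v i) - act i h' (u i) - tmT (u (i + 1)) (v (i + 2)) +
        tmT (v (i + 1)) (u (i + 2))) -
      tmT (act (i + 1) h (v (i + 1)) - act (i + 1) h' (u (i + 1)) -
        tmT (u (i + 1 + 1)) (v (i + 1 + 2)) + tmT (v (i + 1 + 1)) (u (i + 1 + 2))) (w (i + 2)) +
      tmT (w (i + 1)) (act (i + 2) h (v (i + 2)) - act (i + 2) h' (u (i + 2)) -
        tmT (u (i + 2 + 1)) (v (i + 2 + 2)) + tmT (v (i + 2 + 1)) (u (i + 2 + 2)))) +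
    (act i h' (act i h (w i) - act i h'' (u i) - tmT (u (i + 1)) (w (i + 2)) +
        tmT (w (i + 1)) (u (i + 2))) -
      act i (⁅h, h''⁆ + ∑ i, kap i (u i) (w i)) (v i) -
      tmT (v (i + 1)) (act (i + 2) h (w (i + 2)) - act (i + 2) h'' (u (i + 2)) -
        tmT (u (i + 2 + 1)) (w (i + 2 + 2)) + tmT (w (i + 2 + 1)) (u (i + 2 + 2))) +
      tmT (act (i + 1) h (w (i + 1)) - act (i + 1) h'' (u (i + 1)) -
        tmT (u (i + 1 + 1)) (w (i + 1 + 2)) + tmT (w (i + 1 + 1)) (u (i + 1 + 2)))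
        (v (i + 2))) := by
  have e12 : (1 : Fin 3) + 2 = 0 := rfl
  have e11 : (1 : Fin 3) + 1 = 2 := rfl
  have e21 : (2 : Fin 3) + 1 = 0 := rfl
  have e22 : (2 : Fin 3) + 2 = 1 := rfl
  have k10 : ∀ a b c : K₁ ⊗[ℝ] K₂, act 1 (kap 0 a b) c = _ := act_kap_one 0
  have k21 : ∀ a b c : K₁ ⊗[ℝ] K₂, act 2 (kap 1 a b) c = _ := act_kap_one 1
  have k02 : ∀ a b c : K₁ ⊗[ℝ] K₂, act 0 (kap 2 a b) c = _ := act_kap_one 2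
  have k20 : ∀ a b c : K₁ ⊗[ℝ] K₂, act 2 (kap 0 a b) c = _ := act_kap_two 0
  have k01 : ∀ a b c : K₁ ⊗[ℝ] K₂, act 0 (kap 1 a b) c = _ := act_kap_two 1
  have k12 : ∀ a b c : K₁ ⊗[ℝ] K₂, act 1 (kap 2 a b) c = _ := act_kap_two 2
  have t2 : ∀ (h : Tri K₁ × Tri K₂) (a b : K₁ ⊗[ℝ] K₂), act 2 h (tmT a b) = _ := act_tmT 0
  have t0 : ∀ (h : Tri K₁ × Tri K₂) (a b : K₁ ⊗[ℝ] K₂), act 0 h (tmT a b) = _ := act_tmT 1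
  have t1 : ∀ (h : Tri K₁ × Tri K₂) (a b : K₁ ⊗[ℝ] K₂), act 1 h (tmT a b) = _ := act_tmT 2
  have z := act_kap_zero i (u i) (v i) (w i)
  have s1 : act i (kap i (u i) (w i)) (v i) = -act i (kap i (w i) (u i)) (v i) := by
    rw [kap_swap]
    simp
  fin_cases i <;>
  · simp only [Fin.zero_eta, Fin.mk_one, Fin.reduceFinMk, Fin.isValue, Fin.sum_univ_three,
      zero_add, e12, e11, e21, e22, map_add, map_sub, LinearMap.add_apply,
      LinearMap.sub_apply, act_lie, k10, k21, k02, k20, k01, k12, t0, t1, t2] at *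
    linear_combination (norm := abel) -z + s1

lemma kap_self (i : Fin 3) (u : K₁ ⊗[ℝ] K₂) : kap i u u = 0 := by
  have h2 : (2 : ℝ) • kap i u u = 0 := by
    rw [two_smul]
    nth_rw 1 [kap_swap]
    exact neg_add_cancel _
  rw [← one_smul ℝ (kap i u u), ← inv_mul_cancel₀ (two_ne_zero (α := ℝ)), mul_smul, h2, smul_zero]

lemma add_diag (h h' h'' : Tri K₁ × Tri K₂) (u v w : Fin 3 → K₁ ⊗[ℝ] K₂) :
    ⁅h + h', h''⁆ + ∑ i, kap i (u i + v i) (w i) =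
      (⁅h, h''⁆ + ∑ i, kap i (u i) (w i)) + (⁅h', h''⁆ + ∑ i, kap i (v i) (w i)) := by
  rw [add_lie]
  simp only [map_add, LinearMap.add_apply, Finset.sum_add_distrib]
  abel

lemma diag_add (h h' h'' : Tri K₁ × Tri K₂) (u v w : Fin 3 → K₁ ⊗[ℝ] K₂) :
    ⁅h'', h + h'⁆ + ∑ i, kap i (w i) (u i + v i) =
      (⁅h'', h⁆ + ∑ i, kap i (w i) (u i)) + (⁅h'', h'⁆ + ∑ i, kap i (w i) (v i)) := by
  rw [lie_add]
  simp only [map_add, Finset.sum_add_distrib]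
  abel

lemma add_off (h h' h'' : Tri K₁ × Tri K₂) (u v w : Fin 3 → K₁ ⊗[ℝ] K₂) (i : Fin 3) :
    act i (h + h') (w i) - act i h'' (u i + v i) - tmT (u (i + 1) + v (i + 1)) (w (i + 2)) +
        tmT (w (i + 1)) (u (i + 2) + v (i + 2)) =
      (act i h (w i) - act i h'' (u i) - tmT (u (i + 1)) (w (i + 2)) +
          tmT (w (i + 1)) (u (i + 2))) +
        (act i h' (w i) - act i h'' (v i) - tmT (v (i + 1)) (w (i + 2)) +
          tmT (w (i + 1)) (v (i + 2))) := by
  simp only [map_add, LinearMap.add_apply]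
  abel

lemma off_add (h h' h'' : Tri K₁ × Tri K₂) (u v w : Fin 3 → K₁ ⊗[ℝ] K₂) (i : Fin 3) :
    act i h'' (u i + v i) - act i (h + h') (w i) - tmT (w (i + 1)) (u (i + 2) + v (i + 2)) +
        tmT (u (i + 1) + v (i + 1)) (w (i + 2)) =
      (act i h'' (u i) - act i h (w i) - tmT (w (i + 1)) (u (i + 2)) +
          tmT (u (i + 1)) (w (i + 2))) +
        (act i h'' (v i) - act i h' (w i) - tmT (w (i + 1)) (v (i + 2)) +
          tmT (v (i + 1)) (w (i + 2))) := by
  simp only [map_add, LinearMap.add_apply]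
  abel

lemma self_diag (h : Tri K₁ × Tri K₂) (u : Fin 3 → K₁ ⊗[ℝ] K₂) :
    ⁅h, h⁆ + ∑ i, kap i (u i) (u i) = 0 := by
  rw [lie_self, zero_add, Finset.sum_eq_zero fun i _ => kap_self i (u i)]

lemma self_off (h : Tri K₁ × Tri K₂) (u : Fin 3 → K₁ ⊗[ℝ] K₂) (i : Fin 3) :
    act i h (u i) - act i h (u i) - tmT (u (i + 1)) (u (i + 2)) +
      tmT (u (i + 1)) (u (i + 2)) = 0 := by
  abel

lemma smul_diag (c : ℝ) (h h' : Tri K₁ × Tri K₂) (u v : Fin 3 → K₁ ⊗[ℝ] K₂) :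
    ⁅h, c • h'⁆ + ∑ i, kap i (u i) (c • v i) = c • (⁅h, h'⁆ + ∑ i, kap i (u i) (v i)) := by
  rw [lie_smul, smul_add, Finset.smul_sum]
  simp only [map_smul]

lemma smul_off (c : ℝ) (h h' : Tri K₁ × Tri K₂) (u v : Fin 3 → K₁ ⊗[ℝ] K₂) (i : Fin 3) :
    act i h (c • v i) - act i (c • h') (u i) - tmT (u (i + 1)) (c • v (i + 2)) +
        tmT (c • v (i + 1)) (u (i + 2)) =
      c • (act i h (v i) - act i h' (u i) - tmT (u (i + 1)) (v (i + 2)) +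
        tmT (v (i + 1)) (u (i + 2))) := by
  simp only [map_smul, LinearMap.smul_apply, smul_add, smul_sub]

instance : LieRing (Su3 K₁ K₂) where
  add_lie x y z := Prod.ext (add_diag x.1 y.1 z.1 x.2 y.2 z.2)
    (funext (add_off x.1 y.1 z.1 x.2 y.2 z.2))
  lie_add z x y := Prod.ext (diag_add x.1 y.1 z.1 x.2 y.2 z.2)
    (funext (off_add x.1 y.1 z.1 x.2 y.2 z.2))
  lie_self x := Prod.ext (self_diag x.1 x.2) (funext (self_off x.1 x.2))
  leibniz_lie x y z := Prod.ext (jac_diag x.1 y.1 z.1 x.2 y.2 z.2)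
    (funext (jac_off x.1 y.1 z.1 x.2 y.2 z.2))

instance : LieAlgebra ℝ (Su3 K₁ K₂) where
  lie_smul c x y := Prod.ext (smul_diag c x.1 y.1 x.2 y.2) (funext (smul_off c x.1 y.1 x.2 y.2))

end Su3

end Su3

/-! The algebras `𝕆`, `𝕆'` and `ℂ'`. -/

/-- The octonions (`ε = -1`) and the split octonions (`ε = 1`): pairs of quaternions `(a, b)`,
standing for `a + b ℓ` with `ℓ ^ 2 = ε`. -/
def Oct (_ε : ℝ) : Type := ℍ[ℝ] × ℍ[ℝ]

namespace Oct

variable {ε : ℝ}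

instance : AddCommGroup (Oct ε) := inferInstanceAs (AddCommGroup (ℍ[ℝ] × ℍ[ℝ]))

instance : Module ℝ (Oct ε) := inferInstanceAs (Module ℝ (ℍ[ℝ] × ℍ[ℝ]))

@[ext]
lemma ext {x y : Oct ε} (h₁ : x.1 = y.1) (h₂ : x.2 = y.2) : x = y := Prod.ext h₁ h₂

@[simp] lemma add_fst (x y : Oct ε) : (x + y).1 = x.1 + y.1 := rfl
@[simp] lemma add_snd (x y : Oct ε) : (x + y).2 = x.2 + y.2 := rfl
@[simp] lemma smul_fst (c : ℝ) (x : Oct ε) : (c • x).1 = c • x.1 := rfl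
@[simp] lemma smul_snd (c : ℝ) (x : Oct ε) : (c • x).2 = c • x.2 := rfl

/-- The element `a + b ℓ`. -/
def mk (a b : ℍ[ℝ]) : Oct ε := (a, b)

@[simp] lemma mk_fst (a b : ℍ[ℝ]) : (mk a b : Oct ε).1 = a := rfl
@[simp] lemma mk_snd (a b : ℍ[ℝ]) : (mk a b : Oct ε).2 = b := rfl

/-- The Cayley–Dickson product. -/
def mulFun (x y : Oct ε) : Oct ε :=
  mk (x.1 * y.1 + ε • (star y.2 * x.2)) (y.2 * x.1 + x.2 * star y.1)

@[simp] lemma mulFun_fst (x y : Oct ε) : (mulFun x y).1 = x.1 * y.1 + ε • (star y.2 * x.2) := rfl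
@[simp] lemma mulFun_snd (x y : Oct ε) : (mulFun x y).2 = y.2 * x.1 + x.2 * star y.1 := rfl

/-- The product as a bilinear map. -/
def mulL : Oct ε →ₗ[ℝ] Oct ε →ₗ[ℝ] Oct ε :=
  LinearMap.mk₂ ℝ mulFun
    (fun x x' y => by ext1 <;> simp [add_mul, mul_add] <;> abel)
    (fun c x y => by ext1 <;> simp [smul_comm c ε])
    (fun x y y' => by ext1 <;> simp [add_mul, mul_add] <;> abel)
    (fun c x y => by ext1 <;> simp [smul_comm c ε])

/-- Conjugation. -/
def conjL : Oct ε →ₗ[ℝ] Oct ε where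
  toFun x := mk (star x.1) (-x.2)
  map_add' x y := by
    refine Prod.ext ?_ ?_
    · change star (x.1 + y.1) = star x.1 + star y.1
      simp
    · change -(x.2 + y.2) = -x.2 + -y.2
      abel
  map_smul' c x := by
    refine Prod.ext ?_ ?_
    · change star (c • x.1) = c • star x.1
      simp
    · change -(c • x.2) = c • -x.2
      simp

@[simp] lemma conjL_fst (x : Oct ε) : (conjL x).1 = star x.1 := rfl
@[simp] lemma conjL_snd (x : Oct ε) : (conjL x).2 = -x.2 := rfl
@[simp] lemma mulL_apply (x y : Oct ε) : mulL x y = mulFun x y := rfl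

/-- The real part. -/
def reL : Oct ε →ₗ[ℝ] ℝ where
  toFun x := x.1.re
  map_add' x y := by simp
  map_smul' c x := by simp

@[simp] lemma reL_apply (x : Oct ε) : reL x = x.1.re := rfl

lemma re_mul_assoc' (x y z : Oct ε) :
    reL (mulL (mulL x y) z) = reL (mulL x (mulL y z)) := by
  simp only [reL_apply, mulL_apply, mulFun_fst, mulFun_snd, Quaternion.re_add, Quaternion.re_mul,
    Quaternion.re_smul, Quaternion.imI_add, Quaternion.imJ_add, Quaternion.imK_add,
    Quaternion.imI_mul, Quaternion.imJ_mul, Quaternion.imK_mul, Quaternion.imI_smul,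
    Quaternion.imJ_smul, Quaternion.imK_smul, Quaternion.re_star, Quaternion.imI_star,
    Quaternion.imJ_star, Quaternion.imK_star, smul_eq_mul]
  ring

set_option maxHeartbeats 1000000 in
lemma conj_mul_mul' (x y z : Oct ε) :
    mulL (conjL z) (mulL x y) + mulL (conjL x) (mulL z y) = (2 * reL (mulL x (conjL z))) • y := by
  refine Oct.ext (QuaternionAlgebra.ext ?_ ?_ ?_ ?_) (QuaternionAlgebra.ext ?_ ?_ ?_ ?_) <;>
  · simp only [reL_apply, mulL_apply, mulFun_fst, mulFun_snd, conjL_fst, conjL_snd, add_fst,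
      add_snd, smul_fst, smul_snd, Quaternion.re_add, Quaternion.re_mul, Quaternion.re_neg,
      Quaternion.re_smul, Quaternion.imI_add, Quaternion.imJ_add, Quaternion.imK_add,
      Quaternion.imI_mul, Quaternion.imJ_mul, Quaternion.imK_mul, Quaternion.imI_smul,
      Quaternion.imJ_smul, Quaternion.imK_smul, Quaternion.re_star, Quaternion.imI_star,
      Quaternion.imJ_star, Quaternion.imK_star, Quaternion.imI_neg, Quaternion.imJ_neg,
      Quaternion.imK_neg, smul_eq_mul, star_neg, neg_neg]
    ring

lemma conj_mul' (x y : Oct ε) : conjL (mulL x y) = mulL (conjL y) (conjL x) := by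
  ext1 <;> simp

lemma mul_mul_conj' (x y z : Oct ε) :
    mulL (mulL y z) (conjL x) + mulL (mulL y x) (conjL z) = (2 * reL (mulL x (conjL z))) • y := by
  have cc : ∀ t : Oct ε, conjL (conjL t) = t := fun t => by ext1 <;> simp
  have h := congrArg conjL (conj_mul_mul' (conjL z) (conjL y) (conjL x))
  simp only [map_add, map_smul, conj_mul', cc] at h
  rw [h]
  congr 2
  simp
  ring

instance : CompAlg (Oct ε) where
  mul := mulL
  one := mk 1 0
  conj := conjL
  re := reL
  one_mul x := by ext1 <;> simp
  mul_one x := by ext1 <;> simp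
  conj_conj x := by ext1 <;> simp
  conj_mul := conj_mul'
  add_conj x := by
    refine Oct.ext ?_ ?_
    · ext <;> simp [two_mul]
    · simp
  re_conj x := by simp
  re_mul_comm x y := by simp; ring
  re_mul_assoc := re_mul_assoc'
  conj_mul_mul := conj_mul_mul'
  mul_mul_conj := mul_mul_conj'

end Oct

/-- The split complex numbers `ℂ'`: pairs `(a, b)`, standing for `a + b L` with `L ^ 2 = 1`. -/
def SplitC : Type := ℝ × ℝ

namespace SplitC

instance : AddCommGroup SplitC := inferInstanceAs (AddCommGroup (ℝ × ℝ))

instance : Module ℝ SplitC := inferInstanceAs (Module ℝ (ℝ × ℝ))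

/-- The element `a + b L`. -/
def mk (a b : ℝ) : SplitC := (a, b)

@[ext]
lemma ext {x y : SplitC} (h₁ : x.1 = y.1) (h₂ : x.2 = y.2) : x = y := Prod.ext h₁ h₂

@[simp] lemma mk_fst (a b : ℝ) : (mk a b).1 = a := rfl
@[simp] lemma mk_snd (a b : ℝ) : (mk a b).2 = b := rfl
@[simp] lemma add_fst (x y : SplitC) : (x + y).1 = x.1 + y.1 := rfl
@[simp] lemma add_snd (x y : SplitC) : (x + y).2 = x.2 + y.2 := rfl
@[simp] lemma smul_fst (c : ℝ) (x : SplitC) : (c • x).1 = c * x.1 := rfl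
@[simp] lemma smul_snd (c : ℝ) (x : SplitC) : (c • x).2 = c * x.2 := rfl

/-- The product as a bilinear map. -/
def mulL : SplitC →ₗ[ℝ] SplitC →ₗ[ℝ] SplitC :=
  LinearMap.mk₂ ℝ (fun x y => mk (x.1 * y.1 + x.2 * y.2) (x.1 * y.2 + x.2 * y.1))
    (fun x x' y => by ext1 <;> simp <;> ring)
    (fun c x y => by ext1 <;> simp <;> ring)
    (fun x y y' => by ext1 <;> simp <;> ring)
    (fun c x y => by ext1 <;> simp <;> ring)

@[simp] lemma mulL_fst (x y : SplitC) : (mulL x y).1 = x.1 * y.1 + x.2 * y.2 := rfl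
@[simp] lemma mulL_snd (x y : SplitC) : (mulL x y).2 = x.1 * y.2 + x.2 * y.1 := rfl

/-- Conjugation. -/
def conjL : SplitC →ₗ[ℝ] SplitC where
  toFun x := mk x.1 (-x.2)
  map_add' x y := by ext1 <;> simp; ring
  map_smul' c x := by ext1 <;> simp

@[simp] lemma conjL_fst (x : SplitC) : (conjL x).1 = x.1 := rfl
@[simp] lemma conjL_snd (x : SplitC) : (conjL x).2 = -x.2 := rfl

/-- The real part. -/
def reL : SplitC →ₗ[ℝ] ℝ where
  toFun x := x.1
  map_add' x y := by simp
  map_smul' c x := by simp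

@[simp] lemma reL_apply (x : SplitC) : reL x = x.1 := rfl

instance : CompAlg SplitC where
  mul := mulL
  one := mk 1 0
  conj := conjL
  re := reL
  one_mul x := by ext1 <;> simp
  mul_one x := by ext1 <;> simp
  conj_conj x := by ext1 <;> simp
  conj_mul x y := by ext1 <;> simp <;> ring
  add_conj x := by ext1 <;> simp; ring
  re_conj x := by simp
  re_mul_comm x y := by simp; ring
  re_mul_assoc x y z := by simp; ring
  conj_mul_mul x y z := by ext1 <;> simp <;> ring
  mul_mul_conj x y z := by ext1 <;> simp <;> ring

/-- The inclusion `ℂ' ⊂ 𝕆'`, `a + b L ↦ a + b L`. -/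
def incl : SplitC →ₗ[ℝ] Oct 1 where
  toFun x := Oct.mk (x.1 : ℍ[ℝ]) (x.2 : ℍ[ℝ])
  map_add' x y := by ext1 <;> simp
  map_smul' c x := by ext1 <;> simp [Quaternion.coe_mul_eq_smul]

end SplitC

/-! The generators of `𝔢₈ = 𝔰𝔲(3, 𝕆' ⊗ 𝕆)`. -/

namespace Su3

variable {K₁ K₂ : Type} [AddCommGroup K₁] [Module ℝ K₁] [CompAlg K₁]
  [AddCommGroup K₂] [Module ℝ K₂] [CompAlg K₂]

/-- The off-diagonal element of type I, II, III (for `i = 0, 1, 2`) with entry `t`. -/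
def offDiag (i : Fin 3) (t : K₁ ⊗[ℝ] K₂) : Su3 K₁ K₂ := (0, Pi.single i t)

/-- `X_t`. -/
def X (t : K₁ ⊗[ℝ] K₂) : Su3 K₁ K₂ := offDiag 0 t

/-- `Y_t`. -/
def Y (t : K₁ ⊗[ℝ] K₂) : Su3 K₁ K₂ := offDiag 1 t

/-- `Z_t`. -/
def Z (t : K₁ ⊗[ℝ] K₂) : Su3 K₁ K₂ := offDiag 2 t

/-- The unit of `K₁ ⊗ K₂`. -/
def oneT : K₁ ⊗[ℝ] K₂ := (CompAlg.one : K₁) ⊗ₜ[ℝ] (CompAlg.one : K₂)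

/-- `D_q = ½ [X_1, X_q]`. -/
def D (q : K₁ ⊗[ℝ] K₂) : Su3 K₁ K₂ := (1 / 2 : ℝ) • ⁅X (oneT : K₁ ⊗[ℝ] K₂), X q⁆

/-- `E_q = ½ [Y_1, Y_q]`. -/
def E (q : K₁ ⊗[ℝ] K₂) : Su3 K₁ K₂ := (1 / 2 : ℝ) • ⁅Y (oneT : K₁ ⊗[ℝ] K₂), Y q⁆

/-- `F_q = ½ [Z_1, Z_q]`. -/
def F (q : K₁ ⊗[ℝ] K₂) : Su3 K₁ K₂ := (1 / 2 : ℝ) • ⁅Z (oneT : K₁ ⊗[ℝ] K₂), Z q⁆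

/-- `D_{p,q} = ½ [X_p, X_q]`. -/
def DD (p q : K₁ ⊗[ℝ] K₂) : Su3 K₁ K₂ := (1 / 2 : ℝ) • ⁅X p, X q⁆

/-- `S_q = E_q - F_q`. -/
def S (q : K₁ ⊗[ℝ] K₂) : Su3 K₁ K₂ := E q - F q

end Su3

/-- The labels of the seven imaginary units `i, j, k, kℓ, jℓ, iℓ, ℓ` of `𝕆`, and of the seven
imaginary units `I, J, K, KL, JL, IL, L` of `𝕆'`. -/
inductive ImUnit
  | i | j | k | kl | jl | il | l
  deriving DecidableEq

namespace ImUnit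

/-- The imaginary unit with a given label. -/
def toOct (ε : ℝ) : ImUnit → Oct ε
  | i => Oct.mk ⟨0, 1, 0, 0⟩ 0
  | j => Oct.mk ⟨0, 0, 1, 0⟩ 0
  | k => Oct.mk ⟨0, 0, 0, 1⟩ 0
  | kl => Oct.mk 0 ⟨0, 0, 0, 1⟩
  | jl => Oct.mk 0 ⟨0, 0, 1, 0⟩
  | il => Oct.mk 0 ⟨0, 1, 0, 0⟩
  | l => Oct.mk 0 1

/-- The first pair of units generating a quaternionic subalgebra that contains `p`. -/
def a : ImUnit → ImUnit × ImUnit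
  | i => (j, k)
  | j => (k, i)
  | k => (i, j)
  | kl => (jl, i)
  | jl => (il, k)
  | il => (kl, j)
  | l => (il, i)

/-- The second pair of units generating a quaternionic subalgebra that contains `p`. -/
def b : ImUnit → ImUnit × ImUnit
  | i => (kl, jl)
  | j => (il, kl)
  | k => (jl, il)
  | kl => (j, il)
  | jl => (i, kl)
  | il => (k, jl)
  | l => (jl, j)

/-- The third pair of units generating a quaternionic subalgebra that contains `p`. -/
def c : ImUnit → ImUnit × ImUnit
  | i => (l, il)
  | j => (l, jl)
  | k => (l, kl)
  | kl => (k, l)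
  | jl => (j, l)
  | il => (i, l)
  | l => (kl, k)

/-- The orientation of the pairs `b p` and `c p` over `𝕆` (`ε = -1`) or `𝕆'` (`ε = 1`): their
product is `orient ε p` times `p`. (The product of the pair `a p` is always `p`.) -/
def orient (ε : ℝ) : ImUnit → ℝ
  | i => -ε
  | j => -ε
  | k => -ε
  | _ => 1

end ImUnit

/-- The Lie algebra `𝔢₈₍₋₂₄₎ = 𝔰𝔲(3, 𝕆' ⊗ 𝕆)`. -/
abbrev E8 : Type := Su3 (Oct 1) (Oct (-1))

namespace E8

open Su3

/-- An element of `{1} ∪ {imaginary units}`. -/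
def unit (ε : ℝ) : Option ImUnit → Oct ε
  | none => CompAlg.one
  | some p => p.toOct ε

/-- The product `q Q ∈ 𝕆' ⊗ 𝕆` of a unit `q` of `𝕆` and a unit `Q` of `𝕆'`. -/
def lab (q Q : Option ImUnit) : Oct 1 ⊗[ℝ] Oct (-1) := unit 1 Q ⊗ₜ[ℝ] unit (-1) q

/-- The imaginary unit `p` of `𝕆`, as an element of `𝕆' ⊗ 𝕆`. -/
def oLab (p : ImUnit) : Oct 1 ⊗[ℝ] Oct (-1) := lab (some p) none

/-- The imaginary unit `Q` of `𝕆'`, as an element of `𝕆' ⊗ 𝕆`. -/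
def sLab (Q : ImUnit) : Oct 1 ⊗[ℝ] Oct (-1) := lab none (some Q)

/-- `A_p = -(D_{a(p)} - D_{b(p)})` for an imaginary unit `p` of `𝕆`. -/
def A (p : ImUnit) : E8 :=
  -(DD (oLab p.a.1) (oLab p.a.2) - p.orient (-1) • DD (oLab p.b.1) (oLab p.b.2))

/-- `G_p = -(D_{a(p)} + D_{b(p)} - 2 D_{c(p)})` for an imaginary unit `p` of `𝕆`. -/
def G (p : ImUnit) : E8 :=
  -(DD (oLab p.a.1) (oLab p.a.2) + p.orient (-1) • DD (oLab p.b.1) (oLab p.b.2) -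
    (2 * p.orient (-1)) • DD (oLab p.c.1) (oLab p.c.2))

/-- `A_Q = -(D_{a(Q)} - D_{b(Q)})` for an imaginary unit `Q` of `𝕆'`, with all pairs oriented so
that their product is `Q`. -/
def A' (Q : ImUnit) : E8 :=
  -(DD (sLab Q.a.1) (sLab Q.a.2) - Q.orient 1 • DD (sLab Q.b.1) (sLab Q.b.2))

/-- `G_Q = -(D_{a(Q)} + D_{b(Q)} - 2 D_{c(Q)})` for an imaginary unit `Q` of `𝕆'`, with all pairs
oriented so that their product is `Q`. -/
def G' (Q : ImUnit) : E8 :=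
  -(DD (sLab Q.a.1) (sLab Q.a.2) + Q.orient 1 • DD (sLab Q.b.1) (sLab Q.b.2) -
    (2 * Q.orient 1) • DD (sLab Q.c.1) (sLab Q.c.2))

/-- The names of the generators `A_p, G_p, S_p, D_p`. -/
inductive DiagIdx
  | A (p : ImUnit) | G (p : ImUnit) | S (p : ImUnit) | D (p : ImUnit)

/-- The names of the generators `X_q, Y_q, Z_q`. -/
inductive OffIdx
  | X (q : Option ImUnit) | Y (q : Option ImUnit) | Z (q : Option ImUnit)

/-- The names of the generators `X_{qL}, Y_{qL}, Z_{qL}, D_L, S_L`. -/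
inductive BoostIdx
  | XL (q : Option ImUnit) | YL (q : Option ImUnit) | ZL (q : Option ImUnit) | DL | SL

/-- The 28 elements `A_p, G_p, S_p, D_p`. -/
def gen28 : DiagIdx → E8
  | .A p => A p
  | .G p => G p
  | .S p => S (oLab p)
  | .D p => D (oLab p)

/-- The 24 elements `X_q, Y_q, Z_q`. -/
def gen24 : OffIdx → E8
  | .X q => X (lab q none)
  | .Y q => Y (lab q none)
  | .Z q => Z (lab q none)

/-- The 26 elements `X_{qL}, Y_{qL}, Z_{qL}, D_L, S_L`. -/
def boost : BoostIdx → E8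
  | .XL q => X (lab q (some .l))
  | .YL q => Y (lab q (some .l))
  | .ZL q => Z (lab q (some .l))
  | .DL => D (sLab .l)
  | .SL => S (sLab .l)

/-- The 52 generators of `𝔣₄`. -/
def gen52 : DiagIdx ⊕ OffIdx → E8 := Sum.elim gen28 gen24

/-- The 78 generators of `𝔢₆`. -/
def gen78 : (DiagIdx ⊕ OffIdx) ⊕ BoostIdx → E8 := Sum.elim gen52 boost

/-- The eight elements `G_L` and `A_Q`, where `Q` is any of the seven imaginary units of `𝕆'`. -/
def gen8 : Option ImUnit → E8
  | none => G' .l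
  | some Q => A' Q

/-- The names of the 27 elements labeled by a fixed imaginary unit of `𝕆'`. -/
inductive Idx27
  | X (p : Option ImUnit) | Y (p : Option ImUnit) | Z (p : Option ImUnit) | D | S | G

/-- The 27 elements `X_{pQ}, Y_{pQ}, Z_{pQ}, D_Q, S_Q, G_Q`. -/
def gen27 (Q : ImUnit) : Idx27 → E8
  | .X p => X (lab p (some Q))
  | .Y p => Y (lab p (some Q))
  | .Z p => Z (lab p (some Q))
  | .D => D (sLab Q)
  | .S => S (sLab Q)
  | .G => G' Q

/-- The pairs `(I, IL)`, `(J, JL)`, `(K, KL)` of split imaginary units other than `L`. -/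
def base : Fin 3 → ImUnit × ImUnit := ![(.i, .il), (.j, .jl), (.k, .kl)]

/-- The 27 elements labeled by the null element `½ (N + s NL)` of `𝕆'`, where `N` is `I`, `J` or
`K` and `s = ± 1`; they depend linearly on the label. -/
def gen27Null (n : Fin 3) (s : ℤˣ) (x : Idx27) : E8 :=
  (1 / 2 : ℝ) • (gen27 (base n).1 x + ((s : ℤ) : ℝ) • gen27 (base n).2 x)

/-- The Lie subalgebra of `𝔢₈` generated by `A_p, G_p, S_p, D_p`. -/
def so8 : LieSubalgebra ℝ E8 := LieSubalgebra.lieSpan ℝ E8 (Set.range gen28)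

/-- The Lie subalgebra of `𝔢₈` generated by the 52 generators without `L`. -/
def f4 : LieSubalgebra ℝ E8 := LieSubalgebra.lieSpan ℝ E8 (Set.range gen52)

/-- The Lie subalgebra of `𝔢₈` generated by the 78 generators. -/
def e6 : LieSubalgebra ℝ E8 := LieSubalgebra.lieSpan ℝ E8 (Set.range gen78)

/-- The subspace spanned by the 27 elements labeled by `Q`. -/
def W (Q : ImUnit) : Submodule ℝ E8 := Submodule.span ℝ (Set.range (gen27 Q))

/-- The subspace spanned by the 27 elements labeled by `½ (N + s NL)`. -/
def H (n : Fin 3) (s : ℤˣ) : Submodule ℝ E8 := Submodule.span ℝ (Set.range (gen27Null n s))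

/-- `d` is a derivation of `𝕆'`. -/
def IsDer (d : Module.End ℝ (Oct 1)) : Prop :=
  ∀ x y, d (CompAlg.mul x y) = CompAlg.mul (d x) y + CompAlg.mul x (d y)

/-- `x ∈ 𝔢₈` is the element of `𝔤₂₍₂₎ = 𝔡𝔢𝔯(𝕆') ⊂ 𝔢₈` given by the endomorphism `d` of `𝕆'`: it
is diagonal and acts by `d` on the factor `𝕆'` in each of the three off-diagonal positions. -/
def IsDerElem (x : E8) (d : Module.End ℝ (Oct 1)) : Prop :=
  off x = 0 ∧ diag₂ x = 0 ∧ ∀ i, (diag₁ x).app i = d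

/-- The direct summands of `𝔢₈`. -/
inductive Piece
  | e6 | sl3 | H (n : Fin 3) (s : ℤˣ)
  deriving DecidableEq

/-- The corresponding subspaces. -/
def piece : Piece → Submodule ℝ E8
  | .e6 => Submodule.span ℝ (Set.range gen78)
  | .sl3 => Submodule.span ℝ (Set.range gen8)
  | .H n s => H n s

end E8

/-- The centralizer of a Lie subalgebra. -/
def lieCentralizer {L : Type} [LieRing L] [LieAlgebra ℝ L] (A : LieSubalgebra ℝ L) :
    LieSubalgebra ℝ L where
  carrier := {x | ∀ a ∈ A, ⁅a, x⁆ = 0}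
  add_mem' hx hy a ha := by rw [lie_add, hx a ha, hy a ha, add_zero]
  zero_mem' a _ := lie_zero a
  smul_mem' c x hx a ha := by rw [lie_smul, hx a ha, smul_zero]
  lie_mem' hx hy a ha := by rw [leibniz_lie, hx a ha, hy a ha, zero_lie, lie_zero, add_zero]

/-! The Albert algebra and `𝔢₆₍₋₂₆₎ = 𝔰𝔩(3, 𝕆)`. -/

/-- The Albert algebra `H₃(𝕆)`: the element `(p, x)` is the Hermitian matrix with diagonal entries
`p 0, p 1, p 2` and with entries `x 0, x 1, x 2` in the positions `(1,2)`, `(2,3)`, `(3,1)`. -/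
abbrev Albert : Type := (Fin 3 → ℝ) × (Fin 3 → Oct (-1))

namespace Albert

open CompAlg

/-- The identity matrix. -/
def one : Albert := (fun _ => 1, 0)

/-- The determinant of a `3 × 3` octonionic Hermitian matrix. -/
def det (P : Albert) : ℝ :=
  P.1 0 * P.1 1 * P.1 2 - P.1 2 * ip (P.2 0) (P.2 0) - P.1 0 * ip (P.2 1) (P.2 1) -
    P.1 1 * ip (P.2 2) (P.2 2) + 2 * re (mul (mul (P.2 0) (P.2 1)) (P.2 2))

/-- The polarization of the determinant: the symmetric trilinear form with
`polar P P P = 6 det P`. -/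
def polar (P Q R : Albert) : ℝ :=
  det (P + Q + R) - det (P + Q) - det (Q + R) - det (P + R) + det P + det Q + det R

lemma polar_left (P Q R : Albert) : polar P Q R = polar Q P R := by
  simp only [polar, add_comm Q P]
  ring

lemma polar_right (P Q R : Albert) : polar P Q R = polar P R Q := by
  simp only [polar, add_right_comm P R Q, add_comm R Q]
  ring

lemma polar_add (P P' Q R : Albert) : polar (P + P') Q R = polar P Q R + polar P' Q R := by
  simp only [polar, det, Prod.fst_add, Prod.snd_add, Pi.add_apply, map_add, LinearMap.add_apply]
  ring

lemma polar_smul (c : ℝ) (P Q R : Albert) : polar (c • P) Q R = c * polar P Q R := by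
  simp only [polar, det, Prod.fst_add, Prod.snd_add, Prod.smul_fst, Prod.smul_snd, Pi.add_apply,
    Pi.smul_apply, map_add, map_smul, LinearMap.add_apply, LinearMap.smul_apply, smul_eq_mul]
  ring

lemma polar_sub (P P' Q R : Albert) : polar (P - P') Q R = polar P Q R - polar P' Q R := by
  rw [sub_eq_add_neg, polar_add, ← neg_one_smul ℝ P', polar_smul]
  ring

lemma polar_add₂ (P Q Q' R : Albert) : polar P (Q + Q') R = polar P Q R + polar P Q' R := by
  rw [polar_left, polar_add, polar_left Q, polar_left Q']

lemma polar_add₃ (P Q R R' : Albert) : polar P Q (R + R') = polar P Q R + polar P Q R' := by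
  rw [polar_right, polar_add₂, polar_right P R, polar_right P R']

lemma polar_smul₂ (c : ℝ) (P Q R : Albert) : polar P (c • Q) R = c * polar P Q R := by
  rw [polar_left, polar_smul, polar_left Q]

lemma polar_smul₃ (c : ℝ) (P Q R : Albert) : polar P Q (c • R) = c * polar P Q R := by
  rw [polar_right, polar_smul₂, polar_right P R]

lemma polar_sub₂ (P Q Q' R : Albert) : polar P (Q - Q') R = polar P Q R - polar P Q' R := by
  rw [polar_left, polar_sub, polar_left Q, polar_left Q']

lemma polar_sub₃ (P Q R R' : Albert) : polar P Q (R - R') = polar P Q R - polar P Q R' := by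
  rw [polar_right, polar_sub₂, polar_right P R, polar_right P R']

/-- `𝔢₆₍₋₂₆₎ = 𝔰𝔩(3, 𝕆)`: the Lie algebra of all endomorphisms of the Albert algebra that leave
the determinant infinitesimally invariant. -/
def sl3O : LieSubalgebra ℝ (Module.End ℝ Albert) where
  carrier := {f | ∀ P Q R, polar (f P) Q R + polar P (f Q) R + polar P Q (f R) = 0}
  add_mem' {f g} hf hg P Q R := by
    simp only [LinearMap.add_apply, polar_add, polar_add₂, polar_add₃]
    linear_combination hf P Q R + hg P Q R
  zero_mem' P Q R := by
    have h (T : Albert) (U : Albert) : polar 0 T U = 0 := by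
      rw [← zero_smul ℝ (0 : Albert), polar_smul, zero_mul]
    simp only [LinearMap.zero_apply]
    rw [polar_left P, polar_right P Q, polar_left P 0, h, h, h]
    ring
  smul_mem' c f hf P Q R := by
    simp only [LinearMap.smul_apply, polar_smul, polar_smul₂, polar_smul₃]
    linear_combination c * hf P Q R
  lie_mem' {f g} hf hg P Q R := by
    simp only [Ring.lie_def, LinearMap.sub_apply, Module.End.mul_apply, polar_sub, polar_sub₂,
      polar_sub₃]
    linear_combination hf (g P) Q R + hf P (g Q) R + hf P Q (g R) - hg (f P) Q R -
      hg P (f Q) R - hg P Q (f R)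

end Albert

end

/-! Everything rests on triality. A triple in tri(𝕆) or tri(𝕆') is determined by its component of
index 0 (`Oct.Tri.eq_zero_of_app_zero`): if that component vanishes, the next one is right
multiplication by an element of the nucleus, so by a real number, which skewness forces to be 0.
Conversely every skew map is such a component (`Oct.app_zero_sum_T`). Hence both triality algebras
have dimension 28, and 𝔢₈ has dimension 28 + 28 + 3·64. It then suffices that the 248 generators
span. For the diagonal ones this comes down to S_p being the sum of the three oriented elements
D_{a(p)}, D_{b(p)}, D_{c(p)} (`Oct.triGen_S`).

The subalgebras are recognised by their shape rather than from a multiplication table: 𝔰𝔬(8) is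
tri(𝕆), 𝔣₄ adds the off-diagonal entries in 1 ⊗ 𝕆, and 𝔢₆ is the image of 𝔰𝔲(3, ℂ' ⊗ 𝕆) under
`su3Incl`. The triality algebra of ℂ' is an abelian plane spanned by the T_i(1, L), so it embeds in
tri(𝕆').

An element centralizes 𝔢₆ exactly when it lies in tri(𝕆') and its components kill ℂ'
(`mem_centralizer_iff`); killing 1 makes the three components equal to one derivation. Such a
derivation preserves the space of the null elements ν = ½(N + NL). Its matrix there is traceless
because Re((xy)z) is a volume form on this space, and it determines the derivation because the null
elements of opposite sign form the dual space. So the centralizer embeds in 𝔰𝔩(3, ℝ), and the eight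
independent generators inside it force equality.

For the modules of dimension 27, split ℂ' = ℝ × ℝ by its two characters. An element of ℂ' multiplies
ν from the left and from the right through opposite characters. The elements with label ν are
parametrized by 𝔸: the entries ν ⊗ x are off-diagonal, and three elements T_i(½(1 + sL), ν) play the
role of the diagonal. Under this parametrization the bracket with 𝔢₆ becomes an action `rep s` that
does not depend on N (`lie_thetaNull`). On 𝔣₄ the two characters agree, which gives the invariance
of W_Q; the centralizer changes only the label ν, which gives the invariance of the sums over N.

Finally `rep 1` annihilates the cubic form (`rep_mem`) and `rep (-1)` is its contragredient
(`pair_rep`). It is a homomorphism by the Jacobi identity in 𝔢₈. It is onto 𝔰𝔩(3, 𝕆) because the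
values of an endomorphism on the diagonal matrix units can be matched by `rep 1`, and what then
remains is a triality triple (`repHom_surjective`). The direct sum decomposition follows from
spanning and 78 + 8 + 6·27 = 248. -/

noncomputable section

/-! ### Coordinates, units and norms in 𝕆 and 𝕆'. -/

namespace Oct

variable {ε : ℝ}

lemma ext_coord {x y : Oct ε} (h₁ : x.1.re = y.1.re) (h₂ : x.1.imI = y.1.imI)
    (h₃ : x.1.imJ = y.1.imJ) (h₄ : x.1.imK = y.1.imK) (h₅ : x.2.re = y.2.re)
    (h₆ : x.2.imI = y.2.imI) (h₇ : x.2.imJ = y.2.imJ) (h₈ : x.2.imK = y.2.imK) : x = y :=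
  Oct.ext (QuaternionAlgebra.ext h₁ h₂ h₃ h₄) (QuaternionAlgebra.ext h₅ h₆ h₇ h₈)

lemma ext_coord_iff {x y : Oct ε} : x = y ↔
    (x.1.re = y.1.re ∧ x.1.imI = y.1.imI ∧ x.1.imJ = y.1.imJ ∧ x.1.imK = y.1.imK) ∧
      x.2.re = y.2.re ∧ x.2.imI = y.2.imI ∧ x.2.imJ = y.2.imJ ∧ x.2.imK = y.2.imK :=
  ⟨by rintro rfl; simp, fun ⟨⟨h₁, h₂, h₃, h₄⟩, h₅, h₆, h₇, h₈⟩ =>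
    ext_coord h₁ h₂ h₃ h₄ h₅ h₆ h₇ h₈⟩

@[simp] lemma zero_fst : (0 : Oct ε).1 = 0 := rfl
@[simp] lemma zero_snd : (0 : Oct ε).2 = 0 := rfl
@[simp] lemma neg_fst (x : Oct ε) : (-x).1 = -x.1 := rfl
@[simp] lemma neg_snd (x : Oct ε) : (-x).2 = -x.2 := rfl
@[simp] lemma sub_fst (x y : Oct ε) : (x - y).1 = x.1 - y.1 := rfl
@[simp] lemma sub_snd (x y : Oct ε) : (x - y).2 = x.2 - y.2 := rfl

@[simp] lemma one_fst : (CompAlg.one : Oct ε).1 = 1 := rfl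
@[simp] lemma one_snd : (CompAlg.one : Oct ε).2 = 0 := rfl

@[simp] lemma mul_fst (x y : Oct ε) :
    (CompAlg.mul x y).1 = x.1 * y.1 + ε • (star y.2 * x.2) := rfl
@[simp] lemma mul_snd (x y : Oct ε) : (CompAlg.mul x y).2 = y.2 * x.1 + x.2 * star y.1 := rfl
@[simp] lemma conj_fst (x : Oct ε) : (CompAlg.conj x).1 = star x.1 := rfl
@[simp] lemma conj_snd (x : Oct ε) : (CompAlg.conj x).2 = -x.2 := rfl
@[simp] lemma re_eq (x : Oct ε) : CompAlg.re x = x.1.re := rfl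

lemma ip_coord (x y : Oct ε) : CompAlg.ip x y =
    x.1.re * y.1.re + x.1.imI * y.1.imI + x.1.imJ * y.1.imJ + x.1.imK * y.1.imK -
      ε * (x.2.re * y.2.re + x.2.imI * y.2.imI + x.2.imJ * y.2.imJ + x.2.imK * y.2.imK) := by
  rw [CompAlg.ip_apply]
  simp
  ring

/-- The eight coordinates of an octonion. -/
def coord (x : Oct ε) : Option ImUnit → ℝ
  | none => x.1.re
  | some .i => x.1.imI
  | some .j => x.1.imJ
  | some .k => x.1.imK
  | some .kl => x.2.imK
  | some .jl => x.2.imJ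
  | some .il => x.2.imI
  | some .l => x.2.re

variable (p : ImUnit)

@[simp] lemma toOct_fst_re : (p.toOct ε).1.re = 0 := by cases p <;> rfl
@[simp] lemma toOct_fst_imI : (p.toOct ε).1.imI = if p = .i then 1 else 0 := by cases p <;> rfl
@[simp] lemma toOct_fst_imJ : (p.toOct ε).1.imJ = if p = .j then 1 else 0 := by cases p <;> rfl
@[simp] lemma toOct_fst_imK : (p.toOct ε).1.imK = if p = .k then 1 else 0 := by cases p <;> rfl
@[simp] lemma toOct_snd_re : (p.toOct ε).2.re = if p = .l then 1 else 0 := by cases p <;> rfl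
@[simp] lemma toOct_snd_imI : (p.toOct ε).2.imI = if p = .il then 1 else 0 := by cases p <;> rfl
@[simp] lemma toOct_snd_imJ : (p.toOct ε).2.imJ = if p = .jl then 1 else 0 := by cases p <;> rfl
@[simp] lemma toOct_snd_imK : (p.toOct ε).2.imK = if p = .kl then 1 else 0 := by cases p <;> rfl

end Oct

instance : Fintype ImUnit where
  elems := {.i, .j, .k, .kl, .jl, .il, .l}
  complete p := by cases p <;> decide

namespace Oct

open E8 (unit)

variable {ε : ℝ}

@[simp] lemma unit_none : unit ε none = CompAlg.one := rfl
@[simp] lemma unit_some (p : ImUnit) : unit ε (some p) = p.toOct ε := rfl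

variable (ε) in
/-- The coordinates as a linear equivalence. -/
def coordEquiv : Oct ε ≃ₗ[ℝ] (Option ImUnit → ℝ) where
  toFun := coord
  map_add' x y := by ext (_ | p); rotate_left; cases p; all_goals simp [coord]
  map_smul' c x := by ext (_ | p); rotate_left; cases p; all_goals simp [coord]
  invFun f := mk ⟨f none, f (some .i), f (some .j), f (some .k)⟩
    ⟨f (some .l), f (some .il), f (some .jl), f (some .kl)⟩
  left_inv x := by apply ext_coord <;> rfl
  right_inv f := by ext (_ | p); rotate_left; cases p; all_goals rfl

variable (ε) in
/-- The basis `1, i, j, k, kℓ, jℓ, iℓ, ℓ`. -/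
def unitBasis : Module.Basis (Option ImUnit) ℝ (Oct ε) := Module.Basis.ofEquivFun (coordEquiv ε)

lemma coord_unit (p q : Option ImUnit) : coord (unit ε p) q = if p = q then 1 else 0 := by
  rcases q with _ | q; rotate_left; cases q
  all_goals rcases p with _ | p <;> simp [coord]

lemma unitBasis_apply (p : Option ImUnit) : unitBasis ε p = unit ε p := by
  rw [unitBasis, Module.Basis.coe_ofEquivFun, LinearEquiv.symm_apply_eq]
  ext q
  exact (Pi.single_apply _ _ _).trans ((if_congr eq_comm rfl rfl).trans (coord_unit p q).symm)

instance : Module.Finite ℝ (Oct ε) := Module.Finite.of_basis (unitBasis ε)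

lemma finrank_eq : Module.finrank ℝ (Oct ε) = 8 := by
  rw [Module.finrank_eq_card_basis (unitBasis ε)]; rfl

/-- The norms of the units. -/
def eta (ε : ℝ) : Option ImUnit → ℝ
  | some .kl => -ε
  | some .jl => -ε
  | some .il => -ε
  | some .l => -ε
  | _ => 1

lemma ip_unit (x : Oct ε) (p : Option ImUnit) :
    CompAlg.ip (unit ε p) x = eta ε p * x.coord p := by
  rw [ip_coord]
  rcases p with _ | p; rotate_left; cases p
  all_goals simp [coord, eta]

lemma sum_coord (x : Oct ε) : ∑ p, x.coord p • unit ε p = x := by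
  simp_rw [← unitBasis_apply]
  exact (unitBasis ε).sum_equivFun x

lemma eta_sq (h : ε ^ 2 = 1) (p : Option ImUnit) : eta ε p * eta ε p = 1 := by
  rcases p with _ | p; rotate_left; cases p
  all_goals simp only [eta]; linarith

/-- The units are orthogonal with norms ±1, so each norm is its own inverse and Fourier expansion
needs no division. -/
lemma sum_ip (h : ε ^ 2 = 1) (x : Oct ε) :
    ∑ p, (eta ε p * CompAlg.ip (unit ε p) x) • unit ε p = x := by
  simp_rw [ip_unit, ← mul_assoc, eta_sq h, one_mul]
  exact sum_coord x

lemma eq_zero_of_ip (h : ε ^ 2 = 1) (x : Oct ε) (hx : ∀ y, CompAlg.ip y x = 0) : x = 0 := by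
  rw [← sum_ip h x]
  simp [hx]

end Oct

namespace CompAlg

variable {K : Type} [AddCommGroup K] [Module ℝ K] [CompAlg K]

lemma conj_one : conj (one : K) = one := by
  rw [← CompAlg.one_mul (conj (one : K)), ← conj_conj (mul one (conj (one : K))), conj_mul,
    conj_conj, CompAlg.one_mul]
  exact conj_conj _

@[simp] lemma tm_one_left (x : K) : tm one x = conj x := by rw [tm_apply, CompAlg.one_mul]
@[simp] lemma tm_one_right (x : K) : tm x one = conj x := by rw [tm_apply, CompAlg.mul_one]

@[simp] lemma T_self (i : Fin 3) (x : K) : T i x x = 0 := by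
  have h := T_swap i x x
  have h2 : (2 : ℝ) • T i x x = 0 := by rw [two_smul]; nth_rw 1 [h]; exact neg_add_cancel _
  simpa using h2

/-- A component of an element of the triality algebra, as a linear map. -/
def Tri.appL (i : Fin 3) : Tri K →ₗ[ℝ] Module.End ℝ K where
  toFun φ := φ.app i
  map_add' _ _ := rfl
  map_smul' _ _ := rfl

lemma Tri.appL_apply (i : Fin 3) (φ : Tri K) : Tri.appL i φ = φ.app i := rfl

@[simp] lemma Tri.app_zero (i : Fin 3) : (0 : Tri K).app i = 0 := rfl

lemma Tri.app_neg (φ : Tri K) (i : Fin 3) : (-φ).app i = -φ.app i := rfl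

lemma Tri.app_sub (φ ψ : Tri K) (i : Fin 3) : (φ - ψ).app i = φ.app i - ψ.app i := rfl

end CompAlg

/-! ### Infinitesimal triality. -/

namespace Oct

open CompAlg
open E8 (unit)

variable {ε : ℝ}

/-- The associators of c with (i, j), (i, ℓ) and (j, ℓ) already kill the seven imaginary
coordinates. This holds for every ε. -/
lemma eq_smul_one_of_nucleus (c : Oct ε)
    (h : ∀ x y : Oct ε, mul (mul x y) c = mul x (mul y c)) : c = c.1.re • one := by
  have h1 := h (ImUnit.toOct ε .i) (ImUnit.toOct ε .j)
  have h2 := h (ImUnit.toOct ε .i) (ImUnit.toOct ε .l)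
  have h3 := h (ImUnit.toOct ε .j) (ImUnit.toOct ε .l)
  rw [ext_coord_iff] at h1 h2 h3
  obtain ⟨-, a1, a2, a3, a4⟩ := h1
  obtain ⟨-, b1, b2, b3, b4⟩ := h2
  obtain ⟨-, c1, c2, c3, c4⟩ := h3
  simp at a1 a2 a3 a4 b1 b2 b3 b4 c1 c2 c3 c4
  apply ext_coord <;> simp <;> linarith

/-- With φ₀ = 0 the compatibility condition lets φ₁ pass through left factors; evaluating it with
one argument equal to 1 gives both formulas. -/
lemma Tri.app_two_of_app_zero (φ : Tri (Oct ε)) (h : ∀ x, φ.app 0 x = 0) (y : Oct ε) :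
    φ.app 1 y = mul y (φ.app 1 one) ∧ φ.app 2 y = conj (φ.app 1 (conj y)) := by
  have key : ∀ x y, φ.app 2 (tm x y) = tm x (φ.app 1 y) := fun x y => by
    simpa only [h, map_zero, LinearMap.zero_apply, zero_add] using φ.app_tm 0 x y
  have k2 : ∀ y, φ.app 2 (conj y) = conj (φ.app 1 y) := fun y => by
    rw [← tm_one_left, key, tm_one_left]
  refine ⟨?_, by rw [← k2, conj_conj]⟩
  have := key y one
  rw [tm_one_right, k2, tm_apply] at this
  rw [← conj_conj (φ.app 1 y), this, conj_conj]

/-- The element φ₁(1) associates with all pairs, so it is real; skewness of φ₁ at 1 then makes it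
vanish. This is what allows identities between triples to be checked in index 0 only. -/
lemma Tri.eq_zero_of_app_zero (φ : Tri (Oct ε)) (h : ∀ x, φ.app 0 x = 0) : φ = 0 := by
  have key := Tri.app_two_of_app_zero φ h
  have hc : ∀ x y : Oct ε, mul (mul x y) (φ.app 1 one) = mul x (mul y (φ.app 1 one)) := by
    intro x y
    have := φ.app_tm 0 x y
    simp only [h, map_zero, LinearMap.zero_apply, zero_add] at this
    rw [(key _).2, tm_apply, tm_apply, conj_conj, (key (mul x y)).1, (key y).1] at this
    rw [← conj_conj (mul (mul x y) _), this, conj_conj]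
  have h1 := eq_smul_one_of_nucleus _ hc
  have h2 := φ.skew 1 one one
  have h3 : φ.app 1 one = 0 := by
    rw [h1] at h2 ⊢
    simp [ip_coord] at h2 ⊢
    simp [h2]
  have h4 : ∀ x, φ.app 1 x = 0 := fun x => by rw [(key x).1, h3, map_zero]
  refine Tri.ext fun j r => ?_
  fin_cases j
  · exact h r
  · exact h4 r
  · exact (key r).2.trans (by rw [h4, map_zero]; rfl)

lemma Tri.ext_zero {φ ψ : Tri (Oct ε)} (h : ∀ x, φ.app 0 x = ψ.app 0 x) : φ = ψ :=
  sub_eq_zero.1 (Tri.eq_zero_of_app_zero _ fun x => by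
    rw [Tri.app_sub, LinearMap.sub_apply, h, sub_self])

/-- A skew f is half the sum of the elementary rotations e_p ∧ f(e_p) over an orthonormal basis.
Since T₀ carries a factor 4, the normalization is 1/8. -/
lemma app_zero_sum_T (hε : ε ^ 2 = 1) (f : Module.End ℝ (Oct ε))
    (hf : ∀ x y, ip (f x) y + ip x (f y) = 0) (r : Oct ε) :
    (∑ p, (eta ε p / 8) • T 0 (unit ε p) (f (unit ε p))).app 0 r = f r := by
  rw [← Tri.appL_apply, map_sum, LinearMap.sum_apply]
  have e : ∀ p, Tri.appL 0 ((eta ε p / 8) • T 0 (unit ε p) (f (unit ε p))) r =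
      (1 / 2 : ℝ) • f ((eta ε p * ip (unit ε p) r) • unit ε p) +
        (1 / 2 : ℝ) • (eta ε p * ip (unit ε p) (f r)) • unit ε p := fun p => by
    rw [map_smul, LinearMap.smul_apply, Tri.appL_apply, T_apply, sub_self, tEnd_zero,
      show ip (f (unit ε p)) r = -ip (unit ε p) (f r) by linarith [hf (unit ε p) r], map_smul]
    module
  simp_rw [e]
  rw [Finset.sum_add_distrib, ← Finset.smul_sum, ← Finset.smul_sum, ← map_sum, sum_ip hε, sum_ip hε]
  module

/-- Triality: `tri(𝕆) ≅ 𝔰𝔬(8)` through the component of index `0`. -/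
def triEquiv (hε : ε ^ 2 = 1) : Tri (Oct ε) ≃ₗ⁅ℝ⁆
    skewAdjointLieSubalgebra (ip : Oct ε →ₗ[ℝ] Oct ε →ₗ[ℝ] ℝ) :=
  LieEquiv.ofBijective
    { toFun := fun φ => ⟨φ.app 0, fun x y => by
        have := φ.skew 0 x y
        simp only [LinearMap.neg_apply]
        linarith⟩
      map_add' := fun _ _ => rfl
      map_smul' := fun _ _ => rfl
      map_lie' := rfl }
    ⟨fun φ ψ h => Tri.ext_zero fun x => LinearMap.congr_fun (congrArg Subtype.val h) x,
      fun f => ⟨_, Subtype.ext (LinearMap.ext (app_zero_sum_T hε f.1 fun x y => by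
        have := f.2 x y
        simp only [LinearMap.neg_apply] at this
        linarith))⟩⟩

end Oct

/-! ### The 28 generators of the triality algebra. -/

namespace E8

/-- The names of the 28 generators, as a sum of four copies of the names of the units. -/
def diagIdxEquiv : ImUnit ⊕ ImUnit ⊕ ImUnit ⊕ ImUnit ≃ DiagIdx where
  toFun := Sum.elim .A (Sum.elim .G (Sum.elim .S .D))
  invFun := fun
    | .A p => .inl p
    | .G p => .inr (.inl p)
    | .S p => .inr (.inr (.inl p))
    | .D p => .inr (.inr (.inr p))
  left_inv := by rintro (p | p | p | p) <;> rfl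
  right_inv := by rintro (p | p | p | p) <;> rfl

instance : Fintype DiagIdx := Fintype.ofEquiv _ diagIdxEquiv

instance : DecidableEq DiagIdx := diagIdxEquiv.symm.decidableEq

lemma card_diagIdx : Fintype.card DiagIdx = 28 := rfl

/-- The unordered pairs of distinct units of `𝕆`, each in one order. -/
def unitPair : DiagIdx → Option ImUnit × Option ImUnit
  | .D p => (none, some p)
  | .A p => (some p.a.1, some p.a.2)
  | .G p => (some p.b.1, some p.b.2)
  | .S p => (some p.c.1, some p.c.2)

lemma unitPair_ne (x : DiagIdx) : (unitPair x).1 ≠ (unitPair x).2 := by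
  rcases x with p | p | p | p <;> cases p <;> decide

/-- The tables a, b, c together with the pairs (1, p) run through all 28 unordered pairs of distinct
units. With `unitPair_injective`, each pair occurs once. -/
lemma exists_unitPair (p q : Option ImUnit) :
    p = q ∨ (∃ x, unitPair x = (p, q)) ∨ ∃ x, unitPair x = (q, p) := by
  revert p q; decide

lemma unitPair_injective (x y : DiagIdx)
    (h : unitPair x = unitPair y ∨ unitPair x = (unitPair y).swap) : x = y := by
  revert x y
  decide

end E8

namespace Oct

open CompAlg E8
open E8 (unit)

variable {ε : ℝ}

variable (ε) in
/-- The elements `[X_p, X_q]` of the triality algebra, for pairs of distinct units. -/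
def pairT (x : DiagIdx) : Tri (Oct ε) := T 0 (unit ε (unitPair x).1) (unit ε (unitPair x).2)

lemma eta_ne_zero (h : ε ^ 2 = 1) (p : Option ImUnit) : eta ε p ≠ 0 :=
  fun h0 => by simpa [h0] using eta_sq h p

/-- The rotation in the plane of two units sends one to a multiple of the other and kills the
remaining units. So reading off one matrix entry of φ₀ per pair gives a dual family. -/
lemma linearIndependent_pairT (h : ε ^ 2 = 1) : LinearIndependent ℝ (pairT ε) := by
  have key : ∀ x y : DiagIdx, ((pairT ε y).app 0 (unit ε (unitPair x).1)).coord (unitPair x).2 =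
      if x = y then 4 * eta ε (unitPair x).1 else 0 := fun x y => by
    have hx := unitPair_ne x
    have hxy := unitPair_injective x y
    rw [pairT, T_apply, sub_self, tEnd_zero]
    change coordEquiv ε _ _ = _
    rw [map_sub, map_smul, map_smul, Pi.sub_apply, Pi.smul_apply, Pi.smul_apply]
    change _ • coord _ _ - _ • coord _ _ = _
    rw [ip_unit, ip_unit, coord_unit, coord_unit, coord_unit, coord_unit]
    by_cases hh : x = y
    · subst hh
      simp [hx]
    · have h1 : ¬((unitPair x).1 = (unitPair y).1 ∧ (unitPair x).2 = (unitPair y).2) :=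
        fun h => hh (hxy (Or.inl (Prod.ext h.1 h.2)))
      have h2 : ¬((unitPair x).1 = (unitPair y).2 ∧ (unitPair x).2 = (unitPair y).1) :=
        fun h => hh (hxy (Or.inr (Prod.ext h.1 h.2)))
      rw [if_neg hh]
      split_ifs <;> simp_all
  let f : DiagIdx → Module.Dual ℝ (Tri (Oct ε)) := fun x =>
    (4 * eta ε (unitPair x).1)⁻¹ • (LinearMap.proj (unitPair x).2 ∘ₗ
      (coordEquiv ε).toLinearMap ∘ₗ LinearMap.applyₗ (unit ε (unitPair x).1) ∘ₗ Tri.appL 0)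
  have hf : ∀ x y, f x (pairT ε y) = if x = y then 1 else 0 := fun x y => by
    change (4 * eta ε (unitPair x).1)⁻¹ •
      coord ((pairT ε y).app 0 (unit ε (unitPair x).1)) (unitPair x).2 = _
    rw [key]
    split_ifs
    · rw [smul_eq_mul, inv_mul_cancel₀]
      simpa using eta_ne_zero h _
    · simp
  refine LinearIndependent.of_pairwise_dual_eq_zero_one _ f (fun x y hxy => ?_) fun x => ?_
  · exact (hf x y).trans (if_neg hxy)
  · exact (hf x x).trans (if_pos rfl)

lemma span_pairT (h : ε ^ 2 = 1) : Submodule.span ℝ (Set.range (pairT ε)) = ⊤ := by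
  have hT : ∀ p q, T 0 (unit ε p) (unit ε q) ∈ Submodule.span ℝ (Set.range (pairT ε)) := by
    intro p q
    rcases exists_unitPair p q with h | ⟨x, h⟩ | ⟨x, h⟩
    · rw [h, T_self]; exact zero_mem _
    · have : pairT ε x = T 0 (unit ε p) (unit ε q) := by rw [pairT, h]
      exact this ▸ Submodule.subset_span ⟨x, rfl⟩
    · have : pairT ε x = T 0 (unit ε q) (unit ε p) := by rw [pairT, h]
      rw [T_swap]
      exact neg_mem (this ▸ Submodule.subset_span ⟨x, rfl⟩)
  refine eq_top_iff.2 fun φ _ => ?_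
  rw [show φ = _ from (Tri.ext_zero (app_zero_sum_T h (φ.app 0) (φ.skew 0))).symm]
  refine sum_mem fun p _ => Submodule.smul_mem _ _ ?_
  rw [← sum_coord (φ.app 0 (unit ε p)), map_sum]
  refine sum_mem fun q _ => ?_
  rw [map_smul]
  exact Submodule.smul_mem _ _ (hT p q)

lemma finrank_tri (h : ε ^ 2 = 1) : Module.finrank ℝ (Tri (Oct ε)) = 28 := by
  rw [Module.finrank_eq_card_basis (Module.Basis.mk (linearIndependent_pairT h)
    (span_pairT h).ge), card_diagIdx]

lemma finite_tri (h : ε ^ 2 = 1) : Module.Finite ℝ (Tri (Oct ε)) :=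
  Module.Finite.of_basis (Module.Basis.mk (linearIndependent_pairT h) (span_pairT h).ge)

instance : Module.Finite ℝ (Tri (Oct 1)) := finite_tri (by norm_num)
instance : Module.Finite ℝ (Tri (Oct (-1))) := finite_tri (by norm_num)

variable (ε) in
/-- `½ [X_p, X_q]` for a pair of imaginary units. -/
def halfT (p : ImUnit × ImUnit) : Tri (Oct ε) := (1 / 2 : ℝ) • T 0 (p.1.toOct ε) (p.2.toOct ε)

variable (ε) in
/-- The elements `A_p, G_p, S_p, D_p` of the triality algebra. -/
def triGen : DiagIdx → Tri (Oct ε)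
  | .A p => -(halfT ε p.a - p.orient ε • halfT ε p.b)
  | .G p => -(halfT ε p.a + p.orient ε • halfT ε p.b - (2 * p.orient ε) • halfT ε p.c)
  | .S p => (1 / 2 : ℝ) • T 1 one (p.toOct ε) - (1 / 2 : ℝ) • T 2 one (p.toOct ε)
  | .D p => (1 / 2 : ℝ) • T 0 one (p.toOct ε)


/-- In index 0 the element E_p acts by left and F_p by right multiplication by p, up to the same
lower-order normalization, so their difference is the commutator with p. -/
lemma half_T_app_zero (p : ImUnit) (r : Oct ε) :
    ((1 / 2 : ℝ) • T 1 one (p.toOct ε) - (1 / 2 : ℝ) • T 2 one (p.toOct ε)).app 0 r =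
      mul (p.toOct ε) r - mul r (p.toOct ε) := by
  have hp : conj (p.toOct ε) = -p.toOct ε := by apply ext_coord <;> simp
  simp only [Tri.app_sub, Tri.app_smul, T_apply, show (0 : Fin 3) - 1 = 2 from rfl,
    show (0 : Fin 3) - 2 = 1 from rfl, LinearMap.sub_apply, LinearMap.smul_apply, tEnd_one,
    tEnd_two, tm_apply, CompAlg.mul_one, CompAlg.one_mul, CompAlg.conj_mul, conj_conj, hp, map_neg,
    LinearMap.neg_apply]
  module

/-- The commutator with p acts on the three planes that complete 1, p to quaternionic subalgebras,
and these are spanned by the pairs a(p), b(p), c(p). By triality it is enough to compare the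
components of index 0. -/
lemma triGen_S (h : ε ^ 2 = 1) (p : ImUnit) : triGen ε (.S p) =
    halfT ε p.a + p.orient ε • halfT ε p.b + p.orient ε • halfT ε p.c := by
  refine Tri.ext_zero fun r => ?_
  rw [triGen, half_T_app_zero]
  simp only [halfT, Tri.app_add, Tri.app_smul, T_apply, sub_self, LinearMap.add_apply,
    LinearMap.smul_apply, tEnd_zero]
  simp only [← unit_some, ip_unit]
  have h2 : ε * ε = 1 := by linarith
  simp only [unit_some]
  cases p <;> apply ext_coord <;>
    simp [ImUnit.orient, ImUnit.a, ImUnit.b, ImUnit.c, eta, coord] <;>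
    first | ring1 | (ring_nf; simp only [h]; ring1)

/-- With a, b, c the oriented elements, -A = a - b, -G = a + b - 2c and S = a + b + c; the
coefficients invert this 3 × 3 system. The orientation sign is its own inverse. -/
lemma halfT_mem (h : ε ^ 2 = 1) (p : ImUnit) :
    halfT ε p.a ∈ Submodule.span ℝ (Set.range (triGen ε)) ∧
      halfT ε p.b ∈ Submodule.span ℝ (Set.range (triGen ε)) ∧
      halfT ε p.c ∈ Submodule.span ℝ (Set.range (triGen ε)) := by
  have ho : p.orient ε * p.orient ε = 1 := by
    cases p <;> simp only [ImUnit.orient] <;> linarith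
  have hA : triGen ε (.A p) ∈ Submodule.span ℝ (Set.range (triGen ε)) :=
    Submodule.subset_span ⟨_, rfl⟩
  have hG : triGen ε (.G p) ∈ Submodule.span ℝ (Set.range (triGen ε)) :=
    Submodule.subset_span ⟨_, rfl⟩
  have hS : triGen ε (.S p) ∈ Submodule.span ℝ (Set.range (triGen ε)) :=
    Submodule.subset_span ⟨_, rfl⟩
  have ea : halfT ε p.a = (-(1 / 2) : ℝ) • triGen ε (.A p) + (-(1 / 6) : ℝ) • triGen ε (.G p) +
      (1 / 3 : ℝ) • triGen ε (.S p) := by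
    rw [triGen_S h, triGen, triGen]
    module
  have eb : halfT ε p.b = p.orient ε • ((1 / 2 : ℝ) • triGen ε (.A p) +
      (-(1 / 6) : ℝ) • triGen ε (.G p) + (1 / 3 : ℝ) • triGen ε (.S p)) := by
    rw [triGen_S h, triGen, triGen]
    linear_combination (norm := module) (-ho) • halfT ε p.b
  have ec : halfT ε p.c = p.orient ε • ((1 / 3 : ℝ) • triGen ε (.G p) +
      (1 / 3 : ℝ) • triGen ε (.S p)) := by
    rw [triGen_S h, triGen]
    linear_combination (norm := module) (-ho) • halfT ε p.c
  refine ⟨?_, ?_, ?_⟩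
  · rw [ea]
    exact add_mem (add_mem (Submodule.smul_mem _ _ hA) (Submodule.smul_mem _ _ hG))
      (Submodule.smul_mem _ _ hS)
  · rw [eb]
    exact Submodule.smul_mem _ _ (add_mem (add_mem (Submodule.smul_mem _ _ hA)
      (Submodule.smul_mem _ _ hG)) (Submodule.smul_mem _ _ hS))
  · rw [ec]
    exact Submodule.smul_mem _ _ (add_mem (Submodule.smul_mem _ _ hG)
      (Submodule.smul_mem _ _ hS))

lemma pairT_eq_halfT (p q : ImUnit) :
    T 0 (unit ε (some p)) (unit ε (some q)) = (2 : ℝ) • halfT ε (p, q) := by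
  rw [halfT, smul_smul, unit_some, unit_some]
  norm_num

lemma span_triGen (h : ε ^ 2 = 1) : Submodule.span ℝ (Set.range (triGen ε)) = ⊤ := by
  rw [eq_top_iff, ← span_pairT h, Submodule.span_le]
  rintro _ ⟨p | p | p | p, rfl⟩
  · simp only [pairT, unitPair, pairT_eq_halfT]
    exact Submodule.smul_mem _ _ (halfT_mem h p).1
  · simp only [pairT, unitPair, pairT_eq_halfT]
    exact Submodule.smul_mem _ _ (halfT_mem h p).2.1
  · simp only [pairT, unitPair, pairT_eq_halfT]
    exact Submodule.smul_mem _ _ (halfT_mem h p).2.2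
  · have : pairT ε (.D p) = (2 : ℝ) • triGen ε (.D p) := by
      rw [triGen, smul_smul, pairT, unitPair]
      norm_num
    rw [this]
    exact Submodule.smul_mem _ _ (Submodule.subset_span ⟨_, rfl⟩)

end Oct

/-! ### Brackets of diagonal and off-diagonal elements. -/

namespace Su3

open CompAlg

variable {K₁ K₂ : Type} [AddCommGroup K₁] [Module ℝ K₁] [CompAlg K₁]
  [AddCommGroup K₂] [Module ℝ K₂] [CompAlg K₂]

/-- The diagonal elements. -/
def diagL : Tri K₁ × Tri K₂ →ₗ[ℝ] Su3 K₁ K₂ :=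
  LinearMap.inl ℝ (Tri K₁ × Tri K₂) (Fin 3 → K₁ ⊗[ℝ] K₂)

/-- The off-diagonal elements of a given type. -/
def offL (i : Fin 3) : K₁ ⊗[ℝ] K₂ →ₗ[ℝ] Su3 K₁ K₂ :=
  LinearMap.inr ℝ (Tri K₁ × Tri K₂) (Fin 3 → K₁ ⊗[ℝ] K₂) ∘ₗ LinearMap.single ℝ (fun _ => K₁ ⊗[ℝ] K₂) i

@[simp] lemma diagL_fst (h : Tri K₁ × Tri K₂) : (diagL h : Su3 K₁ K₂).1 = h := rfl
@[simp] lemma diagL_snd (h : Tri K₁ × Tri K₂) : (diagL h : Su3 K₁ K₂).2 = 0 := rfl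
@[simp] lemma offL_fst (i : Fin 3) (t : K₁ ⊗[ℝ] K₂) : (offL i t : Su3 K₁ K₂).1 = 0 := rfl
@[simp] lemma offL_snd (i : Fin 3) (t : K₁ ⊗[ℝ] K₂) :
    (offL i t : Su3 K₁ K₂).2 = Pi.single i t := rfl
@[simp] lemma add_fst' (x y : Su3 K₁ K₂) : (x + y).1 = x.1 + y.1 := rfl
@[simp] lemma add_snd' (x y : Su3 K₁ K₂) : (x + y).2 = x.2 + y.2 := rfl
@[simp] lemma smul_fst' (c : ℝ) (x : Su3 K₁ K₂) : (c • x).1 = c • x.1 := rfl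
@[simp] lemma smul_snd' (c : ℝ) (x : Su3 K₁ K₂) : (c • x).2 = c • x.2 := rfl
@[simp] lemma zero_fst' : (0 : Su3 K₁ K₂).1 = 0 := rfl
@[simp] lemma zero_snd' : (0 : Su3 K₁ K₂).2 = 0 := rfl

lemma ext' {x y : Su3 K₁ K₂} (h₁ : x.1 = y.1) (h₂ : ∀ i, x.2 i = y.2 i) : x = y :=
  Prod.ext h₁ (funext h₂)

lemma eq_diagL_add_sum (x : Su3 K₁ K₂) : x = diagL x.1 + ∑ i, offL i (x.2 i) := by
  refine ext' ?_ fun i => ?_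
  · simp [Fin.sum_univ_three]
  · fin_cases i <;> simp [Fin.sum_univ_three]

lemma lie_fst (x y : Su3 K₁ K₂) : ⁅x, y⁆.1 = ⁅x.1, y.1⁆ + ∑ i, kap i (x.2 i) (y.2 i) := rfl

lemma lie_snd (x y : Su3 K₁ K₂) (i : Fin 3) : ⁅x, y⁆.2 i =
    act i x.1 (y.2 i) - act i y.1 (x.2 i) - tmT (x.2 (i + 1)) (y.2 (i + 2)) +
        tmT (y.2 (i + 1)) (x.2 (i + 2)) := rfl

lemma lie_diagL_diagL (g h : Tri K₁ × Tri K₂) : ⁅(diagL g : Su3 K₁ K₂), diagL h⁆ = diagL ⁅g, h⁆ :=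
  ext' (by simp [lie_fst]) fun i => by simp [lie_snd]

lemma lie_diagL_offL (h : Tri K₁ × Tri K₂) (i : Fin 3) (t : K₁ ⊗[ℝ] K₂) :
    ⁅diagL h, offL i t⁆ = offL i (act i h t) := by
  refine ext' (by simp [lie_fst]) fun j => ?_
  by_cases hj : j = i
  · subst hj; simp [lie_snd]
  · simp [lie_snd, hj]

lemma lie_offL_diagL (h : Tri K₁ × Tri K₂) (i : Fin 3) (t : K₁ ⊗[ℝ] K₂) :
    ⁅offL i t, diagL h⁆ = -offL i (act i h t) := by
  rw [← lie_skew, lie_diagL_offL]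

lemma lie_offL_self (i : Fin 3) (t u : K₁ ⊗[ℝ] K₂) :
    ⁅(offL i t : Su3 K₁ K₂), offL i u⁆ = diagL (kap i t u) := by
  refine ext' ?_ fun j => ?_
  · fin_cases i <;> simp [lie_fst, Fin.sum_univ_three]
  · fin_cases i <;> fin_cases j <;> simp [lie_snd]

end Su3

/-- A submodule containing the image of a spanning family contains the image of every element. -/
lemma Submodule.mem_of_span_eq_top {R M N ι : Type*} [Semiring R] [AddCommMonoid M]
    [AddCommMonoid N] [Module R M] [Module R N] {v : ι → M}
    (hv : Submodule.span R (Set.range v) = ⊤) (f : M →ₗ[R] N) (P : Submodule R N)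
    (h : ∀ i, f (v i) ∈ P) (m : M) : f m ∈ P := by
  have : Submodule.span R (Set.range v) ≤ P.comap f := by
    rw [Submodule.span_le]
    rintro _ ⟨i, rfl⟩
    exact h i
  exact this (hv ▸ Submodule.mem_top)

namespace Oct

open E8 (unit)

lemma span_unit (ε : ℝ) : Submodule.span ℝ (Set.range (unit ε)) = ⊤ := by
  rw [← (unitBasis ε).span_eq]
  congr 2
  ext1 p
  rw [unitBasis_apply]

lemma span_tmul_unit {M : Type*} [AddCommGroup M] [Module ℝ M] (ε : ℝ) (f : Oct ε →ₗ[ℝ] M)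
    (P : Submodule ℝ M) (h : ∀ p, f (unit ε p) ∈ P) (x : Oct ε) : f x ∈ P :=
  Submodule.mem_of_span_eq_top (span_unit ε) f P h x

end Oct

/-! ### The generators of 𝔢₈ form a basis. -/

namespace E8

open CompAlg Su3

lemma ip_one_one (ε : ℝ) : ip (one : Oct ε) one = 1 := by simp [Oct.ip_coord]

lemma ip_one_toOct (ε : ℝ) (p : ImUnit) : ip (one : Oct ε) (p.toOct ε) = 0 := by
  simp [Oct.ip_coord]

/-- The 𝕆'-factor of both labels is 1 and T_i(1, 1) = 0, so the bracket stays in tri(𝕆). The next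
lemma is the mirror image in tri(𝕆'). -/
lemma lie_oLab (i : Fin 3) (q q' : Option ImUnit) :
    ⁅(offL i (lab q none) : E8), offL i (lab q' none)⁆ =
      diagL (0, T i (unit (-1) q) (unit (-1) q')) := by
  rw [lie_offL_self, lab, lab, kap_tmul, Oct.unit_none, T_self, smul_zero, ip_one_one, one_smul]

lemma lie_sLab (i : Fin 3) (Q Q' : Option ImUnit) :
    ⁅(offL i (lab none Q) : E8), offL i (lab none Q')⁆ =
      diagL (T i (unit 1 Q) (unit 1 Q'), 0) := by
  rw [lie_offL_self, lab, lab, kap_tmul, Oct.unit_none, T_self, smul_zero, ip_one_one, one_smul]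

lemma oneT_eq_lab : (oneT : Oct 1 ⊗[ℝ] Oct (-1)) = lab none none := rfl

lemma X_eq (t : Oct 1 ⊗[ℝ] Oct (-1)) : (X t : E8) = offL 0 t := rfl
lemma Y_eq (t : Oct 1 ⊗[ℝ] Oct (-1)) : (Y t : E8) = offL 1 t := rfl
lemma Z_eq (t : Oct 1 ⊗[ℝ] Oct (-1)) : (Z t : E8) = offL 2 t := rfl

/-- The embedding of `tri(𝕆')`. -/
def diagS : Tri (Oct 1) →ₗ[ℝ] E8 := diagL ∘ₗ LinearMap.inl ℝ _ _

/-- The embedding of `tri(𝕆)`. -/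
def diagO : Tri (Oct (-1)) →ₗ[ℝ] E8 := diagL ∘ₗ LinearMap.inr ℝ _ _

lemma diagS_apply (φ : Tri (Oct 1)) : diagS φ = diagL (φ, 0) := rfl
lemma diagO_apply (φ : Tri (Oct (-1))) : diagO φ = diagL (0, φ) := rfl

lemma D_oLab (p : ImUnit) : (D (oLab p) : E8) = diagO (Oct.triGen (-1) (.D p)) := by
  rw [D, X_eq, X_eq, oneT_eq_lab, oLab, lie_oLab, ← diagO_apply, ← map_smul]; rfl

lemma S_oLab (p : ImUnit) : (S (oLab p) : E8) = diagO (Oct.triGen (-1) (.S p)) := by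
  rw [S, E, F, Y_eq, Y_eq, Z_eq, Z_eq, oneT_eq_lab, oLab, lie_oLab, lie_oLab, ← diagO_apply,
    ← diagO_apply, ← map_smul diagO, ← map_smul diagO, ← map_sub]; rfl

lemma DD_oLab (p q : ImUnit) : (DD (oLab p) (oLab q) : E8) = diagO (Oct.halfT (-1) (p, q)) := by
  rw [DD, X_eq, X_eq, oLab, oLab, lie_oLab, ← diagO_apply, ← map_smul]; rfl

lemma D_sLab (p : ImUnit) : (D (sLab p) : E8) = diagS (Oct.triGen 1 (.D p)) := by
  rw [D, X_eq, X_eq, oneT_eq_lab, sLab, lie_sLab, ← diagS_apply, ← map_smul]; rfl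

lemma S_sLab (p : ImUnit) : (S (sLab p) : E8) = diagS (Oct.triGen 1 (.S p)) := by
  rw [S, E, F, Y_eq, Y_eq, Z_eq, Z_eq, oneT_eq_lab, sLab, lie_sLab, lie_sLab, ← diagS_apply,
    ← diagS_apply, ← map_smul diagS, ← map_smul diagS, ← map_sub]; rfl

lemma DD_sLab (p q : ImUnit) : (DD (sLab p) (sLab q) : E8) = diagS (Oct.halfT 1 (p, q)) := by
  rw [DD, X_eq, X_eq, sLab, sLab, lie_sLab, ← diagS_apply, ← map_smul]; rfl

lemma A'_eq (p : ImUnit) : A' p = diagS (Oct.triGen 1 (.A p)) := by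
  rw [A', DD_sLab, DD_sLab, ← map_smul, ← map_sub, ← map_neg]; rfl

lemma G'_eq (p : ImUnit) : G' p = diagS (Oct.triGen 1 (.G p)) := by
  rw [G', DD_sLab, DD_sLab, DD_sLab, ← map_smul, ← map_smul, ← map_add, ← map_sub, ← map_neg]; rfl

lemma gen28_eq (x : DiagIdx) : gen28 x = diagO (Oct.triGen (-1) x) := by
  rcases x with p | p | p | p
  · rw [gen28, A, DD_oLab, DD_oLab, ← map_smul, ← map_sub, ← map_neg]; rfl
  · rw [gen28, G, DD_oLab, DD_oLab, DD_oLab, ← map_smul, ← map_smul, ← map_add, ← map_sub,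
      ← map_neg]; rfl
  · exact S_oLab p
  · exact D_oLab p

/-- The names of the off-diagonal generators, as a sum. -/
def offIdxEquiv : Option ImUnit ⊕ Option ImUnit ⊕ Option ImUnit ≃ OffIdx where
  toFun := Sum.elim .X (Sum.elim .Y .Z)
  invFun := fun
    | .X p => .inl p
    | .Y p => .inr (.inl p)
    | .Z p => .inr (.inr p)
  left_inv := by rintro (p | p | p) <;> rfl
  right_inv := by rintro (p | p | p) <;> rfl

instance : Fintype OffIdx := Fintype.ofEquiv _ offIdxEquiv

/-- The names of the generators labelled by `L`, as a sum. -/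
def boostIdxEquiv : OffIdx ⊕ Bool ≃ BoostIdx where
  toFun := fun
    | .inl (.X p) => .XL p
    | .inl (.Y p) => .YL p
    | .inl (.Z p) => .ZL p
    | .inr true => .DL
    | .inr false => .SL
  invFun := fun
    | .XL p => .inl (.X p)
    | .YL p => .inl (.Y p)
    | .ZL p => .inl (.Z p)
    | .DL => .inr true
    | .SL => .inr false
  left_inv := by rintro ((p | p | p) | (_ | _)) <;> rfl
  right_inv := by rintro (p | p | p | _ | _) <;> rfl

instance : Fintype BoostIdx := Fintype.ofEquiv _ boostIdxEquiv

/-- The names of the 27 elements with a given label, as a sum. -/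
def idx27Equiv : OffIdx ⊕ Fin 3 ≃ Idx27 where
  toFun := fun
    | .inl (.X p) => .X p
    | .inl (.Y p) => .Y p
    | .inl (.Z p) => .Z p
    | .inr 0 => .D
    | .inr 1 => .S
    | .inr 2 => .G
  invFun := fun
    | .X p => .inl (.X p)
    | .Y p => .inl (.Y p)
    | .Z p => .inl (.Z p)
    | .D => .inr 0
    | .S => .inr 1
    | .G => .inr 2
  left_inv := by rintro ((p | p | p) | p) <;> (try fin_cases p) <;> rfl
  right_inv := by rintro (p | p | p | _ | _ | _) <;> rfl

instance : Fintype Idx27 := Fintype.ofEquiv _ idx27Equiv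

lemma card_idx27 : Fintype.card Idx27 = 27 := rfl

/-- The 248 generators. -/
def gen248 : ((DiagIdx ⊕ OffIdx) ⊕ BoostIdx) ⊕ (Option ImUnit ⊕ {Q : ImUnit // Q ≠ .l} × Idx27) →
    E8 :=
  Sum.elim gen78 (Sum.elim gen8 fun x => gen27 x.1 x.2)

/-- The generators contain the 3·64 off-diagonal units and the images of the families A, G, S, D
from both triality algebras, merely distributed over the three groups according to their label. -/
lemma span_gen248 : Submodule.span ℝ (Set.range gen248) = ⊤ := by
  set P := Submodule.span ℝ (Set.range gen248)
  have h78 : ∀ x, gen78 x ∈ P := fun x => Submodule.subset_span ⟨.inl x, rfl⟩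
  have h8 : ∀ x, gen8 x ∈ P := fun x => Submodule.subset_span ⟨.inr (.inl x), rfl⟩
  have h27 : ∀ Q (_ : Q ≠ .l) x, gen27 Q x ∈ P :=
    fun Q hQ x => Submodule.subset_span ⟨.inr (.inr ⟨⟨Q, hQ⟩, x⟩), rfl⟩
  have hoff : ∀ i q Q, (offL i (lab q Q) : E8) ∈ P := by
    intro i q Q
    rcases Q with _ | Q
    · fin_cases i
      exacts [h78 (.inl (.inr (.X q))), h78 (.inl (.inr (.Y q))), h78 (.inl (.inr (.Z q)))]
    · by_cases hQ : Q = .l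
      · subst hQ
        fin_cases i
        exacts [h78 (.inr (.XL q)), h78 (.inr (.YL q)), h78 (.inr (.ZL q))]
      · fin_cases i
        exacts [h27 Q hQ (.X q), h27 Q hQ (.Y q), h27 Q hQ (.Z q)]
  have hO : ∀ φ, diagO φ ∈ P := Submodule.mem_of_span_eq_top
    (Oct.span_triGen (ε := -1) (by norm_num)) diagO P fun x => gen28_eq x ▸ h78 (.inl (.inl x))
  have hS : ∀ φ, diagS φ ∈ P := by
    refine Submodule.mem_of_span_eq_top (Oct.span_triGen (ε := 1) (by norm_num)) diagS P fun x => ?_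
    rcases x with p | p | p | p
    · exact A'_eq p ▸ h8 (some p)
    · rw [← G'_eq p]
      by_cases hp : p = .l
      · exact hp ▸ h8 none
      · exact h27 p hp .G
    · rw [← S_sLab p]
      by_cases hp : p = .l
      · exact hp ▸ h78 (.inr .SL)
      · exact h27 p hp .S
    · rw [← D_sLab p]
      by_cases hp : p = .l
      · exact hp ▸ h78 (.inr .DL)
      · exact h27 p hp .D
  refine eq_top_iff.2 fun x _ => ?_
  rw [eq_diagL_add_sum x]
  refine add_mem ?_ (sum_mem fun i _ => ?_)
  · rw [show x.1 = (x.1.1, 0) + (0, x.1.2) by simp, map_add]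
    exact add_mem (hS _) (hO _)
  · generalize x.2 i = t
    induction t using TensorProduct.induction_on with
    | zero => rw [map_zero]; exact zero_mem _
    | add a b ha hb => rw [map_add]; exact add_mem ha hb
    | tmul y z =>
      refine Oct.span_tmul_unit 1 (offL i ∘ₗ (TensorProduct.mk ℝ _ _).flip z) P (fun p => ?_) y
      exact Oct.span_tmul_unit (-1) (offL i ∘ₗ TensorProduct.mk ℝ _ _ (unit 1 p)) P
        (fun q => hoff i q p) z

instance : Module.Finite ℝ E8 :=
  inferInstanceAs (Module.Finite ℝ ((Tri (Oct 1) × Tri (Oct (-1))) ×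
    (Fin 3 → Oct 1 ⊗[ℝ] Oct (-1))))

lemma finrank_eq : Module.finrank ℝ E8 = 248 := by
  change Module.finrank ℝ ((Tri (Oct 1) × Tri (Oct (-1))) × (Fin 3 → Oct 1 ⊗[ℝ] Oct (-1))) = 248
  rw [Module.finrank_prod, Module.finrank_prod, Oct.finrank_tri (by norm_num),
    Oct.finrank_tri (by norm_num), Module.finrank_pi_fintype]
  simp [Module.finrank_tensorProduct, Oct.finrank_eq]

/-- There are 28 + 24 + 26 + 8 + 6·27 = 248 generators, as many as the dimension, so spanning
suffices. Every later independence statement restricts this one. -/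
lemma linearIndependent_gen248 : LinearIndependent ℝ gen248 := by
  refine linearIndependent_of_top_le_span_of_card_eq_finrank span_gen248.ge ?_
  have h1 : Fintype.card OffIdx = 24 := rfl
  have h2 : Fintype.card BoostIdx = 26 := rfl
  have h3 : Fintype.card {Q : ImUnit // Q ≠ .l} = 6 := rfl
  have h4 : Fintype.card (Option ImUnit) = 8 := rfl
  simp only [finrank_eq, Fintype.card_sum, Fintype.card_prod, card_diagIdx, h1, h2, h3, h4,
    card_idx27]

end E8

/-! ### The subalgebras 𝔰𝔬(8) and 𝔣₄. -/

namespace E8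

open CompAlg Su3

lemma tmT_one_tmul (x y : Oct (-1)) :
    tmT ((one : Oct 1) ⊗ₜ[ℝ] x) ((one : Oct 1) ⊗ₜ[ℝ] y) = (one : Oct 1) ⊗ₜ[ℝ] tm x y := by
  rw [tmT_tmul, tm_one_left, conj_one]

lemma kap_one_tmul (i : Fin 3) (x y : Oct (-1)) :
    kap i ((one : Oct 1) ⊗ₜ[ℝ] x) ((one : Oct 1) ⊗ₜ[ℝ] y) = (0, T i x y) := by
  rw [kap_tmul, T_self, smul_zero, ip_one_one, one_smul]

lemma act_one_tmul (i : Fin 3) (h : Tri (Oct 1) × Tri (Oct (-1))) (hh : h.1 = 0) (x : Oct (-1)) :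
    act i h ((one : Oct 1) ⊗ₜ[ℝ] x) = (one : Oct 1) ⊗ₜ[ℝ] h.2.app i x := by
  rw [act_tmul, hh, Tri.app_zero, LinearMap.zero_apply, TensorProduct.zero_tmul, zero_add]

/-- The span of the 52 generators, as a Lie subalgebra. -/
def f4Sub : LieSubalgebra ℝ E8 where
  carrier := {x | x.1.1 = 0 ∧ ∃ o : Fin 3 → Oct (-1), ∀ i, x.2 i = (one : Oct 1) ⊗ₜ[ℝ] o i}
  add_mem' := by
    rintro x y ⟨hx, o, ho⟩ ⟨hy, o', ho'⟩
    refine ⟨by simp [hx, hy], o + o', fun i => ?_⟩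
    simp [ho, ho', TensorProduct.tmul_add]
  zero_mem' := ⟨rfl, 0, fun i => by simp⟩
  smul_mem' := by
    rintro c x ⟨hx, o, ho⟩
    refine ⟨by simp [hx], c • o, fun i => ?_⟩
    simp [ho]
  lie_mem' := by
    rintro x y ⟨hx, o, ho⟩ ⟨hy, o', ho'⟩
    refine ⟨?_, fun i => x.1.2.app i (o' i) - y.1.2.app i (o i) - tm (o (i + 1)) (o' (i + 2)) +
      tm (o' (i + 1)) (o (i + 2)), fun i => ?_⟩
    · rw [lie_fst, Prod.fst_add]
      simp only [ho, ho', kap_one_tmul, Fin.sum_univ_three, Prod.fst_add, add_zero]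
      change ⁅x.1.1, y.1.1⁆ = 0
      rw [hx, zero_lie]
    · simp only [lie_snd, ho, ho', tmT_one_tmul, act_one_tmul i _ hx, act_one_tmul i _ hy,
        TensorProduct.tmul_add, TensorProduct.tmul_sub]

/-- The span of the 28 generators, as a Lie subalgebra. -/
def so8Sub : LieSubalgebra ℝ E8 where
  carrier := {x | x.1.1 = 0 ∧ x.2 = 0}
  add_mem' := by rintro x y ⟨hx, hx'⟩ ⟨hy, hy'⟩; simp [hx, hx', hy, hy']
  zero_mem' := ⟨rfl, rfl⟩
  smul_mem' := by rintro c x ⟨hx, hx'⟩; simp [hx, hx']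
  lie_mem' := by
    rintro x y ⟨hx, hx'⟩ ⟨hy, hy'⟩
    refine ⟨?_, funext fun i => ?_⟩
    · rw [lie_fst, hx', Prod.fst_add]
      simp only [Pi.zero_apply, map_zero, LinearMap.zero_apply, Finset.sum_const_zero,
        Prod.fst_zero, add_zero]
      change ⁅x.1.1, y.1.1⁆ = 0
      rw [hx, zero_lie]
    · rw [lie_snd, hx', hy']
      simp

lemma diagO_mem_span (φ : Tri (Oct (-1))) : diagO φ ∈ Submodule.span ℝ (Set.range gen28) :=
  Submodule.mem_of_span_eq_top (Oct.span_triGen (ε := -1) (by norm_num)) diagO _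
    (fun x => gen28_eq x ▸ Submodule.subset_span ⟨x, rfl⟩) φ

/-- If the span of a set is the underlying space of a Lie subalgebra, it is the Lie span. -/
lemma lieSpan_eq_of_span_eq {s : Set E8} {L : LieSubalgebra ℝ E8}
    (h : L.toSubmodule = Submodule.span ℝ s) : LieSubalgebra.lieSpan ℝ E8 s = L := by
  refine le_antisymm (LieSubalgebra.lieSpan_le.2 fun x hx => ?_) ?_
  · have : x ∈ L.toSubmodule := h ▸ Submodule.subset_span hx
    exact this
  · rw [← LieSubalgebra.toSubmodule_le_toSubmodule, h]
    exact LieSubalgebra.submodule_span_le_lieSpan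

lemma so8Sub_eq_span : so8Sub.toSubmodule = Submodule.span ℝ (Set.range gen28) := by
  refine le_antisymm ?_ (Submodule.span_le.2 ?_)
  · rintro x ⟨h1, h2⟩
    have : x = diagO x.1.2 := ext' (Prod.ext h1 rfl) fun i => congrFun h2 i
    rw [this]
    exact diagO_mem_span _
  · rintro _ ⟨x, rfl⟩
    rw [gen28_eq]
    exact ⟨rfl, rfl⟩

lemma so8_eq : so8 = so8Sub := lieSpan_eq_of_span_eq so8Sub_eq_span

lemma offL_one_mem_span (i : Fin 3) (x : Oct (-1)) :
    (offL i ((one : Oct 1) ⊗ₜ[ℝ] x) : E8) ∈ Submodule.span ℝ (Set.range gen24) := by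
  refine Oct.span_tmul_unit (-1) (offL i ∘ₗ TensorProduct.mk ℝ _ _ one) _ (fun q => ?_) x
  fin_cases i
  exacts [Submodule.subset_span ⟨.X q, rfl⟩, Submodule.subset_span ⟨.Y q, rfl⟩,
    Submodule.subset_span ⟨.Z q, rfl⟩]

lemma span_gen52 : Submodule.span ℝ (Set.range gen52) =
    Submodule.span ℝ (Set.range gen28) ⊔ Submodule.span ℝ (Set.range gen24) := by
  rw [gen52, Set.Sum.elim_range, Submodule.span_union]

lemma f4Sub_eq_span : f4Sub.toSubmodule = Submodule.span ℝ (Set.range gen52) := by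
  refine le_antisymm ?_ (Submodule.span_le.2 ?_)
  · rintro x ⟨h1, o, h2⟩
    rw [eq_diagL_add_sum x, span_gen52]
    refine add_mem (Submodule.mem_sup_left ?_) (sum_mem fun i _ => Submodule.mem_sup_right ?_)
    · rw [show x.1 = (0, x.1.2) from Prod.ext h1 rfl]
      exact diagO_mem_span _
    · rw [h2]
      exact offL_one_mem_span _ _
  · rintro _ ⟨x | x, rfl⟩
    · change gen28 x ∈ f4Sub
      rw [gen28_eq]
      exact ⟨rfl, 0, fun i => by simp [diagO_apply]⟩
    · have key : ∀ i q, (offL i (lab q none) : E8) ∈ f4Sub := fun i q =>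
        ⟨rfl, Pi.single i (unit (-1) q), fun j => by
          rw [offL_snd]
          by_cases hj : j = i
          · subst hj; rw [Pi.single_eq_same, Pi.single_eq_same]; rfl
          · rw [Pi.single_eq_of_ne hj, Pi.single_eq_of_ne hj, TensorProduct.tmul_zero]⟩
      rcases x with q | q | q
      exacts [key 0 q, key 1 q, key 2 q]

lemma f4_eq : f4 = f4Sub := lieSpan_eq_of_span_eq f4Sub_eq_span

lemma mem_f4_iff (x : E8) :
    x ∈ f4 ↔ x.1.1 = 0 ∧ ∃ o : Fin 3 → Oct (-1), ∀ i, x.2 i = (one : Oct 1) ⊗ₜ[ℝ] o i := by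
  rw [f4_eq]; rfl

lemma linearIndependent_gen78 : LinearIndependent ℝ gen78 :=
  linearIndependent_gen248.comp Sum.inl Sum.inl_injective

lemma linearIndependent_gen52 : LinearIndependent ℝ gen52 :=
  linearIndependent_gen78.comp Sum.inl Sum.inl_injective

lemma linearIndependent_gen28 : LinearIndependent ℝ gen28 :=
  linearIndependent_gen52.comp Sum.inl Sum.inl_injective

lemma finrank_so8 : Module.finrank ℝ so8 = 28 := by
  change Module.finrank ℝ so8.toSubmodule = 28
  rw [so8_eq, so8Sub_eq_span, finrank_span_eq_card linearIndependent_gen28, card_diagIdx]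

lemma finrank_f4 : Module.finrank ℝ f4 = 52 := by
  change Module.finrank ℝ f4.toSubmodule = 52
  rw [f4_eq, f4Sub_eq_span, finrank_span_eq_card linearIndependent_gen52]
  rfl

/-- `𝔰𝔬(8)` is the triality algebra of `𝕆`. -/
def triEquivSo8Sub : Tri (Oct (-1)) ≃ₗ⁅ℝ⁆ so8Sub :=
  LieEquiv.ofBijective
    { toFun := fun φ => ⟨diagO φ, rfl, rfl⟩
      map_add' := fun φ ψ => Subtype.ext (map_add diagO φ ψ)
      map_smul' := fun c φ => Subtype.ext (map_smul diagO c φ)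
      map_lie' := fun {φ ψ} => Subtype.ext (by
        change diagO ⁅φ, ψ⁆ = ⁅diagO φ, diagO ψ⁆
        rw [diagO_apply, diagO_apply, diagO_apply, lie_diagL_diagL]
        congr 1
        exact Prod.ext (lie_self (0 : Tri (Oct 1))).symm rfl) }
    ⟨fun φ ψ h => congrArg (fun x : so8Sub => (x : E8).1.2) h,
      fun ⟨x, h1, h2⟩ => ⟨x.1.2, Subtype.ext (ext' (Prod.ext h1.symm rfl)
        fun i => (congrFun h2 i).symm)⟩⟩

lemma so8_equiv : Nonempty (so8 ≃ₗ⁅ℝ⁆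
    skewAdjointLieSubalgebra (ip : Oct (-1) →ₗ[ℝ] Oct (-1) →ₗ[ℝ] ℝ)) := by
  rw [so8_eq]
  exact ⟨triEquivSo8Sub.symm.trans (Oct.triEquiv (by norm_num))⟩

end E8

/-! The subalgebra `𝔰𝔲(3, ℂ' ⊗ 𝕆)`. -/

namespace SplitC

open CompAlg

/-- The split imaginary unit `L` of `ℂ'`. -/
def L : SplitC := mk 0 1

@[simp] lemma L_fst : L.1 = 0 := rfl
@[simp] lemma L_snd : L.2 = 1 := rfl
@[simp] lemma one_fst : (one : SplitC).1 = 1 := rfl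
@[simp] lemma one_snd : (one : SplitC).2 = 0 := rfl
@[simp] lemma neg_fst (x : SplitC) : (-x).1 = -x.1 := rfl
@[simp] lemma neg_snd (x : SplitC) : (-x).2 = -x.2 := rfl
@[simp] lemma sub_fst (x y : SplitC) : (x - y).1 = x.1 - y.1 := rfl
@[simp] lemma sub_snd (x y : SplitC) : (x - y).2 = x.2 - y.2 := rfl
@[simp] lemma mul_fst (x y : SplitC) : (mul x y).1 = x.1 * y.1 + x.2 * y.2 := rfl
@[simp] lemma mul_snd (x y : SplitC) : (mul x y).2 = x.1 * y.2 + x.2 * y.1 := rfl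
@[simp] lemma conj_fst (x : SplitC) : (conj x).1 = x.1 := rfl
@[simp] lemma conj_snd (x : SplitC) : (conj x).2 = -x.2 := rfl
@[simp] lemma tm_fst (x y : SplitC) : (tm x y).1 = x.1 * y.1 + x.2 * y.2 := rfl
@[simp] lemma tm_snd (x y : SplitC) : (tm x y).2 = -(x.1 * y.2 + x.2 * y.1) := rfl

lemma ip_eq (x y : SplitC) : ip x y = x.1 * y.1 - x.2 * y.2 := by
  change x.1 * y.1 + x.2 * -y.2 = _
  ring

lemma eq_add (z : SplitC) : z = z.1 • one + z.2 • L := by ext1 <;> simp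

/-- The coefficients of an element of the triality algebra of `ℂ'`. -/
def coef (i : Fin 3) : Tri SplitC →ₗ[ℝ] ℝ where
  toFun φ := (φ.app i one).2
  map_add' _ _ := rfl
  map_smul' _ _ := rfl

/-- A skew endomorphism of the plane ℂ' is a multiple of the swap 1 ↔ L, so each component is
recorded by a single number. -/
lemma app_one (φ : Tri SplitC) (i : Fin 3) : φ.app i one = coef i φ • L := by
  have h := φ.skew i one one
  rw [ip_eq, ip_eq] at h
  simp at h
  ext1
  · simpa using by linarith
  · simp; rfl

lemma app_L (φ : Tri SplitC) (i : Fin 3) : φ.app i L = coef i φ • one := by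
  have h := φ.skew i L L
  have h' := φ.skew i one L
  rw [app_one] at h'
  rw [ip_eq, ip_eq] at h h'
  simp at h h'
  ext1 <;> simp <;> linarith

/-- This is the compatibility condition at (1, 1), where conjugation changes the sign of L. So
tri(ℂ') is at most a plane. -/
lemma coef_sum (φ : Tri SplitC) : coef 0 φ + coef 1 φ + coef 2 φ = 0 := by
  have h := congrArg Prod.snd (φ.app_tm 0 one one)
  rw [tm_one_left, conj_one, zero_add, zero_add, app_one, app_one, app_one, tm_one_left,
    tm_one_right] at h
  have h : coef 2 φ * 1 = -(coef 0 φ * 1) + -(coef 1 φ * 1) := h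
  linarith

lemma tri_ext {φ ψ : Tri SplitC} (h : ∀ i, coef i φ = coef i ψ) : φ = ψ := by
  refine Tri.ext fun i z => ?_
  rw [eq_add z]
  simp only [map_add, map_smul, app_one, app_L, h]

lemma coef_T (i j : Fin 3) (x y : SplitC) :
    coef j (T i x y) = (if j = i then 4 else -2) * (x.1 * y.2 - x.2 * y.1) := by
  change (tEnd (j - i) x y one).2 = _
  rw [show (if j = i then 4 else -2 : ℝ) = if j - i = 0 then 4 else -2 by simp only [sub_eq_zero]]
  generalize j - i = k
  fin_cases k
  · simp only [Fin.zero_eta, tEnd_zero, ip_eq]; simp; ring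
  · simp only [Fin.mk_one, tEnd_one]; simp; ring
  · simp only [Fin.reduceFinMk, tEnd_two]; simp; ring

/-- T_j(1, L) has coefficients 4, -2, -2. Since the coefficients of φ sum to 0, the combination has
coefficient 4c + 2c = 6c in each index, whence the division by 6. -/
lemma eq_sum_T (φ : Tri SplitC) : φ = ∑ i, (coef i φ / 6) • T i one L := by
  refine tri_ext fun j => ?_
  have := coef_sum φ
  rw [map_sum, Fin.sum_univ_three]
  simp only [map_smul, coef_T, smul_eq_mul]
  fin_cases j <;> simp <;> linarith

@[simp] lemma incl_fst (z : SplitC) : (incl z).1 = (z.1 : ℍ[ℝ]) := rfl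
@[simp] lemma incl_snd (z : SplitC) : (incl z).2 = (z.2 : ℍ[ℝ]) := rfl

lemma incl_one : incl one = one := by apply Oct.ext_coord <;> simp
lemma incl_L : incl L = ImUnit.l.toOct 1 := by apply Oct.ext_coord <;> simp

lemma incl_mul (x y : SplitC) : incl (mul x y) = mul (incl x) (incl y) := by
  apply Oct.ext_coord <;> simp <;> ring

lemma incl_conj (x : SplitC) : incl (conj x) = conj (incl x) := by
  apply Oct.ext_coord <;> simp

lemma incl_tm (x y : SplitC) : incl (tm x y) = tm (incl x) (incl y) := by
  rw [tm_apply, incl_conj, incl_mul, tm_apply]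

lemma ip_incl (x y : SplitC) : ip (incl x) (incl y) = ip x y := by
  rw [ip_eq, Oct.ip_coord]; simp

lemma incl_injective : Function.Injective incl := by
  intro x y h
  rw [Oct.ext_coord_iff] at h
  simp at h
  exact SplitC.ext h.1 h.2

lemma incl_tEnd (k : Fin 3) (x y z : SplitC) :
    tEnd k (incl x) (incl y) (incl z) = incl (tEnd k x y z) := by
  fin_cases k
  · simp only [Fin.zero_eta, tEnd_zero, ip_incl, map_sub, map_smul]
  · simp only [Fin.mk_one, tEnd_one, incl_tm, map_sub]
  · simp only [Fin.reduceFinMk, tEnd_two, incl_tm, map_sub]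

/-- The inclusion of the triality algebra of `ℂ'` into that of `𝕆'`. -/
def triIncl : Tri SplitC →ₗ[ℝ] Tri (Oct 1) :=
  ∑ i, ((1 / 6 : ℝ) • coef i).smulRight (T i one (ImUnit.l.toOct 1))

lemma triIncl_apply (φ : Tri SplitC) :
    triIncl φ = ∑ i, (coef i φ / 6) • T i one (ImUnit.l.toOct 1) := by
  simp [triIncl, LinearMap.sum_apply, div_eq_inv_mul]

lemma app_triIncl (φ : Tri SplitC) (i : Fin 3) (z : SplitC) :
    (triIncl φ).app i (incl z) = incl (φ.app i z) := by
  conv_rhs => rw [eq_sum_T φ]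
  rw [triIncl_apply, ← Tri.appL_apply, ← Tri.appL_apply, map_sum, map_sum, LinearMap.sum_apply,
    LinearMap.sum_apply, map_sum]
  refine Finset.sum_congr rfl fun j _ => ?_
  rw [map_smul, map_smul, LinearMap.smul_apply, LinearMap.smul_apply, map_smul, Tri.appL_apply,
    Tri.appL_apply, T_apply, T_apply, ← incl_one, ← incl_L, incl_tEnd]

/-- The cyclic identity for (1, 1, x). It says D + E + F = 0 and leaves only D and S as independent
combinations. -/
lemma sum_T_one {K : Type} [AddCommGroup K] [Module ℝ K] [CompAlg K] (x : K) (hx : conj x = -x) :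
    T 0 one x + T 1 one x + T 2 one x = 0 := by
  have h := T_cyclic 0 one one x
  rw [tm_one_left, tm_one_left, tm_one_right, conj_one, hx, zero_add, zero_add, map_neg, map_neg,
    LinearMap.neg_apply, LinearMap.neg_apply, ← T_swap, ← T_swap] at h
  rw [← h]
  abel

lemma conj_toOct (ε : ℝ) (p : ImUnit) : conj (p.toOct ε) = -p.toOct ε := by
  apply Oct.ext_coord <;> simp

/-- Both sides are alternating in x, y, so only T_i(1, L) matters. The coefficients 4, -2, -2 over 6
reproduce it because the three T_j(1, L) sum to 0. -/
lemma triIncl_T (i : Fin 3) (x y : SplitC) : triIncl (T i x y) = T i (incl x) (incl y) := by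
  have e : T i (incl x) (incl y) = (x.1 * y.2 - x.2 * y.1) • T i one (ImUnit.l.toOct 1) := by
    rw [eq_add x, eq_add y]
    simp only [map_add, map_smul, LinearMap.add_apply, LinearMap.smul_apply, incl_one, incl_L,
      T_self, T_swap i (ImUnit.l.toOct 1) one]
    simp
    module
  have h := sum_T_one _ (conj_toOct 1 .l)
  rw [triIncl_apply, e, Fin.sum_univ_three]
  simp only [coef_T]
  fin_cases i <;> simp
  all_goals linear_combination (norm := module) (-(x.1 * y.2 - x.2 * y.1) / 3) • h

lemma coef_lie (φ ψ : Tri SplitC) (i : Fin 3) : coef i ⁅φ, ψ⁆ = 0 := by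
  change (⁅φ, ψ⁆.app i one).2 = 0
  rw [Tri.app_lie, app_one, app_one, map_smul, map_smul, app_L, app_L, smul_smul, smul_smul,
    mul_comm, sub_self]
  rfl

/-- Both sides vanish: tri(ℂ') is abelian, and the right side reduces to multiples of T_i(L, L) and
T_i(1, 1). -/
lemma triIncl_lie (φ ψ : Tri SplitC) : triIncl ⁅φ, ψ⁆ = ⁅triIncl φ, triIncl ψ⁆ := by
  rw [triIncl_apply ⁅φ, ψ⁆, triIncl_apply ψ, Fin.sum_univ_three, Fin.sum_univ_three]
  simp only [coef_lie, lie_add, lie_smul, T_lie, ← incl_one, ← incl_L, app_triIncl, app_one, app_L,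
    map_smul, LinearMap.smul_apply, T_self]
  simp

lemma triIncl_injective : Function.Injective triIncl := by
  intro φ ψ h
  refine Tri.ext fun i z => incl_injective ?_
  rw [← app_triIncl, ← app_triIncl, h]

end SplitC

/-! ### The embedding of 𝔰𝔲(3, ℂ' ⊗ 𝕆) and the subalgebra 𝔢₆. -/

namespace E8

open CompAlg Su3 SplitC

/-- The inclusion `ℂ' ⊗ 𝕆 ⊂ 𝕆' ⊗ 𝕆`. -/
def inclT : SplitC ⊗[ℝ] Oct (-1) →ₗ[ℝ] Oct 1 ⊗[ℝ] Oct (-1) := LinearMap.rTensor (Oct (-1)) incl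

@[simp] lemma inclT_tmul (z : SplitC) (x : Oct (-1)) :
    inclT (z ⊗ₜ[ℝ] x) = incl z ⊗ₜ[ℝ] x := rfl

lemma inclT_injective : Function.Injective inclT :=
  Module.Flat.rTensor_preserves_injective_linearMap _ incl_injective

/-- The inclusion on diagonal elements. -/
def diagIncl : Tri SplitC × Tri (Oct (-1)) →ₗ[ℝ] Tri (Oct 1) × Tri (Oct (-1)) :=
  LinearMap.prodMap triIncl LinearMap.id

lemma diagIncl_apply (h : Tri SplitC × Tri (Oct (-1))) : diagIncl h = (triIncl h.1, h.2) := rfl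

lemma kap_inclT (i : Fin 3) (u v : SplitC ⊗[ℝ] Oct (-1)) :
    kap i (inclT u) (inclT v) = diagIncl (kap i u v) := by
  induction u using TensorProduct.induction_on with
  | zero => simp
  | add a b ha hb => simp only [map_add, LinearMap.add_apply, ha, hb]
  | tmul x x' =>
    induction v using TensorProduct.induction_on with
    | zero => simp
    | add a b ha hb => simp only [map_add, ha, hb]
    | tmul y y' =>
      rw [inclT_tmul, inclT_tmul, kap_tmul, kap_tmul, diagIncl_apply, map_smul, triIncl_T, ip_incl]

lemma tmT_inclT (u v : SplitC ⊗[ℝ] Oct (-1)) : tmT (inclT u) (inclT v) = inclT (tmT u v) := by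
  induction u using TensorProduct.induction_on with
  | zero => simp
  | add a b ha hb => simp only [map_add, LinearMap.add_apply, ha, hb]
  | tmul x x' =>
    induction v using TensorProduct.induction_on with
    | zero => simp
    | add a b ha hb => simp only [map_add, ha, hb]
    | tmul y y' => rw [inclT_tmul, inclT_tmul, tmT_tmul, tmT_tmul, inclT_tmul, incl_tm]

lemma act_inclT (i : Fin 3) (h : Tri SplitC × Tri (Oct (-1))) (u : SplitC ⊗[ℝ] Oct (-1)) :
    act i (diagIncl h) (inclT u) = inclT (act i h u) := by
  induction u using TensorProduct.induction_on with
  | zero => simp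
  | add a b ha hb => simp only [map_add, ha, hb]
  | tmul x x' =>
    rw [inclT_tmul, act_tmul, act_tmul, map_add, inclT_tmul, inclT_tmul, diagIncl_apply,
      app_triIncl]

/-- The inclusion `𝔰𝔲(3, ℂ' ⊗ 𝕆) ⊂ 𝔰𝔲(3, 𝕆' ⊗ 𝕆)`. -/
def su3Incl : Su3 SplitC (Oct (-1)) →ₗ⁅ℝ⁆ E8 where
  toFun x := (diagIncl x.1, fun i => inclT (x.2 i))
  map_add' x y := ext' (map_add diagIncl _ _) fun i => map_add inclT _ _
  map_smul' c x := ext' (map_smul diagIncl _ _) fun i => map_smul inclT _ _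
  map_lie' {x y} := by
    refine ext' ?_ fun i => ?_
    · rw [lie_fst]
      change diagIncl ⁅x, y⁆.1 = ⁅diagIncl x.1, diagIncl y.1⁆ +
        ∑ i, kap i (inclT (x.2 i)) (inclT (y.2 i))
      rw [lie_fst, map_add, map_sum]
      congr 1
      · exact Prod.ext (triIncl_lie _ _) rfl
      · exact Finset.sum_congr rfl fun i _ => (kap_inclT i _ _).symm
    · change inclT (⁅x, y⁆.2 i) = act i (diagIncl x.1) (inclT (y.2 i)) -
        act i (diagIncl y.1) (inclT (x.2 i)) - tmT (inclT (x.2 (i + 1))) (inclT (y.2 (i + 2))) +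
        tmT (inclT (y.2 (i + 1))) (inclT (x.2 (i + 2)))
      simp only [act_inclT, tmT_inclT, ← map_sub, ← map_add]
      rfl

lemma su3Incl_fst (x : Su3 SplitC (Oct (-1))) : (su3Incl x).1 = (triIncl x.1.1, x.1.2) := rfl

lemma su3Incl_snd (x : Su3 SplitC (Oct (-1))) (i : Fin 3) : (su3Incl x).2 i = inclT (x.2 i) := rfl

lemma su3Incl_offL (i : Fin 3) (t : SplitC ⊗[ℝ] Oct (-1)) :
    su3Incl (offL i t) = offL i (inclT t) := by
  refine ext' ?_ fun j => ?_
  · exact Prod.ext (map_zero triIncl) rfl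
  · rw [su3Incl_snd, offL_snd, offL_snd]
    by_cases hj : j = i
    · subst hj; simp
    · simp [hj]

lemma su3Incl_diagL (h : Tri SplitC × Tri (Oct (-1))) :
    su3Incl (diagL h) = diagL (triIncl h.1, h.2) :=
  ext' rfl fun _ => map_zero inclT

lemma su3Incl_injective : Function.Injective su3Incl := by
  intro x y h
  refine ext' (Prod.ext ?_ ?_) fun i => ?_
  · exact triIncl_injective (congrArg (fun x : E8 => x.1.1) h)
  · exact congrArg (fun x : E8 => x.1.2) h
  · exact inclT_injective (congrArg (fun x : E8 => x.2 i) h)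

/-- T₀ = 2D_L, while T₁ - T₂ = 2S_L and T₁ + T₂ = -T₀, so D_L and S_L recover all three. -/
lemma T_L_mem_span (i : Fin 3) : diagS (T i one (ImUnit.l.toOct 1)) ∈
    Submodule.span ℝ (Set.range boost) := by
  have h := sum_T_one _ (conj_toOct 1 .l)
  have hD : diagS (Oct.triGen 1 (.D .l)) ∈ Submodule.span ℝ (Set.range boost) :=
    Submodule.subset_span ⟨.DL, D_sLab _⟩
  have hS : diagS (Oct.triGen 1 (.S .l)) ∈ Submodule.span ℝ (Set.range boost) :=
    Submodule.subset_span ⟨.SL, S_sLab _⟩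
  have key : ∀ a b : ℝ, diagS (a • Oct.triGen 1 (.D .l) + b • Oct.triGen 1 (.S .l)) ∈
      Submodule.span ℝ (Set.range boost) := fun a b => by
    rw [map_add, map_smul, map_smul]
    exact add_mem (Submodule.smul_mem _ _ hD) (Submodule.smul_mem _ _ hS)
  have e0 : T 0 one (ImUnit.l.toOct 1) =
      (2 : ℝ) • Oct.triGen 1 (.D .l) + (0 : ℝ) • Oct.triGen 1 (.S .l) := by
    rw [zero_smul, add_zero, Oct.triGen, smul_smul]
    norm_num
  have e1 : T 1 one (ImUnit.l.toOct 1) =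
      (-1 : ℝ) • Oct.triGen 1 (.D .l) + (1 : ℝ) • Oct.triGen 1 (.S .l) := by
    rw [Oct.triGen, Oct.triGen]
    linear_combination (norm := module) (1 / 2 : ℝ) • h
  have e2 : T 2 one (ImUnit.l.toOct 1) =
      (-1 : ℝ) • Oct.triGen 1 (.D .l) + (-1 : ℝ) • Oct.triGen 1 (.S .l) := by
    rw [Oct.triGen, Oct.triGen]
    linear_combination (norm := module) (1 / 2 : ℝ) • h
  fin_cases i
  exacts [e0 ▸ key _ _, e1 ▸ key _ _, e2 ▸ key _ _]

lemma offL_L_mem_span (i : Fin 3) (x : Oct (-1)) :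
    (offL i (ImUnit.l.toOct 1 ⊗ₜ[ℝ] x) : E8) ∈ Submodule.span ℝ (Set.range boost) := by
  refine Oct.span_tmul_unit (-1) (offL i ∘ₗ TensorProduct.mk ℝ _ _ _) _ (fun q => ?_) x
  fin_cases i
  exacts [Submodule.subset_span ⟨.XL q, rfl⟩, Submodule.subset_span ⟨.YL q, rfl⟩,
    Submodule.subset_span ⟨.ZL q, rfl⟩]

lemma span_gen78 : Submodule.span ℝ (Set.range gen78) =
    (Submodule.span ℝ (Set.range gen28) ⊔ Submodule.span ℝ (Set.range gen24)) ⊔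
      Submodule.span ℝ (Set.range boost) := by
  rw [gen78, Set.Sum.elim_range, Submodule.span_union, span_gen52]

/-- The image consists of tri(𝕆), the plane of the T_i(1, L), and the entries with labels in 1 ⊗ 𝕆
and L ⊗ 𝕆. Being the range of a homomorphism, the span of the 78 elements is closed under brackets.
-/
lemma range_su3Incl : su3Incl.range.toSubmodule = Submodule.span ℝ (Set.range gen78) := by
  refine le_antisymm ?_ (Submodule.span_le.2 ?_)
  · rintro _ ⟨x, rfl⟩
    change su3Incl x ∈ _
    rw [span_gen78, eq_diagL_add_sum (su3Incl x), su3Incl_fst]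
    refine add_mem ?_ (sum_mem fun i _ => ?_)
    · rw [show (triIncl x.1.1, x.1.2) = (triIncl x.1.1, 0) + (0, x.1.2) by simp, map_add]
      refine add_mem (Submodule.mem_sup_right ?_)
        (Submodule.mem_sup_left (Submodule.mem_sup_left (diagO_mem_span _)))
      rw [← diagS_apply, triIncl_apply, map_sum]
      refine sum_mem fun j _ => ?_
      rw [map_smul]
      exact Submodule.smul_mem _ _ (T_L_mem_span j)
    · rw [su3Incl_snd]
      generalize x.2 i = t
      induction t using TensorProduct.induction_on with
      | zero => rw [map_zero, map_zero]; exact zero_mem _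
      | add a b ha hb => rw [map_add, map_add]; exact add_mem ha hb
      | tmul z y =>
        rw [eq_add z, inclT_tmul, map_add, map_smul, map_smul, incl_one, incl_L,
          TensorProduct.add_tmul, ← TensorProduct.smul_tmul', ← TensorProduct.smul_tmul', map_add,
          map_smul, map_smul]
        exact add_mem (Submodule.smul_mem _ _ (Submodule.mem_sup_left (Submodule.mem_sup_right
          (offL_one_mem_span i y)))) (Submodule.smul_mem _ _ (Submodule.mem_sup_right
          (offL_L_mem_span i y)))
  · have hz : ∀ i z q, (offL i (incl z ⊗ₜ[ℝ] unit (-1) q) : E8) ∈ su3Incl.range :=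
      fun i z q => ⟨offL i (z ⊗ₜ[ℝ] unit (-1) q), su3Incl_offL _ _⟩
    have h1 : ∀ i q, (offL i (lab q none) : E8) ∈ su3Incl.range := fun i q => by
      have := hz i one q
      rwa [incl_one] at this
    have hL : ∀ i q, (offL i (lab q (some .l)) : E8) ∈ su3Incl.range := fun i q => by
      have := hz i L q
      rwa [incl_L] at this
    have hB : ∀ i, (1 / 2 : ℝ) • ⁅(offL i (lab none none) : E8), offL i (lab none (some .l))⁆ ∈
        su3Incl.range := fun i =>
      su3Incl.range.smul_mem _ (su3Incl.range.lie_mem (h1 i none) (hL i none))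
    rintro _ ⟨(x | x) | x, rfl⟩
    · change gen28 x ∈ su3Incl.range
      rw [gen28_eq]
      refine ⟨diagL (0, Oct.triGen (-1) x), (su3Incl_diagL _).trans ?_⟩
      rw [map_zero, diagO_apply]
    · rcases x with q | q | q
      exacts [h1 0 q, h1 1 q, h1 2 q]
    · rcases x with q | q | q | _ | _
      exacts [hL 0 q, hL 1 q, hL 2 q, hB 0, su3Incl.range.sub_mem (hB 1) (hB 2)]

lemma e6_eq : e6 = su3Incl.range := lieSpan_eq_of_span_eq range_su3Incl

lemma e6_eq_span : e6.toSubmodule = Submodule.span ℝ (Set.range gen78) := by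
  rw [e6_eq, range_su3Incl]

lemma finrank_e6 : Module.finrank ℝ e6 = 78 := by
  change Module.finrank ℝ e6.toSubmodule = 78
  rw [e6_eq_span, finrank_span_eq_card linearIndependent_gen78]
  simp only [Fintype.card_sum, card_diagIdx, show Fintype.card OffIdx = 24 from rfl,
    show Fintype.card BoostIdx = 26 from rfl]

/-- `𝔢₆` is `𝔰𝔲(3, ℂ' ⊗ 𝕆)`. -/
def su3Equiv : Su3 SplitC (Oct (-1)) ≃ₗ⁅ℝ⁆ e6 :=
  LieEquiv.ofBijective
    { toFun := fun x => ⟨su3Incl x, e6_eq ▸ ⟨x, rfl⟩⟩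
      map_add' := fun x y => Subtype.ext (map_add su3Incl x y)
      map_smul' := fun c x => Subtype.ext (map_smul su3Incl c x)
      map_lie' := fun {x y} => Subtype.ext (LieHom.map_lie su3Incl x y) }
    ⟨fun x y h => su3Incl_injective (congrArg Subtype.val h), fun ⟨y, hy⟩ => by
      rw [e6_eq] at hy
      obtain ⟨x, rfl⟩ := hy
      exact ⟨x, rfl⟩⟩

lemma coe_su3Equiv (x : Su3 SplitC (Oct (-1))) : (su3Equiv x : E8) = su3Incl x := rfl

end E8

/-! ### Triples that fix 1, derivations, and the centralizer of 𝔢₆. -/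

namespace CompAlg

variable {K : Type} [AddCommGroup K] [Module ℝ K] [CompAlg K]

lemma conj_eq (x : K) : conj x = (2 * re x) • one - x := by
  rw [← add_conj]; abel

lemma re_eq_ip (x : K) : re x = ip x one := by
  rw [ip_apply, conj_one, CompAlg.mul_one]

lemma Tri.re_app (φ : Tri K) (i : Fin 3) (h : φ.app i one = 0) (x : K) : re (φ.app i x) = 0 := by
  have := φ.skew i x one
  rwa [h, map_zero, add_zero, ← re_eq_ip] at this

lemma Tri.app_conj (φ : Tri K) (i : Fin 3) (h : φ.app i one = 0) (x : K) :
    φ.app i (conj x) = -φ.app i x ∧ conj (φ.app i x) = -φ.app i x := by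
  constructor
  · rw [conj_eq, map_sub, map_smul, h, smul_zero, zero_sub]
  · rw [conj_eq, φ.re_app i h, mul_zero, zero_smul, zero_sub]

/-- Skew maps that kill 1 anticommute with nothing but the sign in conjugation: they change sign
under it on either side. Putting x = 1 in the compatibility condition then identifies two
consecutive components. -/
lemma Tri.app_eq_app (φ : Tri K) (h : ∀ i, φ.app i one = 0) (i : Fin 3) : φ.app i = φ.app 0 := by
  have key : ∀ i, φ.app (i + 2) = φ.app (i + 1) := fun i => LinearMap.ext fun y => by
    have h1 := φ.app_tm i one y
    rw [h, tm_one_left, map_zero, LinearMap.zero_apply, zero_add, tm_one_left,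
      (φ.app_conj _ (h _) y).1, (φ.app_conj _ (h _) y).2] at h1
    exact neg_injective h1
  have h0 : φ.app 2 = φ.app 1 := key 0
  have h1 : φ.app 0 = φ.app 2 := key 1
  fin_cases i
  exacts [rfl, (h1.trans h0).symm, h1.symm]

lemma Tri.app_mul (φ : Tri K) (h : ∀ i, φ.app i one = 0) (x y : K) :
    φ.app 0 (mul x y) = mul (φ.app 0 x) y + mul x (φ.app 0 y) := by
  have h1 := φ.app_tm 0 x y
  rw [φ.app_eq_app h (0 + 2), φ.app_eq_app h (0 + 1), tm_apply, (φ.app_conj 0 (h 0) _).1,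
    ← (φ.app_conj 0 (h 0) _).2, tm_apply, tm_apply, ← map_add] at h1
  rw [← conj_conj (φ.app 0 (mul x y)), h1, conj_conj]

end CompAlg

namespace E8

open CompAlg Su3

lemma IsDer.map_one {d : Module.End ℝ (Oct 1)} (hd : IsDer d) : d one = 0 := by
  have := hd one one
  rwa [CompAlg.one_mul, CompAlg.mul_one, CompAlg.one_mul, left_eq_add] at this

lemma re_one : re (one : Oct 1) = 1 := rfl

/-- For the imaginary part y of x, the square of y is real, so (dy)y + y(dy) = 0. Polarizing the
quadratic identity, the same expression differs from 2 Re(dy) y by a real number; as y is imaginary,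
Re(dy) y = 0. -/
lemma IsDer.re_map {d : Module.End ℝ (Oct 1)} (hd : IsDer d) (x : Oct 1) : re (d x) = 0 := by
  obtain ⟨y, hy⟩ : ∃ y, y = x - re x • (one : Oct 1) := ⟨_, rfl⟩
  have hdy : d y = d x := by rw [hy, map_sub, map_smul, hd.map_one, smul_zero, sub_zero]
  have hre : re y = 0 := by rw [hy, map_sub, map_smul, re_one]; simp
  rw [← hdy]
  have hc : conj y = -y := by rw [conj_eq, hre]; simp
  have h1 := mul_mul_conj y one y
  have h2 := mul_mul_conj y one (d y)
  rw [CompAlg.one_mul, hc, map_neg] at h1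
  rw [CompAlg.one_mul, CompAlg.one_mul, hc, map_neg, conj_eq (d y), map_sub, map_smul,
    CompAlg.mul_one] at h2
  have h3 := congrArg d h1
  rw [map_add, map_neg, hd, map_smul, hd.map_one, smul_zero] at h3
  have h4 : mul (d y) y + mul y (d y) = 0 := by
    linear_combination (norm := module) (-(1 / 2) : ℝ) • h3
  generalize 2 * re ((2 * re (d y)) • y - mul y (d y)) = c at h2
  have h5 : (2 * re (d y)) • y = c • (one : Oct 1) := by
    linear_combination (norm := module) h2 + h4
  have h6 := congrArg re h5
  rw [map_smul, map_smul, hre, re_one, smul_zero, smul_eq_mul, _root_.mul_one] at h6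
  rw [← h6, zero_smul, smul_eq_zero] at h5
  rcases h5 with h5 | h5
  · linarith
  · rw [h5, map_zero, map_zero]

lemma IsDer.conj_map {d : Module.End ℝ (Oct 1)} (hd : IsDer d) (x : Oct 1) :
    d (conj x) = conj (d x) := by
  rw [conj_eq, conj_eq (d x), hd.re_map, map_sub, map_smul, hd.map_one]
  simp

/-- A derivation `d` as the element `(d, d, d)` of the triality algebra. -/
def IsDer.toTri {d : Module.End ℝ (Oct 1)} (hd : IsDer d) : Tri (Oct 1) :=
  ⟨fun _ => d, fun _ x y => by
    rw [ip_apply, ip_apply, ← hd.conj_map, ← map_add, ← hd, hd.re_map], fun _ x y => by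
    rw [tm_apply, tm_apply, tm_apply, hd.conj_map, hd, map_add]⟩

/-- The elements of the triality algebra that act on `𝕆'` through a derivation vanishing on `L`. -/
def FixesL (φ : Tri (Oct 1)) : Prop :=
  (∀ i, φ.app i one = 0) ∧ φ.app 0 (ImUnit.l.toOct 1) = 0

lemma FixesL.app_incl {φ : Tri (Oct 1)} (h : FixesL φ) (i : Fin 3) (z : SplitC) :
    φ.app i (SplitC.incl z) = 0 := by
  rw [SplitC.eq_add z, map_add, map_smul, map_smul, SplitC.incl_one, SplitC.incl_L,
    φ.app_eq_app h.1, map_add, map_smul, map_smul, h.1, h.2, smul_zero, smul_zero, add_zero]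

lemma FixesL.lie_T {φ : Tri (Oct 1)} (h : FixesL φ) (i : Fin 3) (z : SplitC) (x : Oct 1) :
    ⁅φ, T i (SplitC.incl z) x⁆ = T i (SplitC.incl z) (φ.app 0 x) := by
  rw [T_lie, h.app_incl, map_zero, LinearMap.zero_apply, zero_add, φ.app_eq_app h.1]

lemma tmT_oneT_self (t : Oct 1 ⊗[ℝ] Oct (-1)) :
    tmT (one ⊗ₜ[ℝ] one) (tmT (one ⊗ₜ[ℝ] one) t) = t := by
  induction t using TensorProduct.induction_on with
  | zero => simp
  | add a b ha hb => rw [map_add, map_add, ha, hb]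
  | tmul x y =>
    rw [tmT_tmul, tmT_tmul]
    simp only [tm_one_left, conj_conj]

lemma lie_offL_apply_self (i : Fin 3) (t : Oct 1 ⊗[ℝ] Oct (-1)) (x : E8) :
    ⁅offL i t, x⁆.2 i = -act i x.1 t := by
  fin_cases i <;> simp [lie_snd]

lemma lie_offL_apply_add_two (i : Fin 3) (t : Oct 1 ⊗[ℝ] Oct (-1)) (x : E8) :
    ⁅offL i t, x⁆.2 (i + 2) = -tmT t (x.2 (i + 1)) := by
  fin_cases i <;> simp [lie_snd]

lemma offL_incl_mem (i : Fin 3) (z : SplitC) (x : Oct (-1)) :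
    (offL i (SplitC.incl z ⊗ₜ[ℝ] x) : E8) ∈ e6 :=
  e6_eq ▸ ⟨offL i (z ⊗ₜ[ℝ] x), su3Incl_offL _ _⟩

/-- Bracketing x with an off-diagonal element of 𝔢₆, the entry of the same type shows that the
diagonal part of x kills ℂ' ⊗ 𝕆, and another entry is the product of an entry of x with the label.
Conversely, a triple that kills ℂ' commutes with the T_i(1, L) and kills all labels of 𝔢₆. -/
lemma mem_centralizer_iff (x : E8) :
    x ∈ lieCentralizer e6 ↔ ∃ φ, FixesL φ ∧ x = diagS φ := by
  constructor
  · intro h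
    have hoff : ∀ i z y, ⁅(offL i (SplitC.incl z ⊗ₜ[ℝ] y) : E8), x⁆ = 0 :=
      fun i z y => h _ (offL_incl_mem i z y)
    have hact : ∀ i z y, x.1.1.app i (SplitC.incl z) ⊗ₜ[ℝ] y +
        SplitC.incl z ⊗ₜ[ℝ] x.1.2.app i y = 0 := fun i z y => by
      rw [← act_tmul, ← neg_eq_zero, ← lie_offL_apply_self, hoff]
      rfl
    have hO : ∀ i y, x.1.2.app i y = 0 := fun i y => by
      have h1 := hact i one y
      have h2 := x.1.1.skew i one one
      rw [SplitC.incl_one] at h1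
      -- Pairing the first factor with 1 isolates the tri(𝕆) part, since skewness gives ⟨1, φ(1)⟩ =
      -- 0.
      have h3 := congrArg ((TensorProduct.lid ℝ (Oct (-1))).toLinearMap ∘ₗ
        LinearMap.rTensor (Oct (-1)) (ip (one : Oct 1))) h1
      simp only [map_add, LinearMap.comp_apply, LinearMap.rTensor_tmul, LinearEquiv.coe_coe,
        TensorProduct.lid_tmul, map_zero, ip_one_one, one_smul] at h3
      rw [ip_comm] at h2
      rw [show ip one ((x.1.1.app i) one) = 0 by linarith, zero_smul, zero_add] at h3
      exact h3
    have hS : ∀ i z, x.1.1.app i (SplitC.incl z) = 0 := fun i z => by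
      have h1 := hact i z one
      rw [hO, TensorProduct.tmul_zero, add_zero] at h1
      have h3 := congrArg ((TensorProduct.rid ℝ (Oct 1)).toLinearMap ∘ₗ
        LinearMap.lTensor (Oct 1) (ip (one : Oct (-1)))) h1
      simpa [ip_one_one] using h3
    refine ⟨x.1.1, ⟨fun i => SplitC.incl_one ▸ hS i one, SplitC.incl_L ▸ hS 0 SplitC.L⟩,
      ext' (Prod.ext rfl (Tri.ext hO)) fun i => ?_⟩
    -- Type i + 2 is bracketed so that the entry met is x.2 i, because i + 2 + 1 = i. The conjugated
    -- product with 1 is an involution, hence that entry is 0.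
    have h4 : tmT (one ⊗ₜ[ℝ] one) (x.2 (i + 2 + 1)) = 0 := by
      rw [← neg_eq_zero, ← lie_offL_apply_add_two, ← SplitC.incl_one, hoff]
      rfl
    rw [add_assoc, show (2 : Fin 3) + 1 = 0 from rfl, add_zero] at h4
    rw [← tmT_oneT_self (x.2 i), h4, map_zero]
    rfl
  · rintro ⟨φ, h, rfl⟩ a ha
    rw [e6_eq] at ha
    obtain ⟨y, rfl⟩ := ha
    change ⁅su3Incl y, diagS φ⁆ = 0
    rw [eq_diagL_add_sum y, map_add, map_sum, su3Incl_diagL, add_lie, sum_lie, diagS_apply,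
      lie_diagL_diagL]
    have h1 : ⁅((SplitC.triIncl y.1.1, y.1.2) : Tri (Oct 1) × Tri (Oct (-1))),
        ((φ, 0) : Tri (Oct 1) × Tri (Oct (-1)))⁆ = 0 := by
      refine Prod.ext ?_ (lie_zero y.1.2)
      change ⁅SplitC.triIncl y.1.1, φ⁆ = 0
      rw [← lie_skew, SplitC.triIncl_apply, lie_sum, Finset.sum_eq_zero, neg_zero]
      intro i _
      rw [lie_smul, ← SplitC.incl_one, h.lie_T, h.2, map_zero, smul_zero]
    have h2 : ∀ (i : Fin 3) (t : SplitC ⊗[ℝ] Oct (-1)), act i (φ, 0) (inclT t) = 0 := fun i t => by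
      induction t using TensorProduct.induction_on with
      | zero => simp
      | add a b ha hb => rw [map_add, map_add, ha, hb, add_zero]
      | tmul z o => rw [inclT_tmul, act_tmul, h.app_incl]; simp
    rw [h1, map_zero, zero_add]
    refine Finset.sum_eq_zero fun i _ => ?_
    rw [su3Incl_offL, lie_offL_diagL, h2, map_zero, neg_zero]

lemma centralizer_isDer (x : E8) (hx : x ∈ lieCentralizer e6) :
    ∃ d, IsDer d ∧ d (ImUnit.l.toOct 1) = 0 ∧ IsDerElem x d := by
  obtain ⟨φ, h, rfl⟩ := (mem_centralizer_iff x).1 hx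
  exact ⟨φ.app 0, φ.app_mul h.1, h.2, rfl, rfl, φ.app_eq_app h.1⟩

lemma isDer_centralizer (d : Module.End ℝ (Oct 1)) (hd : IsDer d)
    (hL : d (ImUnit.l.toOct 1) = 0) : ∃ x ∈ lieCentralizer e6, IsDerElem x d :=
  ⟨diagS hd.toTri, (mem_centralizer_iff _).2 ⟨hd.toTri, ⟨fun _ => hd.map_one, hL⟩, rfl⟩,
    rfl, rfl, fun _ => rfl⟩

/-- The null elements `½ (N + s NL)` of `𝕆'`. -/
def nu (n : Fin 3) (s : ℤˣ) : Oct 1 :=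
  (1 / 2 : ℝ) • ((base n).1.toOct 1 + ((s : ℤ) : ℝ) • (base n).2.toOct 1)

lemma units_sq (s : ℤˣ) : ((s : ℤ) : ℝ) * ((s : ℤ) : ℝ) = 1 := by
  rcases Int.units_eq_one_or s with rfl | rfl <;> norm_num

/-- The null elements are eigenvectors of left and of right multiplication by L, with opposite
eigenvalues -s and s. -/
lemma L_mul_nu (n : Fin 3) (s : ℤˣ) :
    mul (ImUnit.l.toOct 1) (nu n s) = -((s : ℤ) : ℝ) • nu n s := by
  rcases Int.units_eq_one_or s with rfl | rfl <;> fin_cases n <;> rw [Oct.ext_coord_iff] <;>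
    simp [nu, base]

lemma nu_mul_L (n : Fin 3) (s : ℤˣ) :
    mul (nu n s) (ImUnit.l.toOct 1) = ((s : ℤ) : ℝ) • nu n s := by
  rcases Int.units_eq_one_or s with rfl | rfl <;> fin_cases n <;> rw [Oct.ext_coord_iff] <;>
    simp [nu, base]

lemma conj_nu (n : Fin 3) (s : ℤˣ) : conj (nu n s) = -nu n s := by
  rw [nu, map_smul, map_add, map_smul, SplitC.conj_toOct, SplitC.conj_toOct]
  module

/-- The null elements of sign s span the imaginary part of this eigenspace. Those of sign -s form
the dual basis up to ⟨ν, ν'⟩ = ½, whence the factor 2. -/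
lemma eq_sum_nu (s : ℤˣ) (y : Oct 1) (hre : re y = 0)
    (hL : mul (ImUnit.l.toOct 1) y = -((s : ℤ) : ℝ) • y) :
    y = ∑ m, (2 * ip (nu m (-s)) y) • nu m s := by
  rw [Oct.ext_coord_iff] at hL
  obtain ⟨⟨h0, h1, h2, h3⟩, h4, h5, h6, h7⟩ := hL
  rw [Oct.re_eq] at hre
  rcases Int.units_eq_one_or s with rfl | rfl <;> simp at h0 h1 h2 h3 h4 h5 h6 h7 <;>
    rw [Oct.ext_coord_iff] <;> simp [Fin.sum_univ_three, nu, base, Oct.ip_coord] <;>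
    refine ⟨⟨?_, ?_, ?_, ?_⟩, ?_, ?_, ?_, ?_⟩ <;> linarith

/-- A derivation that kills L commutes with left multiplication by L and so preserves its
eigenspaces. -/
lemma FixesL.app_nu {φ : Tri (Oct 1)} (h : FixesL φ) (n : Fin 3) (s : ℤˣ) :
    φ.app 0 (nu n s) = ∑ m, (2 * ip (nu m (-s)) (φ.app 0 (nu n s))) • nu m s := by
  refine eq_sum_nu s _ (φ.re_app 0 (h.1 0) _) ?_
  have := φ.app_mul h.1 (ImUnit.l.toOct 1) (nu n s)
  rw [L_mul_nu, h.2, map_zero, LinearMap.zero_apply, zero_add, map_smul] at this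
  exact this.symm

/-- The matrix of the action on the span of the elements `½ (N + NL)`. -/
def nuMatrix : E8 →ₗ[ℝ] Matrix (Fin 3) (Fin 3) ℝ where
  toFun x := Matrix.of fun m n => 2 * ip (nu m (-1)) (x.1.1.app 0 (nu n 1))
  map_add' x y := by
    ext m n
    simp [Tri.app_add, mul_add]
  map_smul' c x := by
    ext m n
    simp [Tri.app_smul, mul_left_comm]

lemma nuMatrix_apply (x : E8) (m n : Fin 3) :
    nuMatrix x m n = 2 * ip (nu m (-1)) (x.1.1.app 0 (nu n 1)) := rfl

lemma nuMatrix_diagS {φ : Tri (Oct 1)} (h : FixesL φ) (n : Fin 3) :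
    φ.app 0 (nu n 1) = ∑ m, nuMatrix (diagS φ) m n • nu m 1 := h.app_nu n 1

lemma nuMatrix_lie {φ ψ : Tri (Oct 1)} (h : FixesL φ) (h' : FixesL ψ) :
    nuMatrix ⁅diagS φ, diagS ψ⁆ = nuMatrix (diagS φ) * nuMatrix (diagS ψ) -
      nuMatrix (diagS ψ) * nuMatrix (diagS φ) := by
  ext m n
  rw [diagS_apply, diagS_apply, lie_diagL_diagL, ← diagS_apply, ← diagS_apply, Matrix.sub_apply,
    Matrix.mul_apply, Matrix.mul_apply, nuMatrix_apply]
  change 2 * ip (nu m (-1)) (⁅φ, ψ⁆.app 0 (nu n 1)) = _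
  rw [Tri.app_lie, nuMatrix_diagS h n, nuMatrix_diagS h' n, map_sum, map_sum, map_sub, map_sum,
    map_sum, mul_sub, Finset.mul_sum, Finset.mul_sum]
  simp only [map_smul, smul_eq_mul]
  congr 1 <;> refine Finset.sum_congr rfl fun k _ => ?_
  · rw [nuMatrix_apply (diagS φ) m k]
    change _ = 2 * ip (nu m (-1)) (φ.app 0 (nu k 1)) * _
    ring
  · rw [nuMatrix_apply (diagS ψ) m k]
    change _ = 2 * ip (nu m (-1)) (ψ.app 0 (nu k 1)) * _
    ring

lemma nu_mul_nu (n : Fin 3) : mul (nu n 1) (nu (n + 1) 1) = nu (n + 2) (-1) := by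
  fin_cases n <;> rw [Oct.ext_coord_iff] <;> simp [nu, base] <;> norm_num

lemma re_nu_neg_mul (m n : Fin 3) :
    re (mul (nu m (-1)) (nu n 1)) = if n = m then -(1 / 2) else 0 := by
  fin_cases m <;> fin_cases n <;> simp [nu, base] <;> norm_num

/-- Replacing one argument in Re((ν₀ν₁)ν₂) by ν_m leaves a nonzero value only when ν_m is the
argument replaced. This is the volume form property that produces the trace. -/
lemma re_nu_mul (m : Fin 3) :
    re (mul (mul (nu m 1) (nu 1 1)) (nu 2 1)) = (if m = 0 then -(1 / 2) else 0) ∧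
    re (mul (mul (nu 0 1) (nu m 1)) (nu 2 1)) = (if m = 1 then -(1 / 2) else 0) ∧
    re (mul (mul (nu 0 1) (nu 1 1)) (nu m 1)) = (if m = 2 then -(1 / 2) else 0) := by
  have h0 : mul (nu 0 1) (nu 1 1) = nu 2 (-1) := nu_mul_nu 0
  have h1 : mul (nu 1 1) (nu 2 1) = nu 0 (-1) := nu_mul_nu 1
  have h2 : mul (nu 2 1) (nu 0 1) = nu 1 (-1) := nu_mul_nu 2
  refine ⟨?_, ?_, ?_⟩
  · rw [re_mul_assoc, h1, re_mul_comm, re_nu_neg_mul]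
  · rw [re_mul_comm, ← re_mul_assoc, h2, re_nu_neg_mul]
  · rw [h0, re_nu_neg_mul]

/-- A derivation has no real part in its image, so it annihilates Re((xy)z). Applied to the three
null elements, the Leibniz rule gives -½ times the trace. -/
lemma trace_nuMatrix {φ : Tri (Oct 1)} (h : FixesL φ) : (nuMatrix (diagS φ)).trace = 0 := by
  have h1 := φ.re_app 0 (h.1 0) (mul (mul (nu 0 1) (nu 1 1)) (nu 2 1))
  rw [φ.app_mul h.1, φ.app_mul h.1, nuMatrix_diagS h 0, nuMatrix_diagS h 1,
    nuMatrix_diagS h 2] at h1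
  simp only [map_add, map_sum, map_smul, LinearMap.add_apply, LinearMap.sum_apply,
    LinearMap.smul_apply, re_nu_mul, smul_eq_mul, mul_ite, mul_zero, Finset.sum_ite_eq',
    Finset.mem_univ, if_true] at h1
  rw [Matrix.trace_fin_three]
  linarith

/-- The derivation kills the null elements of sign 1, and by skewness also those of sign -1, which
are dual to them. Together with 1 and L these span 𝕆'. -/
lemma nuMatrix_injective {φ : Tri (Oct 1)} (h : FixesL φ) (h0 : nuMatrix (diagS φ) = 0) :
    φ = 0 := by
  have hp : ∀ n, φ.app 0 (nu n 1) = 0 := fun n => by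
    rw [nuMatrix_diagS h n, h0]
    simp
  have hm : ∀ n, φ.app 0 (nu n (-1)) = 0 := fun n => by
    rw [h.app_nu n (-1)]
    refine Finset.sum_eq_zero fun m _ => ?_
    have := φ.skew 0 (nu m 1) (nu n (-1))
    rw [hp, map_zero, LinearMap.zero_apply, zero_add] at this
    rw [neg_neg, this, mul_zero, zero_smul]
  have hb : ∀ n, φ.app 0 ((base n).1.toOct 1) = 0 ∧ φ.app 0 ((base n).2.toOct 1) = 0 := fun n => by
    have e1 : (base n).1.toOct 1 = nu n 1 + nu n (-1) := by simp [nu]; module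
    have e2 : (base n).2.toOct 1 = nu n 1 - nu n (-1) := by simp [nu]; module
    rw [e1, e2, map_add, map_sub, hp, hm]
    simp
  refine Oct.Tri.eq_zero_of_app_zero φ fun x => ?_
  rw [← Oct.sum_coord x, map_sum]
  refine Finset.sum_eq_zero fun p _ => ?_
  rw [map_smul]
  suffices φ.app 0 (unit 1 p) = 0 by rw [this, smul_zero]
  rcases p with _ | p
  · exact h.1 0
  · cases p
    exacts [(hb 0).1, (hb 1).1, (hb 2).1, (hb 2).2, (hb 1).2, (hb 0).2, h.2]

/-- The centralizer acts on the span of the three elements `½ (N + NL)` by traceless matrices. -/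
def centralizerHom : lieCentralizer e6 →ₗ⁅ℝ⁆ LieAlgebra.SpecialLinear.sl (Fin 3) ℝ where
  toFun x := ⟨nuMatrix x, by
    obtain ⟨φ, h, hx⟩ := (mem_centralizer_iff _).1 x.2
    rw [hx]
    exact trace_nuMatrix h⟩
  map_add' x y := Subtype.ext (map_add nuMatrix (x : E8) y)
  map_smul' c x := Subtype.ext (map_smul nuMatrix c (x : E8))
  map_lie' {x y} := Subtype.ext (by
    obtain ⟨φ, h, hx⟩ := (mem_centralizer_iff _).1 x.2
    obtain ⟨ψ, h', hy⟩ := (mem_centralizer_iff _).1 y.2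
    rw [LieAlgebra.SpecialLinear.sl_bracket]
    change nuMatrix ⁅(x : E8), (y : E8)⁆ = nuMatrix (x : E8) * nuMatrix (y : E8) -
      nuMatrix (y : E8) * nuMatrix (x : E8)
    rw [hx, hy, nuMatrix_lie h h'])

lemma centralizerHom_injective : Function.Injective centralizerHom := by
  rw [injective_iff_map_eq_zero]
  intro x hx
  obtain ⟨φ, h, hx'⟩ := (mem_centralizer_iff _).1 x.2
  have h1 : nuMatrix (x : E8) = 0 := congrArg Subtype.val hx
  rw [hx'] at h1
  refine Subtype.ext ?_
  rw [hx', nuMatrix_injective h h1, map_zero]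
  rfl

lemma finrank_sl3 : Module.finrank ℝ (LieAlgebra.SpecialLinear.sl (Fin 3) ℝ) = 8 := by
  change Module.finrank ℝ (LinearMap.ker (Matrix.traceLinearMap (Fin 3) ℝ ℝ)) = 8
  have h := LinearMap.finrank_range_add_finrank_ker (Matrix.traceLinearMap (Fin 3) ℝ ℝ)
  have hs : LinearMap.range (Matrix.traceLinearMap (Fin 3) ℝ ℝ) = ⊤ :=
    LinearMap.range_eq_top.2 fun c => ⟨Matrix.single 0 0 c, by simp⟩
  rw [hs, finrank_top, Module.finrank_self, Module.finrank_matrix] at h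
  simp at h
  omega

lemma fixesL_of {φ : Tri (Oct 1)} (h0 : φ.app 0 one = 0) (h1 : φ.app 1 one = 0)
    (hL : φ.app 0 (ImUnit.l.toOct 1) = 0) : FixesL φ := by
  refine ⟨fun i => ?_, hL⟩
  have h2 := φ.app_tm 0 one one
  rw [h0, zero_add, zero_add, h1, tm_one_left, conj_one, map_zero, map_zero, LinearMap.zero_apply,
    add_zero] at h2
  fin_cases i
  exacts [h0, h1, h2]

/-- In index 1 the element D_{u,v} sends 1 to half the commutator of u and v, which is uv when uv is
imaginary. -/
lemma halfT_app (p : ImUnit × ImUnit) :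
    (Oct.halfT 1 p).app 0 one = 0 ∧
      (Oct.halfT 1 p).app 1 one = (1 / 2 : ℝ) • (mul (p.1.toOct 1) (p.2.toOct 1) -
        mul (p.2.toOct 1) (p.1.toOct 1)) := by
  rw [Oct.halfT, Tri.app_smul, Tri.app_smul, T_apply, T_apply, sub_self, sub_zero,
    LinearMap.smul_apply, LinearMap.smul_apply, tEnd_zero, tEnd_one, ip_comm, ip_one_toOct,
    ip_comm, ip_one_toOct, tm_one_right, tm_one_right, tm_apply, tm_apply, SplitC.conj_toOct,
    SplitC.conj_toOct]
  refine ⟨by simp, ?_⟩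
  simp only [map_neg, LinearMap.neg_apply, CompAlg.conj_mul, SplitC.conj_toOct, neg_neg]
  module

lemma halfT_app_L (p : ImUnit × ImUnit) : (Oct.halfT 1 p).app 0 (ImUnit.l.toOct 1) =
    (2 * ip (p.1.toOct 1) (ImUnit.l.toOct 1)) • p.2.toOct 1 -
      (2 * ip (p.2.toOct 1) (ImUnit.l.toOct 1)) • p.1.toOct 1 := by
  rw [Oct.halfT, Tri.app_smul, T_apply, sub_self, LinearMap.smul_apply, tEnd_zero]
  module

lemma mul_a_b (p : ImUnit) : mul (p.a.1.toOct 1) (p.a.2.toOct 1) = p.toOct 1 ∧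
    mul (p.b.1.toOct 1) (p.b.2.toOct 1) = p.orient 1 • p.toOct 1 := by
  constructor <;> cases p <;> rw [Oct.ext_coord_iff] <;> simp [ImUnit.a, ImUnit.b, ImUnit.orient]

lemma mul_c_l : mul (ImUnit.l.c.1.toOct 1) (ImUnit.l.c.2.toOct 1) = ImUnit.l.toOct 1 := by
  apply Oct.ext_coord <;> simp [ImUnit.c]

lemma mul_toOct_swap (p q : ImUnit) :
    mul (q.toOct 1) (p.toOct 1) = conj (mul (p.toOct 1) (q.toOct 1)) := by
  rw [CompAlg.conj_mul, SplitC.conj_toOct, SplitC.conj_toOct, map_neg, map_neg,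
    LinearMap.neg_apply, neg_neg]

lemma ip_toOct_l {p : ImUnit} (hp : p ≠ .l) : ip (p.toOct 1) (ImUnit.l.toOct 1) = 0 := by
  simp [Oct.ip_coord, hp]

lemma halfT_app_L_eq_zero {p : ImUnit × ImUnit} (h₁ : p.1 ≠ .l) (h₂ : p.2 ≠ .l) :
    (Oct.halfT 1 p).app 0 (ImUnit.l.toOct 1) = 0 := by
  rw [halfT_app_L, ip_toOct_l h₁, ip_toOct_l h₂]
  simp

lemma halfT_app_one_of_mul {p : ImUnit × ImUnit} {x : Oct 1} (hx : conj x = -x)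
    (h : mul (p.1.toOct 1) (p.2.toOct 1) = x) : (Oct.halfT 1 p).app 1 one = x := by
  rw [(halfT_app p).2, mul_toOct_swap p.1, h, hx]
  module

lemma orient_mul_self (p : ImUnit) : p.orient 1 * p.orient 1 = 1 := by
  cases p <;> simp [ImUnit.orient]

lemma ne_l (p : ImUnit) : p.a.1 ≠ .l ∧ p.a.2 ≠ .l ∧ p.b.1 ≠ .l ∧ p.b.2 ≠ .l := by
  cases p <;> decide

/-- The oriented pairs a and b have the same product, so their difference kills 1; neither contains
L, so both terms kill L in index 0. -/
lemma fixesL_triGen_A (p : ImUnit) : FixesL (Oct.triGen 1 (.A p)) := by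
  obtain ⟨h1, h2, h3, h4⟩ := ne_l p
  have hp := SplitC.conj_toOct 1 p
  rw [Oct.triGen]
  refine fixesL_of ?_ ?_ ?_ <;>
  simp only [Tri.app_neg, Tri.app_sub, Tri.app_smul, LinearMap.neg_apply, LinearMap.sub_apply,
    LinearMap.smul_apply]
  · simp [(halfT_app _).1]
  · rw [halfT_app_one_of_mul hp (mul_a_b p).1, halfT_app_one_of_mul (by rw [map_smul, hp, smul_neg])
      (mul_a_b p).2, smul_smul, orient_mul_self, one_smul, sub_self, neg_zero]
  · rw [halfT_app_L_eq_zero h1 h2, halfT_app_L_eq_zero h3 h4]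
    simp

/-- Here 1 is killed because 1 + 1 - 2 = 0. The argument for L needs c to avoid L as well, which
happens only for the label L itself. -/
lemma fixesL_triGen_G : FixesL (Oct.triGen 1 (.G .l)) := by
  have hp := SplitC.conj_toOct 1 .l
  rw [Oct.triGen]
  refine fixesL_of ?_ ?_ ?_ <;>
  simp only [Tri.app_neg, Tri.app_sub, Tri.app_add, Tri.app_smul, LinearMap.neg_apply,
    LinearMap.sub_apply, LinearMap.add_apply, LinearMap.smul_apply]
  · simp [(halfT_app _).1]
  · rw [halfT_app_one_of_mul hp (mul_a_b .l).1, halfT_app_one_of_mul hp mul_c_l,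
      halfT_app_one_of_mul (by rw [map_smul, hp, smul_neg]) (mul_a_b .l).2]
    simp only [ImUnit.orient]
    module
  · rw [halfT_app_L_eq_zero, halfT_app_L_eq_zero, halfT_app_L_eq_zero]
    · simp
    all_goals decide

lemma gen8_mem (x : Option ImUnit) : gen8 x ∈ lieCentralizer e6 := by
  refine (mem_centralizer_iff _).2 ?_
  rcases x with _ | p
  · exact ⟨_, fixesL_triGen_G, G'_eq _⟩
  · exact ⟨_, fixesL_triGen_A p, A'_eq _⟩

lemma linearIndependent_gen8 : LinearIndependent ℝ gen8 :=
  linearIndependent_gen248.comp (fun x => .inr (.inl x))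
    (Sum.inr_injective.comp Sum.inl_injective)

lemma finrank_span_gen8 : Module.finrank ℝ (Submodule.span ℝ (Set.range gen8)) = 8 := by
  rw [finrank_span_eq_card linearIndependent_gen8]
  rfl

lemma span_gen8_le : Submodule.span ℝ (Set.range gen8) ≤ (lieCentralizer e6).toSubmodule :=
  Submodule.span_le.2 fun _ ⟨x, hx⟩ => hx ▸ gen8_mem x

/-- Eight independent elements lie in a space that injects into the 8-dimensional 𝔰𝔩(3, ℝ). -/
lemma centralizer_eq_span :
    (lieCentralizer e6).toSubmodule = Submodule.span ℝ (Set.range gen8) := by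
  refine (Submodule.eq_of_le_of_finrank_le span_gen8_le ?_).symm
  rw [finrank_span_gen8, ← finrank_sl3]
  exact LinearMap.finrank_le_finrank_of_injective (f := (centralizerHom : _ →ₗ[ℝ] _))
    centralizerHom_injective

lemma finrank_centralizer : Module.finrank ℝ (lieCentralizer e6) = 8 := by
  change Module.finrank ℝ (lieCentralizer e6).toSubmodule = 8
  rw [centralizer_eq_span, finrank_span_gen8]

/-- The centralizer of `𝔢₆` is `𝔰𝔩(3, ℝ)`. -/
def centralizerEquiv : lieCentralizer e6 ≃ₗ⁅ℝ⁆ LieAlgebra.SpecialLinear.sl (Fin 3) ℝ :=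
  LieEquiv.ofBijective centralizerHom ⟨centralizerHom_injective,
    (LinearMap.injective_iff_surjective_of_finrank_eq_finrank
      (f := (centralizerHom : _ →ₗ[ℝ] _)) (finrank_centralizer.trans finrank_sl3.symm)).1
      centralizerHom_injective⟩

end E8

/-! ### The splitting ℂ' = ℝ × ℝ. -/

namespace SplitC

open CompAlg

/-- The two characters `a + bL ↦ a + sb` of `ℂ'`. -/
def chi (s : ℤˣ) : SplitC →ₗ[ℝ] ℝ where
  toFun z := z.1 + ((s : ℤ) : ℝ) * z.2
  map_add' x y := by simp; ring
  map_smul' c x := by simp; ring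

lemma chi_apply (s : ℤˣ) (z : SplitC) : chi s z = z.1 + ((s : ℤ) : ℝ) * z.2 := rfl

/-- The idempotents `½ (1 + sL)` of `ℂ'`. -/
def idem (s : ℤˣ) : SplitC := mk (1 / 2) (((s : ℤ) : ℝ) / 2)

@[simp] lemma coe_neg_unit (s : ℤˣ) : (((-s : ℤˣ) : ℤ) : ℝ) = -((s : ℤ) : ℝ) := by simp

lemma chi_idem (s : ℤˣ) : chi s (idem s) = 1 := by
  have := E8.units_sq s
  rw [chi_apply]
  simp only [idem, mk_fst, mk_snd]
  linarith

lemma chi_neg_idem (s : ℤˣ) : chi (-s) (idem s) = 0 := by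
  have := E8.units_sq s
  rw [chi_apply, coe_neg_unit]
  simp only [idem, mk_fst, mk_snd]
  linarith

lemma eq_chi_smul_idem (s : ℤˣ) (z : SplitC) : z = chi s z • idem s + chi (-s) z • idem (-s) := by
  have := E8.units_sq s
  ext1
  · simp [chi_apply, idem]; ring
  · simp [chi_apply, idem]; linear_combination (-z.2) * this

lemma chi_mul (s : ℤˣ) (x y : SplitC) : chi s (mul x y) = chi s x * chi s y := by
  have := E8.units_sq s
  simp [chi_apply]
  linear_combination (-(x.2 * y.2)) * this

lemma chi_conj (s : ℤˣ) (x : SplitC) : chi s (conj x) = chi (-s) x := by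
  simp [chi_apply]

lemma chi_tm (s : ℤˣ) (x y : SplitC) : chi s (tm x y) = chi (-s) x * chi (-s) y := by
  rw [tm_apply, chi_conj, chi_mul]

lemma four_ip (s : ℤˣ) (x y : SplitC) :
    4 * ip x y = 2 * (chi s x * chi (-s) y + chi (-s) x * chi s y) := by
  have := E8.units_sq s
  simp [chi_apply, ip_eq]
  linear_combination (4 * (x.2 * y.2)) * this

lemma tm_idem_neg (s : ℤˣ) : tm (idem (-s)) (idem (-s)) = idem s := by
  have := E8.units_sq s
  ext1
  · simp [idem]; linarith
  · simp [idem]; ring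

/-- The maps `χ ⊗ 1 : ℂ' ⊗ 𝕆 → 𝕆`. -/
def ev (s : ℤˣ) : SplitC ⊗[ℝ] Oct (-1) →ₗ[ℝ] Oct (-1) :=
  (TensorProduct.lid ℝ (Oct (-1))).toLinearMap ∘ₗ LinearMap.rTensor (Oct (-1)) (chi s)

@[simp] lemma ev_tmul (s : ℤˣ) (z : SplitC) (x : Oct (-1)) : ev s (z ⊗ₜ[ℝ] x) = chi s z • x := rfl

end SplitC

/-! ### The elements with a null label, parametrized by the Albert algebra. -/

namespace E8

open CompAlg Su3 SplitC

variable (n : Fin 3) (s : ℤˣ)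

/-- Left multiplication sees one character and right multiplication (`nu_mul_incl`) the other. This
asymmetry makes the modules of sign 1 and -1 differ. -/
lemma incl_mul_nu (z : SplitC) : mul (incl z) (nu n s) = chi (-s) z • nu n s := by
  rw [eq_add z, map_add, map_smul, map_smul, incl_one, incl_L, map_add, map_smul, map_smul,
    LinearMap.add_apply, LinearMap.smul_apply, LinearMap.smul_apply, CompAlg.one_mul, L_mul_nu]
  simp [chi_apply]
  module

lemma nu_mul_incl (z : SplitC) : mul (nu n s) (incl z) = chi s z • nu n s := by
  rw [eq_add z, map_add, map_smul, map_smul, incl_one, incl_L, map_add, map_smul, map_smul,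
    CompAlg.mul_one, nu_mul_L]
  simp [chi_apply]
  module

lemma tm_incl_nu (z : SplitC) : tm (incl z) (nu n s) = -(chi (-s) z • nu n s) := by
  rw [tm_apply, incl_mul_nu, map_smul, conj_nu, smul_neg]

lemma tm_nu_incl (z : SplitC) : tm (nu n s) (incl z) = -(chi s z • nu n s) := by
  rw [tm_apply, nu_mul_incl, map_smul, conj_nu, smul_neg]

lemma ip_incl_nu (z : SplitC) : ip (incl z) (nu n s) = 0 := by
  have h : re (nu n s) = 0 := by
    have := re_conj (nu n s)
    rw [conj_nu, map_neg] at this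
    linarith
  rw [ip_apply, conj_nu, map_neg, incl_mul_nu, map_neg, map_smul, h, smul_zero, neg_zero]

/-- The element `T_i(½ (1 + sL), ν)`, where `ν = ½ (N + sNL)`. -/
def tauNull (i : Fin 3) : Tri (Oct 1) := T i (incl (idem s)) (nu n s)

/-- The cyclic identity for the idempotent taken twice and ν: one term vanishes because a character
kills the idempotent. So the six T_i(e, ν), for both idempotents e, reduce to three. -/
lemma T_idem_neg (i : Fin 3) : T i (incl (idem (-s))) (nu n s) = -tauNull n s (i + 2) := by
  have h := T_cyclic i (incl (idem (-s))) (incl (idem (-s))) (nu n s)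
  have h1 := chi_neg_idem (-s)
  rw [neg_neg] at h1
  rw [← incl_tm, tm_idem_neg, tm_incl_nu, tm_nu_incl, chi_idem, h1, zero_smul, neg_zero, map_zero,
    LinearMap.zero_apply, add_zero, one_smul, map_neg, LinearMap.neg_apply, ← T_swap] at h
  rw [tauNull]
  exact eq_neg_of_add_eq_zero_right h

lemma T_incl_nu (i : Fin 3) (z : SplitC) : T i (incl z) (nu n s) =
    chi s z • tauNull n s i - chi (-s) z • tauNull n s (i + 2) := by
  conv_lhs => rw [eq_chi_smul_idem s z]
  rw [map_add, map_smul, map_smul, map_add, map_smul, map_smul, LinearMap.add_apply,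
    LinearMap.smul_apply, LinearMap.smul_apply, T_idem_neg, ← tauNull]
  module

lemma tauNull_app_self (i : Fin 3) (z : SplitC) :
    (tauNull n s i).app i (incl z) = (2 * chi (-s) z) • nu n s := by
  rw [tauNull, T_apply, sub_self, tEnd_zero, ip_incl, four_ip s, chi_idem, chi_neg_idem, ip_comm,
    ip_incl_nu]
  module

lemma tauNull_app_add_one (i : Fin 3) (z : SplitC) :
    (tauNull n s i).app (i + 1) (incl z) = -((2 * chi s z) • nu n s) := by
  rw [tauNull, T_apply, add_sub_cancel_left, tEnd_one, ← incl_tm, tm_incl_nu, tm_nu_incl, map_neg,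
    map_smul, LinearMap.neg_apply, LinearMap.smul_apply, tm_nu_incl, chi_tm, neg_neg, chi_idem]
  module

lemma tauNull_app_add_two (i : Fin 3) (z : SplitC) :
    (tauNull n s i).app (i + 2) (incl z) = 0 := by
  rw [tauNull, T_apply, add_sub_cancel_left, tEnd_two, ← incl_tm, tm_nu_incl, tm_incl_nu, map_neg,
    map_smul, tm_incl_nu, chi_tm, chi_neg_idem]
  module

/-- The eigenvalues of a diagonal element. -/
def lam (s : ℤˣ) (i : Fin 3) : Tri SplitC →ₗ[ℝ] ℝ :=
  (((s : ℤ) : ℝ) / 3) • (coef (i + 2) - coef i)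

lemma lam_apply (i : Fin 3) (φ : Tri SplitC) :
    lam s i φ = ((s : ℤ) : ℝ) / 3 * (coef (i + 2) φ - coef i φ) := rfl

lemma T_L_app_nu (i j : Fin 3) : (T i one (ImUnit.l.toOct 1)).app j (nu n s) =
    ((if j = i then 0 else if j = i + 1 then 2 else -2) * ((s : ℤ) : ℝ)) • nu n s := by
  have hs := units_sq s
  have h0 : ((T i one (ImUnit.l.toOct 1)).app i) (nu n s) = 0 := by
    rw [T_apply, sub_self, ← incl_one, ← incl_L, tEnd_zero, ip_incl_nu, ip_incl_nu]
    simp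
  have h1 : ((T i one (ImUnit.l.toOct 1)).app (i + 1)) (nu n s) = (2 * ((s : ℤ) : ℝ)) • nu n s := by
    rw [T_apply, add_sub_cancel_left, ← incl_one, ← incl_L, tEnd_one, tm_incl_nu, tm_incl_nu,
      map_neg, map_neg, map_smul, map_smul, LinearMap.neg_apply, LinearMap.neg_apply,
      LinearMap.smul_apply, LinearMap.smul_apply, tm_nu_incl, tm_nu_incl]
    simp [chi_apply]
    module
  have h2 : ((T i one (ImUnit.l.toOct 1)).app (i + 2)) (nu n s) = (-2 * ((s : ℤ) : ℝ)) • nu n s := by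
    rw [T_apply, add_sub_cancel_left, ← incl_one, ← incl_L, tEnd_two, tm_nu_incl, tm_nu_incl,
      map_neg, map_neg, map_smul, map_smul, tm_incl_nu, tm_incl_nu]
    simp [chi_apply]
    module
  have hj : ∀ i j : Fin 3, j = i ∨ j = i + 1 ∨ j = i + 2 := by decide
  rcases hj i j with rfl | rfl | rfl
  · rw [h0]; simp
  · rw [h1]; simp
  · rw [h2]
    have e : i + 2 ≠ i + 1 := by simp
    simp [e]

lemma triIncl_app_nu (φ : Tri SplitC) (i : Fin 3) :
    (triIncl φ).app i (nu n s) = (lam s i φ + lam s (i + 1) φ) • nu n s := by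
  rw [triIncl_apply, ← Tri.appL_apply, map_sum, LinearMap.sum_apply]
  simp only [map_smul, LinearMap.smul_apply, Tri.appL_apply, T_L_app_nu, smul_smul,
    ← Finset.sum_smul, lam_apply]
  congr 1
  rw [Fin.sum_univ_three]
  fin_cases i <;> simp [Fin.ext_iff] <;> ring

lemma app_idem (φ : Tri SplitC) (i : Fin 3) :
    φ.app i (idem s) = (((s : ℤ) : ℝ) * coef i φ) • idem s := by
  have := units_sq s
  rw [show idem s = (1 / 2 : ℝ) • one + (((s : ℤ) : ℝ) / 2) • L by ext1 <;> simp [idem], map_add,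
    map_smul, map_smul, app_one, app_L]
  linear_combination (norm := module) (-(coef i φ / 2) * this) • L

/-- Both arguments of T_i are eigenvectors of φ, and the eigenvalues add up to 2λ_{i+1} because the
coefficients of φ sum to 0. So this element plays the part of the diagonal entry i + 1. -/
lemma lie_triIncl_tauNull (φ : Tri SplitC) (i : Fin 3) :
    ⁅triIncl φ, tauNull n s i⁆ = (2 * lam s (i + 1) φ) • tauNull n s i := by
  rw [tauNull, T_lie, app_triIncl, app_idem, map_smul, map_smul, LinearMap.smul_apply,
    triIncl_app_nu, map_smul, ← add_smul]
  congr 1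
  have := coef_sum φ
  rw [lam_apply, lam_apply]
  fin_cases i <;> simp <;> linear_combination ((s : ℤ) : ℝ) / 3 * this

/-- A basis of the diagonal elements with label `Q`. -/
def tau (Q : ImUnit) : Fin 3 → Tri (Oct 1) :=
  ![Oct.triGen 1 (.D Q) - (1 / 3 : ℝ) • (Oct.triGen 1 (.S Q) + Oct.triGen 1 (.G Q)),
    (1 / 3 : ℝ) • ((2 : ℝ) • Oct.triGen 1 (.S Q) - Oct.triGen 1 (.G Q)),
    -Oct.triGen 1 (.D Q) - (1 / 3 : ℝ) • (Oct.triGen 1 (.S Q) + Oct.triGen 1 (.G Q))]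

lemma triGen_G_add_S (Q : ImUnit) : Oct.triGen 1 (.S Q) + Oct.triGen 1 (.G Q) =
    (3 * Q.orient 1) • Oct.halfT 1 Q.c := by
  rw [Oct.triGen_S (by norm_num), Oct.triGen]
  module

/-- For a label other than L the pair c contains L. Hence S + G, which is three times the c-term, is
expressed through T₀(L, ·). -/
lemma half_T_c (n : Fin 3) : (base n).1.orient 1 • Oct.halfT 1 (base n).1.c =
      -((1 / 2 : ℝ) • T 0 (ImUnit.l.toOct 1) ((base n).2.toOct 1)) ∧
    (base n).2.orient 1 • Oct.halfT 1 (base n).2.c =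
      -((1 / 2 : ℝ) • T 0 (ImUnit.l.toOct 1) ((base n).1.toOct 1)) := by
  fin_cases n <;> refine ⟨?_, ?_⟩ <;>
    simp [base, ImUnit.orient, ImUnit.c, Oct.halfT] <;> rw [T_swap] <;> simp

/-- D and S come from T_i(1, ν), and S + G comes from T₀(L, ν). Expanding these by the characters of
1 and L gives a linear system, and the coefficients in `tau` are its solution. -/
lemma tau_null (j : Fin 3) : (1 / 2 : ℝ) • (tau (base n).1 j + ((s : ℤ) : ℝ) • tau (base n).2 j) =
    tauNull n s j := by
  have hs := units_sq s
  have h1 : ∀ i, T i one (nu n s) = tauNull n s i - tauNull n s (i + 2) := fun i => by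
    rw [← incl_one, T_incl_nu]
    simp [chi_apply]
  have hL : T 0 (ImUnit.l.toOct 1) (nu n s) = ((s : ℤ) : ℝ) • (tauNull n s 0 + tauNull n s 2) := by
    rw [← incl_L, T_incl_nu]
    simp [chi_apply]
  have hL' := congrArg (fun x => ((s : ℤ) : ℝ) • x) hL
  have h0 := h1 0
  have h2 := h1 2
  have h1 := h1 1
  rw [show (0 : Fin 3) + 2 = 2 from rfl] at h0
  rw [show (1 : Fin 3) + 2 = 0 from rfl] at h1
  rw [show (2 : Fin 3) + 2 = 1 from rfl] at h2
  rw [smul_smul, hs, one_smul] at hL'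
  rw [nu, map_smul, map_add, map_smul] at h0 h1 h2 hL'
  obtain ⟨c1, c2⟩ := half_T_c n
  have g1 := triGen_G_add_S (base n).1
  have g2 := triGen_G_add_S (base n).2
  rw [mul_smul, c1] at g1
  rw [mul_smul, c2] at g2
  have dS : ∀ Q, Oct.triGen 1 (.S Q) =
    (1 / 2 : ℝ) • T 1 one (Q.toOct 1) - (1 / 2 : ℝ) • T 2 one (Q.toOct 1) := fun Q => rfl
  have dD : ∀ Q, Oct.triGen 1 (.D Q) = (1 / 2 : ℝ) • T 0 one (Q.toOct 1) := fun Q => rfl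
  have gD : (1 / 2 : ℝ) • (Oct.triGen 1 (.D (base n).1) +
      ((s : ℤ) : ℝ) • Oct.triGen 1 (.D (base n).2)) =
      (1 / 2 : ℝ) • (tauNull n s 0 - tauNull n s 2) := by
    rw [dD, dD]
    linear_combination (norm := module) (1 / 2 : ℝ) • h0
  have gS : (1 / 2 : ℝ) • (Oct.triGen 1 (.S (base n).1) +
      ((s : ℤ) : ℝ) • Oct.triGen 1 (.S (base n).2)) =
      tauNull n s 1 - (1 / 2 : ℝ) • (tauNull n s 0 + tauNull n s 2) := by
    rw [dS, dS]
    linear_combination (norm := module) (1 / 2 : ℝ) • h1 - (1 / 2 : ℝ) • h2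
  have gG : (1 / 2 : ℝ) • ((Oct.triGen 1 (.S (base n).1) + Oct.triGen 1 (.G (base n).1)) +
      ((s : ℤ) : ℝ) • (Oct.triGen 1 (.S (base n).2) + Oct.triGen 1 (.G (base n).2))) =
      (-(3 / 2) : ℝ) • (tauNull n s 0 + tauNull n s 2) := by
    rw [g1, g2]
    linear_combination (norm := module) (-(3 / 2) : ℝ) • hL' +
      (3 / 4 * hs) • T 0 (ImUnit.l.toOct 1) ((base n).2.toOct 1)
  fin_cases j <;> simp only [tau, Fin.zero_eta, Fin.mk_one, Fin.reduceFinMk, Matrix.cons_val]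
  · linear_combination (norm := module) gD - (1 / 3 : ℝ) • gG
  · linear_combination (norm := module) gS - (1 / 3 : ℝ) • gG
  · linear_combination (norm := module) -gD - (1 / 3 : ℝ) • gG

/-- The elements with label `Q`, parametrized by the Albert algebra. -/
def theta (Q : ImUnit) : Albert →ₗ[ℝ] E8 :=
  diagS ∘ₗ (∑ j : Fin 3, ((-(1 / 2) : ℝ) • LinearMap.proj (R := ℝ) (φ := fun _ : Fin 3 => ℝ) (j + 1) ∘ₗ
      LinearMap.fst ℝ (Fin 3 → ℝ) (Fin 3 → Oct (-1))).smulRight (tau Q j)) +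
    ∑ i : Fin 3, offL i ∘ₗ TensorProduct.mk ℝ (Oct 1) (Oct (-1)) (Q.toOct 1) ∘ₗ
      LinearMap.proj (R := ℝ) (φ := fun _ : Fin 3 => Oct (-1)) i ∘ₗ
      LinearMap.snd ℝ (Fin 3 → ℝ) (Fin 3 → Oct (-1))

lemma theta_apply (Q : ImUnit) (P : Albert) : theta Q P =
    diagS (∑ j, (-(1 / 2) * P.1 (j + 1)) • tau Q j) +
      ∑ i, offL i (Q.toOct 1 ⊗ₜ[ℝ] P.2 i) := by
  simp [theta, LinearMap.sum_apply]

/-- The elements with label `½ (N + sNL)`, parametrized by the Albert algebra. -/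
def thetaNull (n : Fin 3) (s : ℤˣ) : Albert →ₗ[ℝ] E8 :=
  (1 / 2 : ℝ) • (theta (base n).1 + ((s : ℤ) : ℝ) • theta (base n).2)

lemma thetaNull_apply (P : Albert) : thetaNull n s P =
    diagS (∑ j, (-(1 / 2) * P.1 (j + 1)) • tauNull n s j) +
      ∑ i, offL i (nu n s ⊗ₜ[ℝ] P.2 i) := by
  have h1 : ∑ j, (-(1 / 2) * P.1 (j + 1)) • tauNull n s j = (1 / 2 : ℝ) •
      ((∑ j, (-(1 / 2) * P.1 (j + 1)) • tau (base n).1 j) +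
        ((s : ℤ) : ℝ) • ∑ j, (-(1 / 2) * P.1 (j + 1)) • tau (base n).2 j) := by
    simp only [← tau_null, Fin.sum_univ_three]
    module
  have h2 : ∀ i, (offL i (nu n s ⊗ₜ[ℝ] P.2 i) : E8) = (1 / 2 : ℝ) •
      (offL i ((base n).1.toOct 1 ⊗ₜ[ℝ] P.2 i) +
        ((s : ℤ) : ℝ) • offL i ((base n).2.toOct 1 ⊗ₜ[ℝ] P.2 i)) := fun i => by
    rw [nu, ← TensorProduct.smul_tmul', TensorProduct.add_tmul, ← TensorProduct.smul_tmul',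
      map_smul, map_add, map_smul]
  rw [h1, thetaNull, LinearMap.smul_apply, LinearMap.add_apply, LinearMap.smul_apply, theta_apply,
    theta_apply, map_smul, map_add, map_smul]
  simp only [h2, Fin.sum_univ_three]
  module

lemma thetaNull_fst (P : Albert) : (thetaNull n s P).1 =
    (∑ j, (-(1 / 2) * P.1 (j + 1)) • tauNull n s j, 0) := by
  rw [thetaNull_apply]
  simp [Fin.sum_univ_three, diagS_apply]

lemma thetaNull_snd (P : Albert) (i : Fin 3) : (thetaNull n s P).2 i = nu n s ⊗ₜ[ℝ] P.2 i := by
  rw [thetaNull_apply]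
  fin_cases i <;> simp [Fin.sum_univ_three, diagS_apply]

/-- The element of the Albert algebra with the given name. -/
def alb : Idx27 → Albert
  | .X q => (0, Pi.single 0 (unit (-1) q))
  | .Y q => (0, Pi.single 1 (unit (-1) q))
  | .Z q => (0, Pi.single 2 (unit (-1) q))
  | .D => (![1, -1, 0], 0)
  | .S => (![1, 1, -2], 0)
  | .G => (![2, 2, 2], 0)

lemma theta_alb (Q : ImUnit) (x : Idx27) : theta Q (alb x) = gen27 Q x := by
  rcases x with q | q | q | _ | _ | _ <;> rw [theta_apply]
  · simp [alb, Fin.sum_univ_three, gen27, X, lab]; rfl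
  · simp [alb, Fin.sum_univ_three, gen27, Y, lab]; rfl
  · simp [alb, Fin.sum_univ_three, gen27, Z, lab]; rfl
  · refine Eq.trans ?_ (D_sLab Q).symm
    have e : ∑ j, (-(1 / 2) * (![1, -1, 0] : Fin 3 → ℝ) (j + 1)) • tau Q j =
        Oct.triGen 1 (.D Q) := by
      simp [Fin.sum_univ_three, tau]
      module
    rw [alb, e]
    simp
  · refine Eq.trans ?_ (S_sLab Q).symm
    have e : ∑ j, (-(1 / 2) * (![1, 1, -2] : Fin 3 → ℝ) (j + 1)) • tau Q j =
        Oct.triGen 1 (.S Q) := by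
      simp [Fin.sum_univ_three, tau]
      module
    rw [alb, e]
    simp
  · refine Eq.trans ?_ (G'_eq Q).symm
    have e : ∑ j, (-(1 / 2) * (![2, 2, 2] : Fin 3 → ℝ) (j + 1)) • tau Q j =
        Oct.triGen 1 (.G Q) := by
      simp [Fin.sum_univ_three, tau]
      module
    rw [alb, e]
    simp

lemma thetaNull_alb (x : Idx27) : thetaNull n s (alb x) = gen27Null n s x := by
  simp [thetaNull, gen27Null, theta_alb]

lemma span_alb : Submodule.span ℝ (Set.range alb) = ⊤ := by
  refine eq_top_iff.2 fun P _ => ?_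
  have ho : ∀ i x, ((0, Pi.single i x) : Albert) ∈ Submodule.span ℝ (Set.range alb) := fun i x => by
    refine Oct.span_tmul_unit (-1) (LinearMap.inr ℝ (Fin 3 → ℝ) _ ∘ₗ
      LinearMap.single ℝ (fun _ : Fin 3 => Oct (-1)) i) _
      (fun q => ?_) x
    fin_cases i
    exacts [Submodule.subset_span ⟨.X q, rfl⟩, Submodule.subset_span ⟨.Y q, rfl⟩,
      Submodule.subset_span ⟨.Z q, rfl⟩]
  have hd : ∀ x, alb x ∈ Submodule.span ℝ (Set.range alb) := fun x =>
    Submodule.subset_span ⟨x, rfl⟩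
  have e : P = ((P.1 0 - P.1 1) / 2) • alb .D + (((P.1 0 + P.1 1) / 2 - P.1 2) / 3) • alb .S +
      ((P.1 0 + P.1 1 + P.1 2) / 6) • alb .G + ∑ i, ((0, Pi.single i (P.2 i)) : Albert) := by
    refine Prod.ext (funext fun i => ?_) (funext fun i => ?_)
    · fin_cases i <;> simp [alb, Fin.sum_univ_three] <;> ring
    · fin_cases i <;> simp [alb, Fin.sum_univ_three]
  rw [e]
  exact add_mem (add_mem (add_mem (Submodule.smul_mem _ _ (hd _)) (Submodule.smul_mem _ _ (hd _)))
    (Submodule.smul_mem _ _ (hd _))) (sum_mem fun i _ => ho i _)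

lemma range_theta (Q : ImUnit) : LinearMap.range (theta Q) = W Q := by
  rw [LinearMap.range_eq_map, ← span_alb, Submodule.map_span, ← Set.range_comp, W]
  exact congrArg _ (congrArg _ (funext (theta_alb Q)))

lemma range_thetaNull : LinearMap.range (thetaNull n s) = H n s := by
  rw [LinearMap.range_eq_map, ← span_alb, Submodule.map_span, ← Set.range_comp, H]
  exact congrArg _ (congrArg _ (funext (thetaNull_alb n s)))

end E8

/-! ### The action of 𝔢₆, 𝔣₄ and the centralizer on the 27-dimensional pieces. -/

namespace E8

open CompAlg Su3 SplitC

/-- The action of `𝔰𝔲(3, ℂ' ⊗ 𝕆)` on the Albert algebra (`s = 1`) and on its dual (`s = -1`). -/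
def rep (s : ℤˣ) : Su3 SplitC (Oct (-1)) →ₗ[ℝ] Albert →ₗ[ℝ] Albert :=
  LinearMap.mk₂ ℝ (fun a P =>
    (fun i => 2 * ip (ev (-s) (a.2 i)) (P.2 i) - 2 * ip (ev s (a.2 (i + 2))) (P.2 (i + 2)) +
        2 * lam s i a.1.1 * P.1 i,
      fun i => P.1 (i + 1) • ev (-s) (a.2 i) - P.1 i • ev s (a.2 i) +
        tm (ev (-s) (a.2 (i + 1))) (P.2 (i + 2)) - tm (P.2 (i + 1)) (ev s (a.2 (i + 2))) +
        a.1.2.app i (P.2 i) + (lam s i a.1.1 + lam s (i + 1) a.1.1) • P.2 i))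
    (fun a b P => by
      refine Prod.ext (funext fun i => ?_) (funext fun i => ?_)
      · simp
        ring
      · simp [Tri.app_add]
        module)
    (fun c a P => by
      refine Prod.ext (funext fun i => ?_) (funext fun i => ?_)
      · simp
        ring
      · simp [Tri.app_smul]
        module)
    (fun a P Q => by
      refine Prod.ext (funext fun i => ?_) (funext fun i => ?_)
      · simp
        ring
      · simp
        module)
    (fun c a P => by
      refine Prod.ext (funext fun i => ?_) (funext fun i => ?_)
      · simp
        ring
      · simp
        module)

variable (n : Fin 3) (s : ℤˣ)

lemma rep_fst (a : Su3 SplitC (Oct (-1))) (P : Albert) (i : Fin 3) : (rep s a P).1 i =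
    2 * ip (ev (-s) (a.2 i)) (P.2 i) - 2 * ip (ev s (a.2 (i + 2))) (P.2 (i + 2)) +
      2 * lam s i a.1.1 * P.1 i := rfl

lemma rep_snd (a : Su3 SplitC (Oct (-1))) (P : Albert) (i : Fin 3) : (rep s a P).2 i =
    P.1 (i + 1) • ev (-s) (a.2 i) - P.1 i • ev s (a.2 i) +
      tm (ev (-s) (a.2 (i + 1))) (P.2 (i + 2)) - tm (P.2 (i + 1)) (ev s (a.2 (i + 2))) +
      a.1.2.app i (P.2 i) + (lam s i a.1.1 + lam s (i + 1) a.1.1) • P.2 i := rfl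

lemma kap_inclT_nu (i : Fin 3) (t : SplitC ⊗[ℝ] Oct (-1)) (w : Oct (-1)) :
    kap i (inclT t) (nu n s ⊗ₜ[ℝ] w) =
      (ip (ev s t) w • tauNull n s i - ip (ev (-s) t) w • tauNull n s (i + 2), 0) := by
  induction t using TensorProduct.induction_on with
  | zero => simp; rfl
  | add a b ha hb =>
    simp only [map_add, LinearMap.add_apply, ha, hb, Prod.mk_add_mk, add_zero]
    congr 1
    module
  | tmul z x =>
    rw [inclT_tmul, kap_tmul, T_incl_nu, ip_incl_nu, zero_smul, ev_tmul, ev_tmul, map_smul,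
      map_smul, LinearMap.smul_apply, LinearMap.smul_apply]
    congr 1
    module

lemma tmT_inclT_nu (t : SplitC ⊗[ℝ] Oct (-1)) (w : Oct (-1)) :
    tmT (inclT t) (nu n s ⊗ₜ[ℝ] w) = -(nu n s ⊗ₜ[ℝ] tm (ev (-s) t) w) := by
  induction t using TensorProduct.induction_on with
  | zero => simp
  | add a b ha hb =>
    simp only [map_add, LinearMap.add_apply, ha, hb, TensorProduct.tmul_add]
    abel
  | tmul z x =>
    rw [inclT_tmul, tmT_tmul, tm_incl_nu, ev_tmul, map_smul, LinearMap.smul_apply,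
      TensorProduct.neg_tmul, TensorProduct.smul_tmul]

lemma tmT_nu_inclT (t : SplitC ⊗[ℝ] Oct (-1)) (w : Oct (-1)) :
    tmT (nu n s ⊗ₜ[ℝ] w) (inclT t) = -(nu n s ⊗ₜ[ℝ] tm w (ev s t)) := by
  induction t using TensorProduct.induction_on with
  | zero => simp
  | add a b ha hb =>
    simp only [map_add, ha, hb, TensorProduct.tmul_add]
    abel
  | tmul z x =>
    rw [inclT_tmul, tmT_tmul, tm_nu_incl, ev_tmul, map_smul,
      TensorProduct.neg_tmul, TensorProduct.smul_tmul]

lemma act_tauNull (i : Fin 3) (c : Fin 3 → ℝ) (t : SplitC ⊗[ℝ] Oct (-1)) :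
    act i (∑ j, c j • tauNull n s j, 0) (inclT t) =
      nu n s ⊗ₜ[ℝ] ((2 * c i) • ev (-s) t - (2 * c (i + 2)) • ev s t) := by
  induction t using TensorProduct.induction_on with
  | zero => simp
  | add a b ha hb =>
    simp only [map_add, ha, hb, ← TensorProduct.tmul_add]
    congr 1
    module
  | tmul z x =>
    have h0 := tauNull_app_self n s i z
    have h1 := tauNull_app_add_one n s (i + 2) z
    have h2 := tauNull_app_add_two n s (i + 1) z
    rw [add_assoc, show (2 : Fin 3) + 1 = 0 from rfl, add_zero] at h1
    rw [add_assoc, show (1 : Fin 3) + 2 = 0 from rfl, add_zero] at h2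
    have h : (∑ j, c j • tauNull n s j).app i (incl z) =
        ((2 * c i) * chi (-s) z - (2 * c (i + 2)) * chi s z) • nu n s := by
      rw [← Equiv.sum_comp (Equiv.addLeft i), ← Tri.appL_apply, map_sum, LinearMap.sum_apply,
        Fin.sum_univ_three]
      simp only [Equiv.coe_addLeft, add_zero, map_smul, LinearMap.smul_apply, Tri.appL_apply, h0,
        h1, h2]
      module
    rw [inclT_tmul, act_tmul, h, ev_tmul, ev_tmul, Tri.app_zero, LinearMap.zero_apply,
      TensorProduct.tmul_zero, add_zero, TensorProduct.smul_tmul]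
    congr 1
    module

lemma act_triIncl_nu (i : Fin 3) (h : Tri SplitC × Tri (Oct (-1))) (w : Oct (-1)) :
    act i (triIncl h.1, h.2) (nu n s ⊗ₜ[ℝ] w) =
      nu n s ⊗ₜ[ℝ] (h.2.app i w + (lam s i h.1 + lam s (i + 1) h.1) • w) := by
  rw [act_tmul, triIncl_app_nu, TensorProduct.smul_tmul, ← TensorProduct.tmul_add, add_comm]

/-- An entry of a meets ν only through its two octonions `ev s` and `ev (-s)`, so the bracket keeps
the label ν and is given by formulas without N. They have the shape of P ↦ MP + PM† for a traceless
M; for instance diag(λ) acts on an off-diagonal entry by the sum of two of the λ. -/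
lemma lie_thetaNull (a : Su3 SplitC (Oct (-1))) (P : Albert) :
    ⁅su3Incl a, thetaNull n s P⁆ = thetaNull n s (rep s a P) := by
  refine ext' ?_ fun i => ?_
  · rw [lie_fst, thetaNull_fst, thetaNull_fst, su3Incl_fst]
    simp only [su3Incl_snd, thetaNull_snd, kap_inclT_nu]
    refine Prod.ext ?_ ?_
    · rw [Prod.fst_add, Prod.fst_sum]
      change ⁅triIncl a.1.1, ∑ j, (-(1 / 2) * P.1 (j + 1)) • tauNull n s j⁆ + _ = _
      rw [lie_sum]
      simp only [lie_smul, lie_triIncl_tauNull, rep_fst, Fin.sum_univ_three]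
      simp
      module
    · rw [Prod.snd_add, Prod.snd_sum]
      simp
  · rw [lie_snd, thetaNull_snd, thetaNull_snd, thetaNull_snd, thetaNull_snd, thetaNull_fst,
      su3Incl_fst, su3Incl_snd, su3Incl_snd, su3Incl_snd, act_triIncl_nu, act_tauNull,
      tmT_inclT_nu, tmT_nu_inclT, rep_snd, sub_neg_eq_add, ← sub_eq_add_neg,
      ← TensorProduct.tmul_sub, ← TensorProduct.tmul_add, ← TensorProduct.tmul_sub]
    congr 1
    rw [show i + 2 + 1 = i by rw [add_assoc, show (2 : Fin 3) + 1 = 0 from rfl, add_zero]]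
    module

lemma ip_nu_nu : ip (nu n (-s)) (nu n s) = 1 / 2 := by
  rcases Int.units_eq_one_or s with rfl | rfl <;> fin_cases n <;>
    simp [nu, base, Oct.ip_coord] <;> norm_num

lemma nu_tmul_injective : Function.Injective fun w : Oct (-1) => nu n s ⊗ₜ[ℝ] w := by
  intro x y h
  have h1 := congrArg ((TensorProduct.lid ℝ (Oct (-1))).toLinearMap ∘ₗ
    LinearMap.rTensor (Oct (-1)) (ip (nu n (-s)))) h
  simpa [ip_nu_nu] using h1

lemma thetaNull_injective : Function.Injective (thetaNull n s) := by
  rw [injective_iff_map_eq_zero]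
  intro P hP
  have h2 : ∀ i, P.2 i = 0 := fun i => nu_tmul_injective n s (by
    change nu n s ⊗ₜ[ℝ] P.2 i = nu n s ⊗ₜ[ℝ] 0
    rw [← thetaNull_snd, hP, TensorProduct.tmul_zero]
    rfl)
  have h1 : ∀ i, P.1 i = 0 := fun i => by
    -- The test vector has `ev s` equal to 1 and `ev (-s)` equal to 0, which leaves the coefficient
    -- of index i + 2, that is, the diagonal entry P.1 i.
    have h3 := act_tauNull n s i (fun j => -(1 / 2) * P.1 (j + 1)) (idem s ⊗ₜ[ℝ] one)
    rw [← thetaNull_fst, hP, zero_fst', map_zero, LinearMap.zero_apply, ev_tmul, ev_tmul, chi_idem,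
      chi_neg_idem, ← TensorProduct.tmul_zero (Oct (-1)) (nu n s)] at h3
    have h4 := congrArg (ip one) (nu_tmul_injective n s h3)
    rw [add_assoc, show (2 : Fin 3) + 1 = 0 from rfl, add_zero] at h4
    simpa [ip_one_one] using h4.symm
  exact Prod.ext (funext h1) (funext h2)

lemma finrank_albert : Module.finrank ℝ Albert = 27 := by
  rw [Module.finrank_prod, Module.finrank_pi_fintype, Module.finrank_pi_fintype]
  simp [Oct.finrank_eq]

lemma finrank_H : Module.finrank ℝ (H n s) = 27 := by
  rw [← range_thetaNull, LinearMap.finrank_range_of_inj (thetaNull_injective n s), finrank_albert]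

lemma finrank_W (Q : ImUnit) (hQ : Q ≠ .l) : Module.finrank ℝ (W Q) = 27 := by
  rw [W, finrank_span_eq_card, card_idx27]
  exact linearIndependent_gen248.comp (fun x => Sum.inr (Sum.inr (⟨Q, hQ⟩, x)))
    fun x y h => by simpa using h

lemma theta_base_fst : theta (base n).1 = thetaNull n 1 + thetaNull n (-1) := by
  simp [thetaNull]
  module

lemma theta_base_snd : theta (base n).2 = thetaNull n 1 - thetaNull n (-1) := by
  simp [thetaNull]
  module

lemma H_sup_H : H n 1 ⊔ H n (-1) = W (base n).1 ⊔ W (base n).2 := by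
  rw [← range_thetaNull, ← range_thetaNull, ← range_theta, ← range_theta]
  apply le_antisymm
  · refine sup_le ?_ ?_ <;> rintro _ ⟨P, rfl⟩ <;> exact Submodule.smul_mem _ _ (add_mem
      (Submodule.mem_sup_left ⟨_, rfl⟩) (Submodule.mem_sup_right (Submodule.smul_mem _ _ ⟨_, rfl⟩)))
  · rw [theta_base_fst, theta_base_snd]
    refine sup_le ?_ ?_ <;> rintro _ ⟨P, rfl⟩
    · exact add_mem (Submodule.mem_sup_left ⟨_, rfl⟩) (Submodule.mem_sup_right ⟨_, rfl⟩)
    · exact sub_mem (Submodule.mem_sup_left ⟨_, rfl⟩) (Submodule.mem_sup_right ⟨_, rfl⟩)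

lemma lie_mem_H (a : E8) (ha : a ∈ e6) (x : E8) (hx : x ∈ H n s) : ⁅a, x⁆ ∈ H n s := by
  rw [e6_eq] at ha
  rw [← range_thetaNull] at hx ⊢
  obtain ⟨b, rfl⟩ := ha
  obtain ⟨P, rfl⟩ := hx
  exact ⟨_, (lie_thetaNull n s b P).symm⟩

lemma exists_base {Q : ImUnit} (hQ : Q ≠ .l) : ∃ n, Q = (base n).1 ∨ Q = (base n).2 := by
  cases Q
  exacts [⟨0, .inl rfl⟩, ⟨1, .inl rfl⟩, ⟨2, .inl rfl⟩, ⟨2, .inr rfl⟩, ⟨1, .inr rfl⟩,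
    ⟨0, .inr rfl⟩, (hQ rfl).elim]

/-- Elements of 𝔣₄ have entries in 1 ⊗ 𝕆, on which the two characters agree, and no tri(ℂ') part. So
both signs give the same action on 𝔸, and it passes to the labels N and NL, the sum and difference
of the null ones. -/
lemma lie_mem_W (Q : ImUnit) (hQ : Q ≠ .l) (a : E8) (ha : a ∈ f4) (x : E8) (hx : x ∈ W Q) :
    ⁅a, x⁆ ∈ W Q := by
  obtain ⟨h1, o, h2⟩ := (mem_f4_iff a).1 ha
  rw [← range_theta] at hx ⊢
  obtain ⟨P, rfl⟩ := hx
  let b : Su3 SplitC (Oct (-1)) := ((0, a.1.2), fun i => one ⊗ₜ[ℝ] o i)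
  have hb : a = su3Incl b := by
    refine ext' (Prod.ext (h1.trans (map_zero triIncl).symm) rfl) fun i => ?_
    rw [h2, su3Incl_snd, inclT_tmul, incl_one]
  have hs : rep (-1) b P = rep 1 b P := by
    have he : ∀ s i, ev s (b.2 i) = o i := fun s i => by
      rw [ev_tmul]
      simp [chi_apply]
    have hl : ∀ s i, lam s i b.1.1 = 0 := fun s i => map_zero _
    exact Prod.ext (funext fun i => by simp only [rep_fst, he, hl])
      (funext fun i => by simp only [rep_snd, he, hl])
  refine ⟨rep 1 b P, ?_⟩
  rw [hb]
  obtain ⟨n, rfl | rfl⟩ := exists_base hQ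
  · rw [theta_base_fst, LinearMap.add_apply, LinearMap.add_apply, lie_add, lie_thetaNull,
      lie_thetaNull, hs]
  · rw [theta_base_snd, LinearMap.sub_apply, LinearMap.sub_apply, lie_sub, lie_thetaNull,
      lie_thetaNull, hs]

/-- The derivation kills ℂ', hence the idempotent inside T_j(½(1 + sL), ν), and does not touch 𝕆. It
acts on the label ν alone, so the sum over N behaves like ℝ³ ⊗ 𝔸. -/
lemma FixesL.lie_thetaNull {φ : Tri (Oct 1)} (h : FixesL φ) (P : Albert) :
    ⁅diagS φ, thetaNull n s P⁆ =
      ∑ m, (2 * ip (nu m (-s)) (φ.app 0 (nu n s))) • thetaNull m s P := by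
  obtain ⟨c, hc⟩ : ∃ c : Fin 3 → ℝ, c = fun m => 2 * ip (nu m (-s)) (φ.app 0 (nu n s)) := ⟨_, rfl⟩
  have hn : φ.app 0 (nu n s) = ∑ m, c m • nu m s := hc ▸ h.app_nu n s
  rw [show ∑ m, (2 * ip (nu m (-s)) (φ.app 0 (nu n s))) • thetaNull m s P =
    ∑ m, c m • thetaNull m s P by rw [hc]]
  have h1 : ∀ j, ⁅φ, tauNull n s j⁆ = ∑ m, c m • tauNull m s j := fun j => by
    rw [tauNull, h.lie_T, hn, map_sum]
    simp only [map_smul]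
    rfl
  have h2 : ∀ i, φ.app i (nu n s) = ∑ m, c m • nu m s := fun i => by rw [φ.app_eq_app h.1, hn]
  refine ext' ?_ fun i => ?_
  · rw [lie_fst, thetaNull_fst, diagS_apply, Fin.sum_univ_three (f := fun m => c m • _)]
    simp only [diagL_fst, diagL_snd, Pi.zero_apply, map_zero, LinearMap.zero_apply, add_fst',
      smul_fst', thetaNull_fst, Finset.sum_const_zero, add_zero]
    refine Prod.ext ?_ ?_
    · change ⁅φ, ∑ j, (-(1 / 2) * P.1 (j + 1)) • tauNull n s j⁆ = _
      rw [lie_sum]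
      simp only [lie_smul, h1, Fin.sum_univ_three, Prod.fst_add, Prod.smul_fst]
      module
    · change ⁅(0 : Tri (Oct (-1))), (0 : Tri (Oct (-1)))⁆ = _
      simp
  · rw [lie_snd, thetaNull_snd, diagS_apply, Fin.sum_univ_three]
    simp only [diagL_fst, diagL_snd, Pi.zero_apply, map_zero, LinearMap.zero_apply, add_snd',
      smul_snd', thetaNull_snd, Pi.add_apply, Pi.smul_apply, act_tmul, Tri.app_zero,
      TensorProduct.tmul_zero, h2, Fin.sum_univ_three, TensorProduct.add_tmul,
      TensorProduct.smul_tmul']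
    simp

lemma lie_mem_iSup_H (c : E8) (hc : c ∈ lieCentralizer e6) (x : E8) (hx : x ∈ ⨆ n, H n s) :
    ⁅c, x⁆ ∈ ⨆ n, H n s := by
  obtain ⟨φ, h, rfl⟩ := (mem_centralizer_iff c).1 hc
  induction hx using Submodule.iSup_induction' with
  | mem n x hx =>
    rw [← range_thetaNull] at hx
    obtain ⟨P, rfl⟩ := hx
    rw [h.lie_thetaNull]
    refine sum_mem fun m _ => Submodule.smul_mem _ _ (Submodule.mem_iSup_of_mem m ?_)
    rw [← range_thetaNull]
    exact ⟨P, rfl⟩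
  | zero => rw [lie_zero]; exact zero_mem _
  | add x y _ _ hx hy => rw [lie_add]; exact add_mem hx hy

end E8

/-! ### The cubic form and the pairing on the Albert algebra. -/

namespace CompAlg

variable {K : Type} [AddCommGroup K] [Module ℝ K] [CompAlg K]

lemma ip_tm_rotate (x y z : K) : ip x (tm y z) = ip (tm z x) y := by
  rw [← ip_tm, ip_comm, ip_tm]

lemma ip_tm_tm_right (x y z : K) : ip (tm x z) (tm y z) = ip x y * ip z z := by
  have h := congrArg (ip x) (tm_right z y z)
  rw [map_add, map_smul, smul_eq_mul] at h
  rw [ip_tm]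
  linarith

lemma ip_tm_tm_left (x y z : K) : ip (tm z x) (tm z y) = ip x y * ip z z := by
  have h := congrArg (ip · y) (tm_left z x z)
  simp only [map_add, map_smul, LinearMap.add_apply, LinearMap.smul_apply, smul_eq_mul] at h
  rw [← ip_tm]
  linarith

end CompAlg

namespace Albert

open CompAlg

lemma polar_eq (P Q R : Albert) : polar P Q R =
    ∑ i, (P.1 i * (Q.1 (i + 1) * R.1 (i + 2) + Q.1 (i + 2) * R.1 (i + 1))) -
    2 * ∑ i, (P.1 i * ip (Q.2 (i + 1)) (R.2 (i + 1)) + Q.1 i * ip (P.2 (i + 1)) (R.2 (i + 1)) +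
      R.1 i * ip (P.2 (i + 1)) (Q.2 (i + 1))) +
    2 * ∑ i, (ip (P.2 i) (tm (Q.2 (i + 1)) (R.2 (i + 2))) +
      ip (P.2 i) (tm (R.2 (i + 1)) (Q.2 (i + 2)))) := by
  have hre : ∀ x y z : Oct (-1), re (mul (mul x y) z) = ip x (tm y z) := fun x y z => by
    rw [ip_apply, tm_apply, conj_conj, re_mul_assoc]
  have c1 := ip_comm (P.2 0) (Q.2 0)
  have c2 := ip_comm (P.2 1) (Q.2 1)
  have c3 := ip_comm (P.2 2) (Q.2 2)
  have c4 := ip_comm (P.2 0) (R.2 0)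
  have c5 := ip_comm (P.2 1) (R.2 1)
  have c6 := ip_comm (P.2 2) (R.2 2)
  have c7 := ip_comm (R.2 0) (Q.2 0)
  have c8 := ip_comm (R.2 1) (Q.2 1)
  have c9 := ip_comm (R.2 2) (Q.2 2)
  have rot : ∀ x y z : Oct (-1), ip y (tm z x) = ip x (tm y z) := fun x y z => by
    rw [ip_tm_rotate, ip_tm]
  simp only [polar, det, hre, Prod.fst_add, Prod.snd_add, Pi.add_apply, map_add,
    LinearMap.add_apply, Fin.sum_univ_three, Fin.isValue, Fin.reduceAdd, zero_add]
  simp only [c1, c2, c3, c4, c5, c6, c7, c8, c9]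
  have r1 := rot (Q.2 0) (P.2 1) (R.2 2)
  have r2 := rot (R.2 0) (P.2 1) (Q.2 2)
  have r3 := rot (P.2 2) (Q.2 0) (R.2 1)
  have r4 := rot (P.2 2) (R.2 0) (Q.2 1)
  linarith


/-- Invariance of the cubic form is recovered from its diagonal by polarizing twice. -/
lemma mem_sl3O_of_diag (f : Module.End ℝ Albert) (h : ∀ P, polar (f P) P P = 0) : f ∈ sl3O := by
  -- Adding the identities at P + Q and P - Q isolates the part quadratic in Q.
  have h2 : ∀ P Q, polar (f P) Q Q + 2 * polar (f Q) P Q = 0 := fun P Q => by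
    have h1 := h (P + Q)
    have h1' := h (P - Q)
    simp only [map_add, map_sub, polar_add, polar_add₂, polar_add₃, polar_sub, polar_sub₂,
      polar_sub₃, h] at h1 h1'
    have e1 := polar_right (f P) P Q
    have e2 := polar_right (f Q) P Q
    linarith
  intro P Q R
  have h3 := h2 P (Q + R)
  simp only [map_add, polar_add, polar_add₂, polar_add₃] at h3
  have h4 := h2 P Q
  have h5 := h2 P R
  have e1 := polar_right (f P) Q R
  rw [polar_left P (f Q), polar_left P Q, polar_right Q P, polar_left Q, polar_right (f R) Q]
  linarith

/-- The diagonal matrix units. -/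
def diagUnit (j : Fin 3) : Albert := (Pi.single j 1, 0)

/-- The pairing of the Albert algebra with itself. -/
def pair : Albert →ₗ[ℝ] Albert →ₗ[ℝ] ℝ :=
  LinearMap.mk₂ ℝ (fun P Q => ∑ i, (P.1 i * Q.1 i + 2 * ip (P.2 i) (Q.2 i)))
    (fun P P' Q => by simp [Fin.sum_univ_three]; ring)
    (fun c P Q => by simp [Fin.sum_univ_three]; ring)
    (fun P Q Q' => by simp [Fin.sum_univ_three]; ring)
    (fun c P Q => by simp [Fin.sum_univ_three]; ring)

lemma pair_apply (P Q : Albert) : pair P Q = ∑ i, (P.1 i * Q.1 i + 2 * ip (P.2 i) (Q.2 i)) := rfl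

lemma pair_injective : Function.Injective pair := by
  rw [injective_iff_map_eq_zero]
  intro P hP
  have h1 : ∀ i, P.1 i = 0 := fun i => by
    have h := LinearMap.congr_fun hP (Pi.single i 1, 0)
    rw [pair_apply] at h
    simpa [Pi.single_apply] using h
  have h2 : ∀ i, P.2 i = 0 := fun i => Oct.eq_zero_of_ip (by norm_num) _ fun y => by
    have h := LinearMap.congr_fun hP (0, Pi.single i y)
    rw [pair_apply, Finset.sum_eq_single i (fun j _ hj => by simp [hj]) (by simp)] at h
    rw [ip_comm]
    simpa using h
  exact Prod.ext (funext h1) (funext h2)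

end Albert

/-! ### The homomorphism from 𝔰𝔲(3, ℂ' ⊗ 𝕆) to 𝔰𝔩(3, 𝕆). -/

namespace E8

open CompAlg Su3 SplitC Albert

lemma lam_neg (s : ℤˣ) (i : Fin 3) (φ : Tri SplitC) : lam (-s) i φ = -lam s i φ := by
  rw [lam_apply, lam_apply, coe_neg_unit]
  ring

lemma lam_sum (s : ℤˣ) (φ : Tri SplitC) : lam s 0 φ + lam s 1 φ + lam s 2 φ = 0 := by
  simp [lam_apply]
  ring

/-- Changing s exchanges the two octonions of each entry and negates λ. With the cyclic symmetry of
⟨xy, z⟩ for the conjugated product, this is minus the transpose. -/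
lemma pair_rep (s : ℤˣ) (a : Su3 SplitC (Oct (-1))) (P Q : Albert) :
    pair (rep s a P) Q + pair P (rep (-s) a Q) = 0 := by
  rw [pair_apply, pair_apply]
  simp only [rep_fst, rep_snd, lam_neg, neg_neg, Fin.sum_univ_three, Fin.isValue, Fin.reduceAdd,
    zero_add, map_add, map_sub, map_smul, LinearMap.add_apply, LinearMap.sub_apply,
    LinearMap.smul_apply, smul_eq_mul]
  generalize hu : (fun i => ev s (a.2 i)) = u
  generalize hb : (fun i => ev (-s) (a.2 i)) = b
  have hu : ∀ i, ev s (a.2 i) = u i := fun i => congrFun hu i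
  have hb : ∀ i, ev (-s) (a.2 i) = b i := fun i => congrFun hb i
  simp only [hu, hb]
  have k0 := a.1.2.skew 0 (P.2 0) (Q.2 0)
  have k1 := a.1.2.skew 1 (P.2 1) (Q.2 1)
  have k2 := a.1.2.skew 2 (P.2 2) (Q.2 2)
  simp only [ip_comm (P.2 _) (u _), ip_comm (P.2 _) (b _), ip_tm_rotate (P.2 _) (Q.2 _) (b _)]
  rw [ip_tm_rotate (P.2 0), ip_tm_rotate (P.2 1), ip_tm_rotate (P.2 2)]
  have c : ∀ x y z : Oct (-1), ip (tm x y) z = ip (tm z x) y := fun x y z => by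
    rw [ip_tm, ip_tm_rotate]
  rw [c (P.2 1) (u 2), c (P.2 2) (u 0), c (P.2 0) (u 1)]
  linarith

/-- The three kinds of terms cancel separately: those in λ because the λ sum to 0, those in tri(𝕆)
by skewness and triality, and those in the off-diagonal entries by the composition law ⟨xz, yz⟩ =
⟨x, y⟩⟨z, z⟩. -/
lemma rep_mem (a : Su3 SplitC (Oct (-1))) : rep 1 a ∈ sl3O := by
  refine mem_sl3O_of_diag _ fun P => ?_
  rw [polar_eq]
  simp only [rep_fst, rep_snd, Fin.sum_univ_three, Fin.isValue, Fin.reduceAdd,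
    zero_add, map_add, map_sub, map_smul, LinearMap.add_apply, LinearMap.sub_apply,
    LinearMap.smul_apply, smul_eq_mul]
  generalize hu : (fun i => ev 1 (a.2 i)) = u
  generalize hb : (fun i => ev (-1) (a.2 i)) = b
  have hu : ∀ i, ev 1 (a.2 i) = u i := fun i => congrFun hu i
  have hb : ∀ i, ev (-1) (a.2 i) = b i := fun i => congrFun hb i
  simp only [hu, hb, ip_tm_tm_left, ip_tm_tm_right]
  have hl := lam_sum 1 a.1.1
  generalize lam 1 0 a.1.1 = l0 at *
  generalize lam 1 1 a.1.1 = l1 at *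
  have hl : lam 1 2 a.1.1 = -l0 - l1 := by linarith
  rw [hl]
  have k : ∀ i x, ip (a.1.2.app i x) x = 0 := fun i x => by
    have := a.1.2.skew i x x
    rw [ip_comm x] at this
    linarith
  have c : ∀ x y z : Oct (-1), ip (tm x y) z = ip y (tm z x) := fun x y z => by
    rw [ip_tm, ip_tm_rotate, ip_comm]
  have t := congrArg (ip · (P.2 2)) (a.1.2.app_tm 0 (P.2 0) (P.2 1))
  simp only [zero_add, map_add, LinearMap.add_apply] at t
  rw [ip_tm, c] at t
  have t' := a.1.2.skew 2 (tm (P.2 0) (P.2 1)) (P.2 2)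
  rw [ip_comm _ (a.1.2.app 2 (P.2 2))] at t'
  simp only [k, ip_tm (b _), c _ (u _)]
  have r : ∀ x y z : Oct (-1), ip x (tm y z) = ip y (tm z x) := fun x y z => by
    rw [ip_tm_rotate, ip_comm]
  rw [r (P.2 0), r (P.2 1)]
  linarith

/-- The action on the Albert algebra, as a homomorphism into `𝔢₆₍₋₂₆₎`. -/
def repHom : Su3 SplitC (Oct (-1)) →ₗ⁅ℝ⁆ sl3O where
  toFun a := ⟨rep 1 a, rep_mem a⟩
  map_add' a b := Subtype.ext (map_add (rep 1) a b)
  map_smul' c a := Subtype.ext (map_smul (rep 1) c a)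
  map_lie' {a b} := Subtype.ext (LinearMap.ext fun P => by
    -- The bracket relation is not computed: it is the Jacobi identity of 𝔢₈, transported through
    -- the faithful parametrization of one of the modules.
    apply thetaNull_injective 0 1
    change thetaNull 0 1 (rep 1 ⁅a, b⁆ P) =
      thetaNull 0 1 (rep 1 a (rep 1 b P) - rep 1 b (rep 1 a P))
    rw [map_sub, ← lie_thetaNull, ← lie_thetaNull, ← lie_thetaNull, ← lie_thetaNull,
      ← lie_thetaNull, LieHom.map_lie, lie_lie])

/-- Through the idempotents, an entry in ℂ' ⊗ 𝕆 is the same as two independent octonions. -/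
lemma eq_idem_tmul_ev (s : ℤˣ) (t : SplitC ⊗[ℝ] Oct (-1)) :
    t = idem s ⊗ₜ[ℝ] ev s t + idem (-s) ⊗ₜ[ℝ] ev (-s) t := by
  induction t using TensorProduct.induction_on with
  | zero => simp
  | add a b ha hb =>
    rw [map_add, map_add, TensorProduct.tmul_add, TensorProduct.tmul_add]
    conv_lhs => rw [ha, hb]
    abel
  | tmul z x =>
    conv_lhs => rw [eq_chi_smul_idem s z, TensorProduct.add_tmul, TensorProduct.smul_tmul,
      TensorProduct.smul_tmul]
    rfl

lemma eq_zero_of_lam (s : ℤˣ) {φ : Tri SplitC} (h : ∀ i, lam s i φ = 0) : φ = 0 := by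
  have hs := units_sq s
  have hd : ∀ i, coef (i + 2) φ - coef i φ = 0 := fun i => by
    have := h i
    rw [lam_apply] at this
    linear_combination 3 * ((s : ℤ) : ℝ) * this - (coef (i + 2) φ - coef i φ) * hs
  have h0 := hd 0
  have h1 := hd 1
  have hsum := coef_sum φ
  rw [show (0 : Fin 3) + 2 = 2 from rfl] at h0
  rw [show (1 : Fin 3) + 2 = 0 from rfl] at h1
  refine tri_ext fun i => ?_
  rw [map_zero]
  fin_cases i <;> simp <;> linarith

/-- The witness has coefficients l (j + 1) - l j, and a third of the differences of these gives back
l when its sum is 0. -/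
lemma exists_lam (l : Fin 3 → ℝ) (hl : l 0 + l 1 + l 2 = 0) : ∃ φ, ∀ i, lam 1 i φ = l i := by
  refine ⟨∑ j, ((l (j + 1) - l j) / 6) • T j CompAlg.one L, fun i => ?_⟩
  rw [lam_apply, map_sum, map_sum, Fin.sum_univ_three, Fin.sum_univ_three]
  simp only [map_smul, coef_T, smul_eq_mul]
  fin_cases i <;> simp <;> linarith

lemma rep_diagUnit_fst (s : ℤˣ) (a : Su3 SplitC (Oct (-1))) (i j : Fin 3) :
    (rep s a (diagUnit j)).1 i = if i = j then 2 * lam s j a.1.1 else 0 := by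
  rw [rep_fst, diagUnit]
  by_cases h : i = j
  · subst h; simp
  · simp [h]

lemma rep_diagUnit_self (s : ℤˣ) (a : Su3 SplitC (Oct (-1))) (i : Fin 3) :
    (rep s a (diagUnit i)).2 i = -ev s (a.2 i) := by
  rw [rep_snd, diagUnit]
  simp

lemma rep_diagUnit_succ (s : ℤˣ) (a : Su3 SplitC (Oct (-1))) (i : Fin 3) :
    (rep s a (diagUnit (i + 1))).2 i = ev (-s) (a.2 i) := by
  rw [rep_snd, diagUnit]
  simp

/-- The images of the diagonal matrix units display 2λ and both octonions of every off-diagonal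
entry. Only the tri(𝕆) part of a remains invisible, and it acts on the off-diagonal entries of 𝔸. -/
lemma eq_of_rep_diagUnit {s : ℤˣ} {a : Su3 SplitC (Oct (-1))}
    (h : ∀ j, rep s a (diagUnit j) = 0) : a.1.1 = 0 ∧ a.2 = 0 := by
  refine ⟨eq_zero_of_lam s fun i => ?_, funext fun i => ?_⟩
  · have := rep_diagUnit_fst s a i i
    rw [h] at this
    simpa using this.symm
  · have h1 := rep_diagUnit_self s a i
    have h2 := rep_diagUnit_succ s a i
    rw [h] at h1 h2
    have h1 : ev s (a.2 i) = 0 := neg_eq_zero.1 h1.symm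
    have h2 : ev (-s) (a.2 i) = 0 := h2.symm
    change a.2 i = 0
    rw [eq_idem_tmul_ev s (a.2 i), h1, h2]
    simp

lemma rep_single (s : ℤˣ) {a : Su3 SplitC (Oct (-1))} (h1 : a.1.1 = 0) (h2 : a.2 = 0)
    (P : Albert) : rep s a P = (0, fun i => a.1.2.app i (P.2 i)) := by
  refine Prod.ext (funext fun i => ?_) (funext fun i => ?_)
  · simp [rep_fst, h1, h2]
  · simp [rep_snd, h1, h2]

lemma repHom_injective : Function.Injective repHom := by
  rw [injective_iff_map_eq_zero]
  intro a ha
  have ha : rep 1 a = 0 := congrArg Subtype.val ha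
  obtain ⟨h1, h2⟩ := eq_of_rep_diagUnit (s := 1) (a := a) fun j => by rw [ha]; rfl
  refine ext' (Prod.ext h1 (Tri.ext fun i x => ?_)) fun i => congrFun h2 i
  have h3 := rep_single 1 h1 h2 (0, Pi.single i x)
  rw [ha] at h3
  simpa using (congrFun (congrArg Prod.snd h3) i).symm

end E8

/-! ### The structure of an arbitrary element of 𝔰𝔩(3, 𝕆). -/

namespace Albert

open CompAlg

lemma polar_diagUnit (j : Fin 3) (P Q : Albert) : polar P (diagUnit j) Q =
    P.1 (j + 1) * Q.1 (j + 2) + P.1 (j + 2) * Q.1 (j + 1) -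
      2 * ip (P.2 (j + 1)) (Q.2 (j + 1)) := by
  rw [polar_eq, diagUnit]
  fin_cases j <;> simp [Fin.sum_univ_three]
  ring

lemma polar_single {i j k : Fin 3} (hj : j = i + 1) (hk : k = i + 2) (x y : Oct (-1))
    (V : Albert) :
    polar V (0, Pi.single i x) (0, Pi.single j y) = 2 * ip (tm x y) (V.2 k) := by
  subst hj hk
  rw [polar_eq]
  fin_cases i <;> simp [Fin.sum_univ_three, ip_comm]

variable {f : Module.End ℝ Albert}

lemma polar_map_self (hf : f ∈ sl3O) (P Q : Albert) : 2 * polar (f P) P Q + polar P P (f Q) = 0 := by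
  have := hf P P Q
  rw [polar_left P (f P)] at this
  linarith

/-- A diagonal unit e has rank one: the form vanishes at (e, e, ·). Differentiating this relation
forces most entries of f(e) to be 0. -/
lemma polar_map_diagUnit (hf : f ∈ sl3O) (j : Fin 3) (Q : Albert) : polar (f (diagUnit j)) (diagUnit j) Q = 0 := by
  have h := polar_map_self hf (diagUnit j) Q
  rw [polar_diagUnit j (diagUnit j)] at h
  simp [diagUnit] at h
  simpa [diagUnit] using h

lemma map_diagUnit_fst_succ (hf : f ∈ sl3O) (j : Fin 3) : (f (diagUnit j)).1 (j + 1) = 0 := by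
  have h := polar_map_diagUnit hf j (diagUnit (j + 2))
  rw [polar_diagUnit] at h
  simpa [diagUnit] using h

lemma map_diagUnit_fst_pred (hf : f ∈ sl3O) (j : Fin 3) : (f (diagUnit j)).1 (j + 2) = 0 := by
  have h := polar_map_diagUnit hf j (diagUnit (j + 1))
  rw [polar_diagUnit] at h
  simpa [diagUnit] using h

lemma map_diagUnit_snd_succ (hf : f ∈ sl3O) (j : Fin 3) : (f (diagUnit j)).2 (j + 1) = 0 := by
  refine Oct.eq_zero_of_ip (by norm_num) _ fun y => ?_
  have h := polar_map_diagUnit hf j (0, Pi.single (j + 1) y)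
  rw [polar_diagUnit] at h
  rw [ip_comm]
  simpa using h

/-- Invariance at the three diagonal units. -/
lemma map_diagUnit_trace (hf : f ∈ sl3O) :
    (f (diagUnit 0)).1 0 + (f (diagUnit 1)).1 1 + (f (diagUnit 2)).1 2 = 0 := by
  have h := hf (diagUnit 0) (diagUnit 1) (diagUnit 2)
  rw [polar_diagUnit, polar_left, polar_diagUnit, polar_right (diagUnit 0), polar_left (diagUnit 0),
    polar_diagUnit] at h
  simp [diagUnit] at h
  exact h

lemma polar_zero (P Q : Albert) : polar P 0 Q = 0 := by
  rw [← zero_smul ℝ (0 : Albert), polar_smul₂, zero_mul]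

/-- Pairing with two diagonal units reads off the third diagonal entry, and both units are killed by
f. -/
lemma map_fst (hf : f ∈ sl3O) (h0 : ∀ j, f (diagUnit j) = 0) (Q : Albert) : (f Q).1 = 0 := by
  have h : ∀ j : Fin 3, (f Q).1 (j + 2) = 0 := fun j => by
    have h := hf (diagUnit (j + 1)) (diagUnit j) Q
    rw [h0, h0, polar_zero, polar_left, polar_zero, polar_diagUnit] at h
    simpa [diagUnit] using h
  ext j
  have := h (j + 1)
  rwa [add_assoc, show (1 : Fin 3) + 2 = 0 from rfl, add_zero] at this

lemma map_skew (hf : f ∈ sl3O) (h0 : ∀ j, f (diagUnit j) = 0) (j : Fin 3) (P Q : Albert) :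
    ip ((f P).2 j) (Q.2 j) + ip (P.2 j) ((f Q).2 j) = 0 := by
  have h := hf P (diagUnit (j + 2)) Q
  rw [h0, polar_zero, polar_diagUnit, polar_diagUnit, map_fst hf h0, map_fst hf h0] at h
  rw [show j + 2 + 1 = j by rw [add_assoc, show (2 : Fin 3) + 1 = 0 from rfl, add_zero]] at h
  simp at h
  linarith

/-- By skewness f moves to the test vector, where it meets the vanishing entry of P. So f preserves
each off-diagonal position. -/
lemma map_snd_eq_zero (hf : f ∈ sl3O) (h0 : ∀ j, f (diagUnit j) = 0) (j : Fin 3) (P : Albert)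
    (hP : P.2 j = 0) : (f P).2 j = 0 := by
  refine Oct.eq_zero_of_ip (by norm_num) _ fun y => ?_
  have h := map_skew hf h0 j P (0, Pi.single j y)
  rw [hP, map_zero, LinearMap.zero_apply, add_zero] at h
  rw [ip_comm]
  simpa using h

lemma map_snd (hf : f ∈ sl3O) (h0 : ∀ j, f (diagUnit j) = 0) (j : Fin 3) (P : Albert) :
    (f P).2 j = (f (0, Pi.single j (P.2 j))).2 j := by
  have h := map_snd_eq_zero hf h0 j (P - (0, Pi.single j (P.2 j))) (by simp)
  rw [map_sub] at h
  exact sub_eq_zero.1 h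

/-- The element of the triality algebra given by an element of `𝔰𝔩(3, 𝕆)` that annihilates the
diagonal matrices. -/
def toTri (hf : f ∈ sl3O) (h0 : ∀ j, f (diagUnit j) = 0) : Tri (Oct (-1)) :=
  ⟨fun i => LinearMap.proj (R := ℝ) (φ := fun _ : Fin 3 => Oct (-1)) i ∘ₗ
      LinearMap.snd ℝ (Fin 3 → ℝ) _ ∘ₗ f ∘ₗ LinearMap.inr ℝ (Fin 3 → ℝ) _ ∘ₗ
      LinearMap.single ℝ (fun _ => Oct (-1)) i,
    fun i x y => by
      have h := map_skew hf h0 i (0, Pi.single i x) (0, Pi.single i y)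
      simpa using h,
    fun i x y => by
      change (f (0, Pi.single (i + 2) (tm x y))).2 (i + 2) =
        tm ((f (0, Pi.single i x)).2 i) y + tm x ((f (0, Pi.single (i + 1) y)).2 (i + 1))
      rw [← sub_eq_zero]
      refine Oct.eq_zero_of_ip (by norm_num) _ fun z => ?_
      have h1 := hf (0, Pi.single i x) (0, Pi.single (i + 1) y) (0, Pi.single (i + 2) z)
      have e1 : i = i + 1 + 2 := by rw [add_assoc, show (1 : Fin 3) + 2 = 0 from rfl, add_zero]
      have e2 : i = i + 2 + 1 := by rw [add_assoc, show (2 : Fin 3) + 1 = 0 from rfl, add_zero]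
      have e3 : i + 2 = i + 1 + 1 := by rw [add_assoc, show (1 : Fin 3) + 1 = 2 from rfl]
      have e4 : i + 1 = i + 2 + 2 := by rw [add_assoc, show (2 : Fin 3) + 2 = 1 from rfl]
      rw [polar_single e3 e1, polar_left, polar_right, polar_single e2 e4,
        polar_right (0, Pi.single i x), polar_left (0, Pi.single i x), polar_single rfl rfl] at h1
      have h2 := map_skew hf h0 (i + 2) (0, Pi.single (i + 2) z)
        (0, Pi.single (i + 2) (tm x y))
      simp only [Pi.single_eq_same] at h2
      rw [ip_comm (tm x y)] at h1
      rw [map_sub, map_add, ip_tm_rotate z _ y, ← ip_tm]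
      linarith⟩

end Albert

/-! ### The isomorphism of 𝔢₆ with 𝔰𝔩(3, 𝕆). -/

namespace E8

open CompAlg Su3 SplitC Albert

lemma repHom_surjective : Function.Surjective repHom := by
  rintro ⟨f, hf⟩
  -- Halved because diag(λ) multiplies the i-th diagonal unit by 2λ_i; the trace relation makes the
  -- sum 0.
  obtain ⟨φ, hφ⟩ := exists_lam (fun i => (f (diagUnit i)).1 i / 2) (by
    have := map_diagUnit_trace hf
    linarith)
  -- The position i of the image is met by the diagonal units i and i + 1, through -`ev 1` and `ev
  -- (-1)`. These are independent, so both can be prescribed.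
  let a : Su3 SplitC (Oct (-1)) := ((φ, 0), fun i => idem 1 ⊗ₜ[ℝ] (-(f (diagUnit i)).2 i) +
    idem (-1) ⊗ₜ[ℝ] (f (diagUnit (i + 1))).2 i)
  have ha1 : ∀ i, ev 1 (a.2 i) = -(f (diagUnit i)).2 i := fun i => by
    have h := chi_neg_idem (-1)
    rw [neg_neg] at h
    rw [map_add, ev_tmul, ev_tmul, chi_idem, h]
    simp
  have ha2 : ∀ i, ev (-1) (a.2 i) = (f (diagUnit (i + 1))).2 i := fun i => by
    rw [map_add, ev_tmul, ev_tmul, chi_idem, chi_neg_idem]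
    simp
  have hj : ∀ j i : Fin 3, i = j ∨ i = j + 1 ∨ i = j + 2 := by decide
  have hrep : ∀ j, rep 1 a (diagUnit j) = f (diagUnit j) := fun j => by
    refine Prod.ext (funext fun i => ?_) (funext fun i => ?_)
    · rw [rep_diagUnit_fst, hφ]
      rcases hj j i with rfl | rfl | rfl
      · rw [if_pos rfl]
        ring
      · rw [map_diagUnit_fst_succ hf]
        simp
      · rw [map_diagUnit_fst_pred hf]
        simp
    · rcases hj j i with rfl | rfl | rfl
      · rw [rep_diagUnit_self, ha1, neg_neg]
      · rw [map_diagUnit_snd_succ hf, rep_snd, diagUnit]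
        simp [add_assoc]
      · have h := rep_diagUnit_succ 1 a (j + 2)
        rw [add_assoc, show (2 : Fin 3) + 1 = 0 from rfl, add_zero, ha2, add_assoc,
          show (2 : Fin 3) + 1 = 0 from rfl, add_zero] at h
        exact h
  have hg : f - rep 1 a ∈ sl3O := sl3O.sub_mem hf (rep_mem a)
  have h0 : ∀ j, (f - rep 1 a) (diagUnit j) = 0 := fun j => by
    rw [LinearMap.sub_apply, hrep, sub_self]
  -- The difference kills the diagonal units, so invariance of the cubic form makes it a triality
  -- triple.
  let b : Su3 SplitC (Oct (-1)) := ((0, toTri hg h0), 0)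
  refine ⟨a + b, Subtype.ext (LinearMap.ext fun P => ?_)⟩
  change rep 1 (a + b) P = f P
  rw [map_add, LinearMap.add_apply, ← eq_sub_iff_add_eq', rep_single 1 rfl rfl]
  refine Prod.ext (map_fst hg h0 P).symm (funext fun i => ?_)
  exact (map_snd hg h0 i P).symm

end E8

namespace E8

open CompAlg Su3 SplitC Albert

/-- The image of the identity matrix has diagonal 2λ and off-diagonal entries `ev (-1)` - `ev 1`. It
vanishes exactly when the tri(ℂ') part is 0 and every entry lies in 1 ⊗ 𝕆. -/
lemma su3Incl_mem_f4_iff (b : Su3 SplitC (Oct (-1))) :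
    su3Incl b ∈ f4 ↔ rep 1 b Albert.one = 0 := by
  rw [mem_f4_iff]
  constructor
  · rintro ⟨h1, o, h2⟩
    have h1 : b.1.1 = 0 := triIncl_injective (h1.trans (map_zero triIncl).symm)
    have h2 : ∀ i, b.2 i = CompAlg.one ⊗ₜ[ℝ] o i := fun i => inclT_injective (by
      rw [inclT_tmul, incl_one, ← h2]
      rfl)
    have h3 : ∀ s i, ev s (b.2 i) = o i := fun s i => by
      rw [h2, ev_tmul]
      simp [chi_apply]
    refine Prod.ext (funext fun i => ?_) (funext fun i => ?_)
    · simp [rep_fst, Albert.one, h1]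
    · simp [rep_snd, Albert.one, h3]
  · intro h
    have h1 : b.1.1 = 0 := eq_zero_of_lam 1 fun i => by
      have h1 := congrFun (congrArg Prod.fst h) i
      rw [rep_fst] at h1
      simpa [Albert.one] using h1
    refine ⟨(congrArg triIncl h1).trans (map_zero triIncl), fun i => ev 1 (b.2 i), fun i => ?_⟩
    have h2 : ev (-1) (b.2 i) = ev 1 (b.2 i) := by
      have h2 := congrFun (congrArg Prod.snd h) i
      rw [rep_snd] at h2
      simpa [Albert.one, sub_eq_zero] using h2
    have h3 : b.2 i = CompAlg.one ⊗ₜ[ℝ] ev 1 (b.2 i) := by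
      conv_lhs => rw [eq_idem_tmul_ev 1 (b.2 i), h2, ← TensorProduct.add_tmul]
      congr 1
      ext1 <;> simp [idem] <;> norm_num
    rw [su3Incl_snd]
    conv_lhs => rw [h3, inclT_tmul, incl_one]

/-- The isomorphism `𝔢₆ ≅ 𝔰𝔩(3, 𝕆)`. -/
def e6Equiv : e6 ≃ₗ⁅ℝ⁆ sl3O :=
  su3Equiv.symm.trans (LieEquiv.ofBijective repHom ⟨repHom_injective, repHom_surjective⟩)

lemma coe_e6Equiv (a : e6) : (e6Equiv a : Module.End ℝ Albert) = rep 1 (su3Equiv.symm a) := rfl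

lemma su3Incl_symm (a : e6) : su3Incl (su3Equiv.symm a) = a := by
  rw [← coe_su3Equiv, LieEquiv.apply_symm_apply]

/-- The parametrization of the subspaces `H n s` by the Albert algebra. -/
def thetaEquiv (n : Fin 3) (s : ℤˣ) : Albert ≃ₗ[ℝ] H n s :=
  (LinearEquiv.ofInjective (thetaNull n s) (thetaNull_injective n s)).trans
    (LinearEquiv.ofEq _ _ (range_thetaNull n s))

lemma coe_thetaEquiv (n : Fin 3) (s : ℤˣ) (P : Albert) :
    (thetaEquiv n s P : E8) = thetaNull n s P := rfl

lemma thetaEquiv_symm_lie (n : Fin 3) (s : ℤˣ) (a : e6) (x y : H n s)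
    (h : (y : E8) = ⁅(a : E8), (x : E8)⁆) :
    (thetaEquiv n s).symm y = rep s (su3Equiv.symm a) ((thetaEquiv n s).symm x) := by
  rw [LinearEquiv.symm_apply_eq]
  refine Subtype.ext ?_
  rw [h, coe_thetaEquiv, ← lie_thetaNull, su3Incl_symm, ← coe_thetaEquiv,
    LinearEquiv.apply_symm_apply]

/-- The identification of the Albert algebra with its dual. -/
def pairEquiv : Albert ≃ₗ[ℝ] Module.Dual ℝ Albert :=
  LinearEquiv.ofInjectiveOfFinrankEq pair pair_injective (Subspace.dual_finrank_eq).symm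

lemma pairEquiv_apply (P : Albert) : pairEquiv P = pair P := rfl

/-- The names of the summands, as iterated options. -/
def pieceEquiv : Option (Option (Fin 3 × ℤˣ)) ≃ Piece where
  toFun
    | none => .e6
    | some none => .sl3
    | some (some (n, s)) => .H n s
  invFun
    | .e6 => none
    | .sl3 => some none
    | .H n s => some (some (n, s))
  left_inv := by rintro (_ | _ | ⟨n, s⟩) <;> rfl
  right_inv := by rintro (_ | _ | ⟨n, s⟩) <;> rfl

instance : Fintype Piece := Fintype.ofEquiv _ pieceEquiv

lemma iSup_piece : ⨆ p, piece p = ⊤ := by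
  rw [eq_top_iff, ← span_gen248]
  refine Submodule.span_le.2 ?_
  rintro _ ⟨x | x | ⟨⟨Q, hQ⟩, x⟩, rfl⟩
  · exact Submodule.mem_iSup_of_mem .e6 (Submodule.subset_span ⟨x, rfl⟩)
  · exact Submodule.mem_iSup_of_mem .sl3 (Submodule.subset_span ⟨x, rfl⟩)
  · have h1 : ∀ n, W (base n).1 ⊔ W (base n).2 ≤ ⨆ p, piece p := fun n => by
      rw [← H_sup_H]
      exact sup_le (le_iSup piece (.H n 1)) (le_iSup piece (.H n (-1)))
    obtain ⟨n, hn⟩ := exists_base hQ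
    refine h1 n ?_
    rcases hn with rfl | rfl
    · exact Submodule.mem_sup_left (Submodule.subset_span ⟨x, rfl⟩)
    · exact Submodule.mem_sup_right (Submodule.subset_span ⟨x, rfl⟩)

/-- The pieces span 𝔢₈ and their dimensions 78 + 8 + 6·27 add up to 248, so the surjective sum map
is injective. -/
lemma isInternal_piece : DirectSum.IsInternal piece := by
  have hs : Function.Surjective (DirectSum.coeLinearMap piece) := by
    rw [← LinearMap.range_eq_top, DirectSum.range_coeLinearMap, iSup_piece]
  have hr : Module.finrank ℝ (DirectSum Piece fun p => piece p) = Module.finrank ℝ E8 := by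
    rw [Module.finrank_directSum, ← Equiv.sum_comp pieceEquiv, Fintype.sum_option,
      Fintype.sum_option, finrank_eq]
    have h1 : Module.finrank ℝ (piece (pieceEquiv none)) = 78 := by
      have := finrank_e6
      change Module.finrank ℝ e6.toSubmodule = 78 at this
      rwa [e6_eq_span] at this
    have h2 : Module.finrank ℝ (piece (pieceEquiv (some none))) = 8 := by
      have := finrank_centralizer
      change Module.finrank ℝ (lieCentralizer e6).toSubmodule = 8 at this
      rwa [centralizer_eq_span] at this
    have h3 : ∀ x, Module.finrank ℝ (piece (pieceEquiv (some (some x)))) = 27 :=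
      fun x => finrank_H x.1 x.2
    simp only [h1, h2, h3]
    simp
  exact ⟨(LinearMap.injective_iff_surjective_of_finrank_eq_finrank hr).2 hs, hs⟩

end E8

end

theorem mainTheorem2 :
    -- the generators form a basis of the 248-dimensional algebra
    (LinearIndependent ℝ (Sum.elim E8.gen78 (Sum.elim E8.gen8
        fun x : {Q : ImUnit // Q ≠ .l} × E8.Idx27 => E8.gen27 x.1 x.2)) ∧
      Submodule.span ℝ (Set.range (Sum.elim E8.gen78 (Sum.elim E8.gen8
        fun x : {Q : ImUnit // Q ≠ .l} × E8.Idx27 => E8.gen27 x.1 x.2))) = ⊤ ∧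
      Module.finrank ℝ E8 = 248) ∧
    -- the 28 and the 52 generators close; the former span a copy of `𝔰𝔬(8)`
    (E8.so8.toSubmodule = Submodule.span ℝ (Set.range E8.gen28) ∧
      Module.finrank ℝ E8.so8 = 28 ∧
      Nonempty (E8.so8 ≃ₗ⁅ℝ⁆
        skewAdjointLieSubalgebra (CompAlg.ip : Oct (-1) →ₗ[ℝ] Oct (-1) →ₗ[ℝ] ℝ)) ∧
      E8.f4.toSubmodule = Submodule.span ℝ (Set.range E8.gen52) ∧
      Module.finrank ℝ E8.f4 = 52) ∧
    -- the 78 generators close, and their span is `𝔰𝔲(3, ℂ' ⊗ 𝕆)`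
    (E8.e6.toSubmodule = Submodule.span ℝ (Set.range E8.gen78) ∧
      Module.finrank ℝ E8.e6 = 78 ∧
      ∃ ψ : Su3 SplitC (Oct (-1)) ≃ₗ⁅ℝ⁆ E8.e6, ∀ i t,
        (ψ (Su3.offDiag i t) : E8) =
          Su3.offDiag i (LinearMap.rTensor (Oct (-1)) SplitC.incl t)) ∧
    -- the centralizer
    ((lieCentralizer E8.e6).toSubmodule = Submodule.span ℝ (Set.range E8.gen8) ∧
      Module.finrank ℝ (lieCentralizer E8.e6) = 8 ∧
      Nonempty (lieCentralizer E8.e6 ≃ₗ⁅ℝ⁆ LieAlgebra.SpecialLinear.sl (Fin 3) ℝ) ∧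
      (∀ x ∈ lieCentralizer E8.e6, ∃ d, E8.IsDer d ∧ d (ImUnit.l.toOct 1) = 0 ∧
        E8.IsDerElem x d) ∧
      (∀ d, E8.IsDer d → d (ImUnit.l.toOct 1) = 0 →
        ∃ x ∈ lieCentralizer E8.e6, E8.IsDerElem x d)) ∧
    -- the decomposition `248 = 78 + 8 + 6 × 27`
    (DirectSum.IsInternal E8.piece ∧
      (∀ n s, Module.finrank ℝ (E8.H n s) = 27) ∧
      (∀ n, E8.H n 1 ⊔ E8.H n (-1) = E8.W (E8.base n).1 ⊔ E8.W (E8.base n).2) ∧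
      (∀ Q : ImUnit, Q ≠ .l → Module.finrank ℝ (E8.W Q) = 27 ∧
        ∀ a ∈ E8.f4, ∀ x ∈ E8.W Q, ⁅a, x⁆ ∈ E8.W Q) ∧
      (∀ n s, ∀ a ∈ E8.e6, ∀ x ∈ E8.H n s, ⁅a, x⁆ ∈ E8.H n s) ∧
      (∀ s, ∀ c ∈ lieCentralizer E8.e6, ∀ x ∈ ⨆ n, E8.H n s, ⁅c, x⁆ ∈ ⨆ n, E8.H n s)) ∧
    -- `𝔢₆ ≅ 𝔢₆₍₋₂₆₎`, with `𝔣₄` the annihilator of the identity matrix, and the six subspaces are copies of the Albert algebra or of its dual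
    ∃ φ : E8.e6 ≃ₗ⁅ℝ⁆ Albert.sl3O,
      (∀ a : E8.e6, (a : E8) ∈ E8.f4 ↔ (φ a : Module.End ℝ Albert) Albert.one = 0) ∧
      (∀ n, ∃ θ : E8.H n 1 ≃ₗ[ℝ] Albert, ∀ (a : E8.e6) (x y : E8.H n 1),
        (y : E8) = ⁅(a : E8), (x : E8)⁆ → θ y = (φ a : Module.End ℝ Albert) (θ x)) ∧
      (∀ n, ∃ θ : E8.H n (-1) ≃ₗ[ℝ] Module.Dual ℝ Albert, ∀ (a : E8.e6) (x y : E8.H n (-1)),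
        (y : E8) = ⁅(a : E8), (x : E8)⁆ →
          θ y = -(θ x ∘ₗ (φ a : Module.End ℝ Albert))) := by
  refine ⟨⟨E8.linearIndependent_gen248, E8.span_gen248, E8.finrank_eq⟩,
    ⟨by rw [E8.so8_eq, E8.so8Sub_eq_span], E8.finrank_so8, E8.so8_equiv,
      by rw [E8.f4_eq, E8.f4Sub_eq_span], E8.finrank_f4⟩,
    ⟨E8.e6_eq_span, E8.finrank_e6, E8.su3Equiv, E8.su3Incl_offL⟩,
    ⟨E8.centralizer_eq_span, E8.finrank_centralizer, ⟨E8.centralizerEquiv⟩,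
      E8.centralizer_isDer, E8.isDer_centralizer⟩,
    ⟨E8.isInternal_piece, E8.finrank_H, E8.H_sup_H,
      fun Q hQ => ⟨E8.finrank_W Q hQ, E8.lie_mem_W Q hQ⟩, E8.lie_mem_H, E8.lie_mem_iSup_H⟩,
    E8.e6Equiv, fun a => ?_, fun n => ⟨(E8.thetaEquiv n 1).symm, E8.thetaEquiv_symm_lie n 1⟩,
    fun n => ⟨(E8.thetaEquiv n (-1)).symm.trans E8.pairEquiv, fun a x y h => ?_⟩⟩
  · rw [E8.coe_e6Equiv, ← E8.su3Incl_mem_f4_iff, E8.su3Incl_symm]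
  · refine LinearMap.ext fun Q => ?_
    -- The module of sign -1 carries `rep (-1)`, which the pairing turns into the dual of `rep 1`.
    have hp := E8.pair_rep (-1) (E8.su3Equiv.symm a) ((E8.thetaEquiv n (-1)).symm x) Q
    rw [neg_neg] at hp
    rw [LinearEquiv.trans_apply, LinearEquiv.trans_apply, E8.thetaEquiv_symm_lie n (-1) a x y h,
      E8.pairEquiv_apply, E8.pairEquiv_apply, E8.coe_e6Equiv]
    exact eq_neg_of_add_eq_zero_left hp
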